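/- Let $n\ge 2$, $1<p<\infty$, $1<s\le\infty$, and write $p'=\frac{p}{p-1}$, $s'=\frac{s}{s-1}$ (with $s'=1$ and $\frac{s}{s-p}=1$ if $s=\infty$). Let $\Omega\in L_s(S^{n-1})$ be homogeneous of degree zero, and let $w$ be a weight on $\mathbb R^n$ (locally integrable, with values in $(0,\infty)$ almost everywhere); $w(E)=\int_E w$, $\|f\|_{L_{p,w}(B)}=(\int_B|f|^pw)^{1/p}$, $L_p(w)$ is the space of measurable $f$ with $\|f\|_{L_{p,w}(\mathbb R^n)}<\infty$, and $A_q$ denotes the Muckenhoupt classes. For a positive measurable function $\varphi$ on $\mathbb R^n\times(0,\infty)$ let $M_{p,\varphi}(w)$ be the space of all $f\in L_{p,w}^{\rm loc}(\mathbb R^n)$ with $$\|f\|_{M_{p,\varphi}(w)}=\sup_{x\in\mathbb R^n,\,r>0}\varphi(x,r)^{-1}w(B(x,r))^{-1/p}\|f\|_{L_{p,w}(B(x,r))}<\infty .$$ Let $\varphi_1,\varphi_2$ be positive measurable functions on $\mathbb R^n\times(0,\infty)$, let $b\in BMO(\mathbb R^n)$ with seminorm $\|b\|_*=\sup_B\frac1{|B|}\int_B|b-b_B|$,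 and let $T_{\Omega,b}$ be a sublinear operator ($|T(f+g)|\le|Tf|+|Tg|$ and $|T(cf)|=|c||Tf|$ almost everywhere), defined on a vector space $D$ of functions that contains $L_p(w)$ and $M_{p,\varphi_1}(w)$, with measurable functions as values, such that for every $f\in D$ and almost every $x\notin\operatorname{supp}f$ $$|T_{\Omega,b}f(x)|\le c_0\int_{\mathbb R^n}|b(x)-b(y)|\,\frac{|\Omega(x-y)|}{|x-y|^n}\,|f(y)|\,dy .$$ Suppose that $T_{\Omega,b}$ is bounded on $L_p(w)$, and that one of the following holds, with $C$ independent of $x\in\mathbb R^n$ and $r>0$: (i) $s'\le p$, $w\in A_{p/s'}$, and $$\int_r^\infty\Big(1+\ln\frac tr\Big)\frac{\operatorname*{ess\,inf}_{t<\tau<\infty}\varphi_1(x,\tau)\,w(B(x,\tau))^{1/p}}{w(B(x,t))^{1/p}}\,\frac{dt}t\le C\,\varphi_2(x,r);$$ (ii) $p<s$, $w^{1-p'}\in A_{p'/s'}$, and $$\int_r^\infty\Big(1+\ln\frac tr\Big)\frac{\operatorname*{ess\,inf}_{t<\tau<\infty}\varphi_1(x,\tau)\,w(B(x,\tau))^{1/p}}{\|w\|_{L_{s/(s-p)}(B(x,t))}^{1/p}}\,\frac{dt}t\le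 C\,\varphi_2(x,r)\,\frac{w(B(x,r))^{1/p}}{\|w\|_{L_{s/(s-p)}(B(x,r))}^{1/p}} .$$ Then $T_{\Omega,b}$ is bounded from $M_{p,\varphi_1}(w)$ to $M_{p,\varphi_2}(w)$. Moreover, if the bound of $T_{\Omega,b}$ on $L_p(w)$ is of the form $\|T_{\Omega,b}f\|_{L_p(w)}\le A\|b\|_*\|f\|_{L_p(w)}$, then $$\|T_{\Omega,b}f\|_{M_{p,\varphi_2}(w)}\le K\,\|b\|_*\,\|f\|_{M_{p,\varphi_1}(w)}\qquad\text{for all } f\in M_{p,\varphi_1}(w),$$ where $K$ depends only on $n,p,s,\Omega,w,c_0,A,C$ (and not on $b$, $T_{\Omega,b}$, $\varphi_1$, $\varphi_2$, $f$). -/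

import Mathlib

open MeasureTheory Metric Set
open scoped ENNReal NNReal

noncomputable section

namespace RoughMorrey

/-- A weight on `ℝⁿ`: a locally integrable function with values in `(0, ∞)` almost everywhere. -/
structure IsWeight {n : ℕ} (w : EuclideanSpace ℝ (Fin n) → ℝ≥0∞) : Prop where
  aemeasurable : AEMeasurable w volume
  pos_lt_top : ∀ᵐ x, 0 < w x ∧ w x < ∞
  locallyIntegrable : ∀ (x : EuclideanSpace ℝ (Fin n)) (r : ℝ), ∫⁻ y in ball x r, w y < ∞

/-- The characteristic constant `[w]_{A_q}`, `1 < q < ∞`: the supremum over all balls `B` of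
`(|B|⁻¹ ∫_B w) (|B|⁻¹ ∫_B w^{1-q'})^{q-1}`, with `1 - q' = 1 - q / (q - 1)`. -/
def apConst {n : ℕ} (q : ℝ) (w : EuclideanSpace ℝ (Fin n) → ℝ≥0∞) : ℝ≥0∞ :=
  ⨆ (x : EuclideanSpace ℝ (Fin n)) (r : ℝ) (_ : 0 < r),
    (⨍⁻ y in ball x r, w y ∂volume) * (⨍⁻ y in ball x r, w y ^ (1 - q / (q - 1)) ∂volume) ^ (q - 1)

/-- The Muckenhoupt class `A_q`, `1 ≤ q < ∞`. For `q = 1` the condition is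
`|B|⁻¹ ∫_B w ≤ C essinf_B w` for all balls `B`. -/
def MemAp {n : ℕ} (q : ℝ) (w : EuclideanSpace ℝ (Fin n) → ℝ≥0∞) : Prop :=
  IsWeight w ∧
    ((1 < q ∧ apConst q w < ∞) ∨
      (q = 1 ∧ ∃ C : ℝ≥0, ∀ (x : EuclideanSpace ℝ (Fin n)) (r : ℝ), 0 < r →
        ⨍⁻ y in ball x r, w y ∂volume ≤ C * essInf w (volume.restrict (ball x r))))

/-- `w(B(x, r)) = ∫_{B(x, r)} w`. -/
def wBall {n : ℕ} (w : EuclideanSpace ℝ (Fin n) → ℝ≥0∞) (x : EuclideanSpace ℝ (Fin n))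
    (r : ℝ) : ℝ≥0∞ :=
  ∫⁻ y in ball x r, w y

/-- `‖w‖_{L_q(B(x, r))}` (unweighted), `1 ≤ q < ∞`. -/
def lpBall {n : ℕ} (q : ℝ) (w : EuclideanSpace ℝ (Fin n) → ℝ≥0∞)
    (x : EuclideanSpace ℝ (Fin n)) (r : ℝ) : ℝ≥0∞ :=
  (∫⁻ y in ball x r, w y ^ q) ^ (1 / q)

/-- `φ` is a positive measurable function on `ℝⁿ × (0, ∞)`. -/
structure IsMorreyFunction {n : ℕ} (φ : EuclideanSpace ℝ (Fin n) → ℝ → ℝ) : Prop where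
  pos : ∀ x r, 0 < r → 0 < φ x r
  measurable : Measurable fun z : EuclideanSpace ℝ (Fin n) × Ioi (0 : ℝ) => φ z.1 z.2

/-- `‖f‖_{L_{p,w}(B(x, r))} = (∫_{B(x, r)} |f|^p w)^{1/p}`. -/
def lpwBall {n : ℕ} {𝕜 : Type*} [RCLike 𝕜] (p : ℝ) (w : EuclideanSpace ℝ (Fin n) → ℝ≥0∞)
    (f : EuclideanSpace ℝ (Fin n) → 𝕜) (x : EuclideanSpace ℝ (Fin n)) (r : ℝ) : ℝ≥0∞ :=
  eLpNorm f (ENNReal.ofReal p) ((volume.withDensity w).restrict (ball x r))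

/-- The norm of the generalized weighted Morrey space `M_{p,φ}(w)`:
`sup_{x, r > 0} φ(x, r)⁻¹ w(B(x, r))^{-1/p} ‖f‖_{L_{p,w}(B(x, r))}`. -/
def morreyNorm {n : ℕ} {𝕜 : Type*} [RCLike 𝕜] (p : ℝ) (φ : EuclideanSpace ℝ (Fin n) → ℝ → ℝ)
    (w : EuclideanSpace ℝ (Fin n) → ℝ≥0∞) (f : EuclideanSpace ℝ (Fin n) → 𝕜) : ℝ≥0∞ :=
  ⨆ (x : EuclideanSpace ℝ (Fin n)) (r : ℝ) (_ : 0 < r),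
    (ENNReal.ofReal (φ x r))⁻¹ * wBall w x r ^ (-(1 / p)) * lpwBall p w f x r

/-- `f ∈ M_{p,φ}(w)`: `f` is measurable, locally in `L_{p,w}`, and of finite Morrey norm. -/
structure MemMorrey {n : ℕ} {𝕜 : Type*} [RCLike 𝕜] (p : ℝ)
    (φ : EuclideanSpace ℝ (Fin n) → ℝ → ℝ) (w : EuclideanSpace ℝ (Fin n) → ℝ≥0∞)
    (f : EuclideanSpace ℝ (Fin n) → 𝕜) : Prop where
  aestronglyMeasurable : AEStronglyMeasurable f volume
  locallyLp : ∀ x r, 0 < r → lpwBall p w f x r < ∞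
  norm_lt_top : morreyNorm p φ w f < ∞

/-- The seminorm `‖b‖_* = sup_B |B|⁻¹ ∫_B |b - b_B|`. -/
def bmoNorm {n : ℕ} {𝕜 : Type*} [RCLike 𝕜] (b : EuclideanSpace ℝ (Fin n) → 𝕜) : ℝ≥0∞ :=
  ⨆ (x : EuclideanSpace ℝ (Fin n)) (r : ℝ) (_ : 0 < r),
    ⨍⁻ y in ball x r, ‖b y - ⨍ z in ball x r, b z‖ₑ ∂volume

/-- `b ∈ BMO(ℝⁿ)`. -/
def MemBMO {n : ℕ} {𝕜 : Type*} [RCLike 𝕜] (b : EuclideanSpace ℝ (Fin n) → 𝕜) : Prop :=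
  LocallyIntegrable b volume ∧ bmoNorm b < ∞

/-- `Ω` is homogeneous of degree zero on `ℝⁿ ∖ {0}` and its restriction to the unit sphere is in
`L_s(S^{n-1})`. (The surface measure is not normalized, which does not affect membership.) -/
structure IsRoughKernel {n : ℕ} {𝕜 : Type*} [RCLike 𝕜] (s : ℝ≥0∞)
    (Ω : EuclideanSpace ℝ (Fin n) → 𝕜) : Prop where
  homogeneous : ∀ (μ : ℝ) (x : EuclideanSpace ℝ (Fin n)), 0 < μ → x ≠ 0 → Ω (μ • x) = Ω x
  memLp : MemLp (fun x : sphere (0 : EuclideanSpace ℝ (Fin n)) 1 => Ω x) s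
    (volume : Measure (EuclideanSpace ℝ (Fin n))).toSphere

/-- `T` is a sublinear operator from the vector space `D` of functions to measurable functions:
`|T(f + g)| ≤ |T f| + |T g|` and `|T(c f)| = |c| |T f|` almost everywhere. Values of `T` outside
`D` are irrelevant. -/
structure IsSublinearOn {n : ℕ} {𝕜 : Type*} [RCLike 𝕜]
    (D : Submodule 𝕜 (EuclideanSpace ℝ (Fin n) → 𝕜))
    (T : (EuclideanSpace ℝ (Fin n) → 𝕜) → EuclideanSpace ℝ (Fin n) → 𝕜) : Prop where
  aestronglyMeasurable : ∀ f ∈ D, AEStronglyMeasurable (T f) volume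
  add_le : ∀ f ∈ D, ∀ g ∈ D, ∀ᵐ x, ‖T (f + g) x‖ ≤ ‖T f x‖ + ‖T g x‖
  smul_eq : ∀ (c : 𝕜), ∀ f ∈ D, ∀ᵐ x, ‖T (c • f) x‖ = ‖c‖ * ‖T f x‖

/-- The commutator size condition on `D` with constant `c₀`: for `f ∈ D` and (almost every)
`x ∉ supp f`, `|T f(x)| ≤ c₀ ∫ |b(x) - b(y)| |Ω(x - y)| |x - y|^{-n} |f(y)| dy`. -/
def CommutatorSizeCondition {n : ℕ} {𝕜 : Type*} [RCLike 𝕜]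
    (Ω b : EuclideanSpace ℝ (Fin n) → 𝕜) (c₀ : ℝ≥0)
    (D : Submodule 𝕜 (EuclideanSpace ℝ (Fin n) → 𝕜))
    (T : (EuclideanSpace ℝ (Fin n) → 𝕜) → EuclideanSpace ℝ (Fin n) → 𝕜) : Prop :=
  ∀ f ∈ D, ∀ᵐ x, x ∉ tsupport f →
    ‖T f x‖ₑ ≤ c₀ * ∫⁻ y, ‖b x - b y‖ₑ * (‖Ω (x - y)‖ₑ / ENNReal.ofReal (‖x - y‖ ^ n)) * ‖f y‖ₑ

/-- `T` is bounded on `L_p(w)` with constant `N`. -/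
def BoundedOnLpw {n : ℕ} {𝕜 : Type*} [RCLike 𝕜] (p : ℝ)
    (w : EuclideanSpace ℝ (Fin n) → ℝ≥0∞)
    (T : (EuclideanSpace ℝ (Fin n) → 𝕜) → EuclideanSpace ℝ (Fin n) → 𝕜) (N : ℝ≥0∞) : Prop :=
  ∀ f, MemLp f (ENNReal.ofReal p) (volume.withDensity w) →
    MemLp (T f) (ENNReal.ofReal p) (volume.withDensity w) ∧
      eLpNorm (T f) (ENNReal.ofReal p) (volume.withDensity w) ≤
        N * eLpNorm f (ENNReal.ofReal p) (volume.withDensity w)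

/-- `essinf_{t < τ < ∞} φ(x, τ) w(B(x, τ))^{1/p}`. -/
def essInfTail {n : ℕ} (p : ℝ) (φ : EuclideanSpace ℝ (Fin n) → ℝ → ℝ)
    (w : EuclideanSpace ℝ (Fin n) → ℝ≥0∞) (x : EuclideanSpace ℝ (Fin n)) (t : ℝ) : ℝ≥0∞ :=
  essInf (fun τ : ℝ => ENNReal.ofReal (φ x τ) * wBall w x τ ^ (1 / p)) (volume.restrict (Ioi t))

/-- The Zygmund-type condition
`∫_r^∞ (1 + ln(t/r)) (essinf_{t<τ<∞} φ₁(x,τ) w(B(x,τ))^{1/p}) / w(B(x,t))^{1/p} dt/t ≤ C φ₂(x,r)`. -/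
def ZygmundCondition {n : ℕ} (p : ℝ) (w : EuclideanSpace ℝ (Fin n) → ℝ≥0∞)
    (φ₁ φ₂ : EuclideanSpace ℝ (Fin n) → ℝ → ℝ) (C : ℝ≥0) : Prop :=
  ∀ x r, 0 < r →
    ∫⁻ t in Ioi r, ENNReal.ofReal (1 + Real.log (t / r)) *
        (essInfTail p φ₁ w x t / wBall w x t ^ (1 / p)) / ENNReal.ofReal t
      ≤ C * ENNReal.ofReal (φ₂ x r)

/-- The Zygmund-type condition, with `q = s / (s - p)`,
`∫_r^∞ (1 + ln(t/r)) (essinf_{t<τ<∞} φ₁(x,τ) w(B(x,τ))^{1/p}) / ‖w‖_{L_q(B(x,t))}^{1/p} dt/t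
  ≤ C φ₂(x,r) w(B(x,r))^{1/p} / ‖w‖_{L_q(B(x,r))}^{1/p}`. -/
def ZygmundConditionLp {n : ℕ} (p q : ℝ) (w : EuclideanSpace ℝ (Fin n) → ℝ≥0∞)
    (φ₁ φ₂ : EuclideanSpace ℝ (Fin n) → ℝ → ℝ) (C : ℝ≥0) : Prop :=
  ∀ x r, 0 < r →
    ∫⁻ t in Ioi r, ENNReal.ofReal (1 + Real.log (t / r)) *
        (essInfTail p φ₁ w x t / lpBall q w x t ^ (1 / p)) / ENNReal.ofReal t
      ≤ C * ENNReal.ofReal (φ₂ x r) * (wBall w x r ^ (1 / p) / lpBall q w x r ^ (1 / p))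

end RoughMorrey

end

/-! Fix a ball B(x₀, r) and split f at B(x₀, 2r). The inner part is controlled by the bound on
L_p(w). For the outer part, x ∈ B(x₀, r) and y ∉ B(x₀, 2r) force |x₀ - y| ≤ 2|x - y|, so |x -
y|^{-n} is at most a constant times the integral of dt / (t |B(x₀, t)|) over t > |x₀ - y|. By Fubini
and Minkowski the size condition becomes an integral over t > r of the L_{p,w}(B(x₀, r)) norms of
∫_{B(x₀,t)} |b(x) - b(y)| |Ω(x - y)| |f(y)| dy (`lintegral_compl_ball_le`,
`LocalCommutatorBound.tail_le`).

The core is a bound for each of these norms, `LocalCommutatorBound`, with a gauge U: U = w(B)^{1/p}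
in case (i) and U = ‖w‖_{L_{s/(s-p)}(B)}^{1/p} in case (ii). With the doubling of U it gives, up to
a constant, ‖Tf‖_{L_{p,w}(B(x₀,r))} ≤ U(r) ∫_r^∞ (1 + ln(t/r)) ‖f‖_{L_{p,w}(B(x₀,t))} / U(t) dt/t
(`lpwBall_apply_le`). Local norms increase with the radius, hence are at most the Morrey norm times
the essential infimum in the Zygmund condition (`lpwBall_le_essInfTail`), and that condition
concludes.

For the core bound, |b(x) - b(y)| is split about the constant of B(x₀, r). Moments of the
oscillation against weights come from a John–Nirenberg inequality for A_∞ measures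
(`IsAInfty.exists_lintegral_exp_le`), proved by dyadic stopping times; the logarithm is the cost of
comparing averages over concentric balls. There are three regimes. If s' < p, Hölder puts the kernel
in L_s and uses w together with its A_{p/s'} dual (`localCommutatorBound_of_lt`). If s' = p, then w
∈ A_1 and Hölder leaves no room for the factor in b(y). The part of the oscillation above a multiple
of 1 + ln(t/r) is then exponentially rare, with moments on B(x₀, t) only of size |B(x₀, r)|, and a
Young-type inequality combined with the reverse Hölder inequality for w absorbs it
(`localCommutatorBound_of_eq`). In case (ii), Minkowski moves the norm in x inside the integral in
y, and the A_{p'/s'} weight w^{1-p'} has dual w^{s/(s-p)} (`localCommutatorBound_dual`).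

Linearity in ‖b‖_* comes from normalizing b by an arbitrary positive bound of the seminorm and
letting this bound decrease to the seminorm. -/

noncomputable section

namespace RoughMorrey

/-! ### Minkowski's integral inequality. -/

section Minkowski

variable {α β : Type*} [MeasurableSpace α] [MeasurableSpace β]

/-- **Minkowski's integral inequality** for a finite outer measure. -/
theorem lintegral_rpow_lintegral_le (μ : Measure α) [IsFiniteMeasure μ] (ν : Measure β) [SFinite ν]
    {p : ℝ} (hp : 1 < p) {f : α → β → ℝ≥0∞} (hf : Measurable (Function.uncurry f)) :
    (∫⁻ x, (∫⁻ y, f x y ∂ν) ^ p ∂μ) ^ (1 / p) ≤ ∫⁻ y, (∫⁻ x, f x y ^ p ∂μ) ^ (1 / p) ∂ν := by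
  have hp0 : 0 < p := by linarith
  set G : α → ℝ≥0∞ := fun x => ∫⁻ y, f x y ∂ν with hG
  have hGm : Measurable G := hf.lintegral_prod_right
  set R := ∫⁻ y, (∫⁻ x, f x y ^ p ∂μ) ^ (1 / p) ∂ν with hR
  have hpq : p.HolderConjugate (p.conjExponent) := Real.HolderConjugate.conjExponent hp
  -- Truncating at k over a finite measure makes I finite, so that a power of I can be cancelled
  -- below.
  have key : ∀ k : ℕ, ∫⁻ x, (min (G x) k) ^ p ∂μ ≤ R ^ p := by
    intro k
    set I := ∫⁻ x, (min (G x) k) ^ p ∂μ with hI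
    have hIfin : I ≠ ∞ := by
      refine (lt_of_le_of_lt (lintegral_mono (g := fun _ => (k : ℝ≥0∞) ^ p) fun x => ?_) ?_).ne
      · exact ENNReal.rpow_le_rpow (min_le_right _ _) hp0.le
      · rw [lintegral_const]
        exact ENNReal.mul_lt_top (ENNReal.rpow_lt_top_of_nonneg hp0.le (by simp))
          (measure_lt_top _ _)
    -- One factor of the truncated p-th power is expanded as an integral over y; the remaining power
    -- p - 1 is paired with f in Hölder's inequality after Fubini.
    have h1 : I ≤ R * I ^ (1 / p.conjExponent) := by
      calc I ≤ ∫⁻ x, ∫⁻ y, f x y * (min (G x) k) ^ (p - 1) ∂ν ∂μ := by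
            refine lintegral_mono fun x => ?_
            rw [lintegral_mul_const' _ _ (ENNReal.rpow_lt_top_of_nonneg (by linarith)
              ((min_le_right _ _).trans_lt (ENNReal.natCast_lt_top k)).ne).ne]
            calc (min (G x) k) ^ p = min (G x) k * (min (G x) k) ^ (p - 1) := by
                  conv_lhs => rw [show p = 1 + (p - 1) by ring]
                  rw [ENNReal.rpow_add_of_nonneg _ _ zero_le_one (by linarith), ENNReal.rpow_one]
              _ ≤ _ := by gcongr; exact min_le_left _ _
        _ = ∫⁻ y, ∫⁻ x, f x y * (min (G x) k) ^ (p - 1) ∂μ ∂ν := by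
            refine lintegral_lintegral_swap ?_
            refine (hf.mul ?_).aemeasurable
            exact ((hGm.min measurable_const).pow_const _).comp measurable_fst
        _ ≤ ∫⁻ y, (∫⁻ x, f x y ^ p ∂μ) ^ (1 / p) * I ^ (1 / p.conjExponent) ∂ν := by
            refine lintegral_mono fun y => ?_
            refine (ENNReal.lintegral_mul_le_Lp_mul_Lq μ hpq
              (hf.of_uncurry_right).aemeasurable
              ((hGm.min measurable_const).pow_const _).aemeasurable).trans_eq ?_
            congr 3
            funext x
            rw [← ENNReal.rpow_mul]
            congr 1
            rw [Real.conjExponent]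
            field_simp [show p - 1 ≠ 0 by linarith]
        _ = _ := by
            rw [lintegral_mul_const' _ _ (ENNReal.rpow_lt_top_of_nonneg
              (by have := hpq.symm.pos; positivity) hIfin).ne]
    rcases eq_or_ne I 0 with h0 | h0
    · rw [h0]; exact zero_le
    have h2 : I ^ (1 / p) ≤ R := by
      have hne : I ^ (1 / p.conjExponent) ≠ 0 := by
        simp [ENNReal.rpow_eq_zero_iff, h0, hIfin]
      have hnt : I ^ (1 / p.conjExponent) ≠ ∞ :=
        (ENNReal.rpow_lt_top_of_nonneg (by have := hpq.symm.pos; positivity) hIfin).ne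
      rw [← ENNReal.mul_le_mul_iff_left hne hnt]
      refine le_trans (le_of_eq ?_) h1
      rw [← ENNReal.rpow_add _ _ h0 hIfin]
      have := hpq.inv_add_inv_eq_one
      simp only [one_div, this, ENNReal.rpow_one]
    calc I = (I ^ (1 / p)) ^ p := by
          rw [← ENNReal.rpow_mul, one_div_mul_cancel hp0.ne', ENNReal.rpow_one]
      _ ≤ R ^ p := ENNReal.rpow_le_rpow h2 hp0.le
  have hmain : ∫⁻ x, G x ^ p ∂μ ≤ R ^ p := by
    have hsup : ∀ x, G x ^ p = ⨆ k : ℕ, (min (G x) k) ^ p := by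
      intro x
      have : G x = ⨆ k : ℕ, min (G x) k := by
        rw [← inf_iSup_eq, ENNReal.iSup_natCast, inf_top_eq]
      conv_lhs => rw [this]
      exact (ENNReal.orderIsoRpow p hp0).map_iSup _
    simp_rw [hsup]
    rw [lintegral_iSup (fun k => (hGm.min measurable_const).pow_const _)]
    · exact iSup_le key
    · intro i j hij x
      exact ENNReal.rpow_le_rpow (min_le_min_left _ (by exact_mod_cast hij)) hp0.le
  calc _ ≤ (R ^ p) ^ (1 / p) := ENNReal.rpow_le_rpow hmain (by positivity)
    _ = R := by rw [← ENNReal.rpow_mul, mul_one_div_cancel hp0.ne', ENNReal.rpow_one]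

end Minkowski

/-! ### Stopping times and John–Nirenberg on nested partitions. -/

section Stopping

variable {α J F : Type*} [MeasurableSpace α]

/-- A nested sequence of countable partitions of `α`, the `m`-th one into the fibres of `idx m`,
in which a cell is at most `N` times as large as each of its children. -/
structure IsNestedGrid (μ : Measure α) (idx : ℕ → α → J) (N : ℝ≥0) : Prop where
  measurableSet : ∀ m z, MeasurableSet (idx m ⁻¹' {z})
  nested : ∀ m x y, idx (m + 1) x = idx (m + 1) y → idx m x = idx m y
  measure_pos : ∀ m x, μ (idx m ⁻¹' {idx m x}) ≠ 0
  measure_lt_top : ∀ m x, μ (idx m ⁻¹' {idx m x}) ≠ ∞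
  measure_le_child : ∀ m x, μ (idx m ⁻¹' {idx m x}) ≤ N * μ (idx (m + 1) ⁻¹' {idx (m + 1) x})

theorem IsNestedGrid.eq_of_le {μ : Measure α} {idx : ℕ → α → J} {N : ℝ≥0}
    (h : IsNestedGrid μ idx N) {m m' : ℕ} (hm : m ≤ m') {x y : α} (hxy : idx m' x = idx m' y) :
    idx m x = idx m y := by
  induction m', hm using Nat.le_induction with
  | base => exact hxy
  | succ k _ ih => exact ih (h.nested _ _ _ hxy)

/-- The Calderón–Zygmund stopping cells of `g` at height `l` in a cell of a nested grid. -/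
theorem IsNestedGrid.exists_stopping {μ : Measure α} {idx : ℕ → α → J} {N : ℝ≥0}
    (h : IsNestedGrid μ idx N) (g : α → ℝ≥0∞) (k : ℕ) (z : J) (l : ℝ≥0)
    (hl : ∫⁻ x in idx k ⁻¹' {z}, g x ∂μ ≤ l * μ (idx k ⁻¹' {z})) :
    ∃ S : Set (ℕ × J),
      (∀ q ∈ S, (idx q.1 ⁻¹' {q.2}).Nonempty ∧ idx q.1 ⁻¹' {q.2} ⊆ idx k ⁻¹' {z} ∧
        l * μ (idx q.1 ⁻¹' {q.2}) ≤ ∫⁻ x in idx q.1 ⁻¹' {q.2}, g x ∂μ ∧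
        ∫⁻ x in idx q.1 ⁻¹' {q.2}, g x ∂μ ≤ N * l * μ (idx q.1 ⁻¹' {q.2})) ∧
      S.PairwiseDisjoint (fun q => idx q.1 ⁻¹' {q.2}) ∧
      ∀ x ∈ idx k ⁻¹' {z}, x ∉ ⋃ q ∈ S, idx q.1 ⁻¹' {q.2} →
        ∀ m, k ≤ m → ∫⁻ y in idx m ⁻¹' {idx m x}, g y ∂μ ≤ l * μ (idx m ⁻¹' {idx m x}) := by
  let bad : ℕ → J → Prop := fun m z => l * μ (idx m ⁻¹' {z}) < ∫⁻ x in idx m ⁻¹' {z}, g x ∂μ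
  have hbad0 : ¬ bad k z := not_lt.2 hl
  -- The maximal bad cells: every ancestor down from level k is good, and goodness of the parent
  -- gives the upper bound with the factor N.
  refine ⟨{q | k < q.1 ∧ bad q.1 q.2 ∧ ∃ x ∈ idx k ⁻¹' {z}, idx q.1 x = q.2 ∧
    ∀ m, k ≤ m → m < q.1 → ¬ bad m (idx m x)}, ?_, ?_, ?_⟩
  · rintro ⟨m, u⟩ ⟨hkm, hb, x, hx, hxu, hx'⟩
    simp only at hkm hb hxu hx' ⊢
    subst hxu
    refine ⟨⟨x, rfl⟩, fun y hy => ?_, hb.le, ?_⟩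
    · exact (h.eq_of_le hkm.le hy).trans hx
    · obtain ⟨m, rfl⟩ : ∃ j, m = j + 1 := ⟨m - 1, by omega⟩
      calc _ ≤ ∫⁻ y in idx m ⁻¹' {idx m x}, g y ∂μ :=
            lintegral_mono_set fun y hy => h.nested _ _ _ hy
        _ ≤ l * μ (idx m ⁻¹' {idx m x}) := not_lt.1 (hx' m (by omega) (by omega))
        _ ≤ l * (N * μ (idx (m + 1) ⁻¹' {idx (m + 1) x})) := by
            gcongr; exact h.measure_le_child m x
        _ = _ := by ring
  -- If two selected cells meet and one is strictly coarser, it is a bad ancestor of the other,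
  -- against maximality.
  · have aux : ∀ m u m' u' y, k < m → bad m u → y ∈ idx m ⁻¹' {u} → y ∈ idx m' ⁻¹' {u'} →
        (∃ x, idx m' x = u' ∧ ∀ i, k ≤ i → i < m' → ¬ bad i (idx i x)) → m' ≤ m := by
      rintro m u m' u' y hk hb hy hy' ⟨x, rfl, hx⟩
      by_contra! hlt
      refine hx m hk.le hlt ?_
      rwa [← h.eq_of_le hlt.le hy', show idx m y = u from hy]
    rintro ⟨m, u⟩ ⟨hkm, hb, x, hx, hxu, hx'⟩ ⟨m', u'⟩ ⟨hkm', hb', y, hy, hyu, hy'⟩ hne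
    refine Set.disjoint_left.2 fun v hv hv' => hne ?_
    have e : m = m' := le_antisymm (aux m' u' m u v hkm' hb' hv' hv ⟨x, hxu, hx'⟩)
      (aux m u m' u' v hkm hb hv hv' ⟨y, hyu, hy'⟩)
    subst e
    have : u = u' := Eq.trans (Eq.symm hv) hv'
    rw [this]
  · intro x hx hxS m hm
    by_contra! hb
    apply hxS
    classical
    have hex : ∃ i, k ≤ i ∧ bad i (idx i x) := ⟨m, hm, hb⟩
    set i := Nat.find hex
    have hi := Nat.find_spec hex
    have hki : k < i := lt_of_le_of_ne hi.1 (by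
      intro e
      apply hbad0
      have := hi.2
      rwa [show Nat.find hex = k from e.symm, show idx k x = z from hx] at this)
    refine mem_iUnion₂.2 ⟨(i, idx i x), ⟨hki, hi.2, x, hx, rfl, fun j hj hji hbj => ?_⟩, rfl⟩
    exact Nat.find_min hex hji ⟨hj, hbj⟩

/-- **John–Nirenberg inequality** on a nested grid, for the distribution with respect to a measure
`ν` that is quantitatively absolutely continuous with respect to `μ`. -/
theorem IsNestedGrid.measure_lt_enorm_sub_le [Countable J] [NormedAddCommGroup F] {μ ν : Measure α} {idx : ℕ → α → J} {N : ℝ≥0}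
    (h : IsNestedGrid μ idx N) (hνμ : ν ≪ μ) {ε H l Λ : ℝ≥0} {θ : ℝ≥0∞} (hl0 : 0 < l)
    (hl : H ≤ ε * l) (hHl : H ≤ l) (hlΛ : l ≤ Λ) (hΛ : H + N * l ≤ Λ)
    (hθ : ∀ m z E, MeasurableSet E → E ⊆ idx m ⁻¹' {z} → μ E ≤ ε * μ (idx m ⁻¹' {z}) →
      ν E ≤ θ * ν (idx m ⁻¹' {z}))
    {b : α → F} {c : ℕ → J → F} (hb : ∀ m z, Measurable fun x => ‖b x - c m z‖ₑ)
    (hbmo : ∀ m z, ∫⁻ x in idx m ⁻¹' {z}, ‖b x - c m z‖ₑ ∂μ ≤ H * μ (idx m ⁻¹' {z}))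
    (hdiff : ∀ k z, ∀ᵐ x ∂μ, (∀ m, k ≤ m → ∫⁻ y in idx m ⁻¹' {idx m x}, ‖b y - c k z‖ₑ ∂μ ≤
      l * μ (idx m ⁻¹' {idx m x})) → ‖b x - c k z‖ₑ ≤ l) (j : ℕ) :
    ∀ k z, ν (idx k ⁻¹' {z} ∩ {x | (j : ℝ≥0∞) * Λ < ‖b x - c k z‖ₑ}) ≤
      θ ^ j * ν (idx k ⁻¹' {z}) := by
  induction j with
  | zero => intro k z; simpa using measure_mono inter_subset_left
  | succ j ih =>
    intro k z
    set Q := idx k ⁻¹' {z} with hQ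
    have hQl : ∫⁻ x in Q, ‖b x - c k z‖ₑ ∂μ ≤ l * μ Q :=
      (hbmo k z).trans (by gcongr)
    obtain ⟨S, hS, hdis, hrest⟩ := h.exists_stopping (fun x => ‖b x - c k z‖ₑ) k z l hQl
    set R : ℕ × J → Set α := fun q => idx q.1 ⁻¹' {q.2} with hRdef
    have hSc : S.Countable := Set.to_countable _
    have hRm : ∀ q, MeasurableSet (R q) := fun q => h.measurableSet _ _
    have hUm : MeasurableSet (⋃ q ∈ S, R q) := MeasurableSet.biUnion hSc fun q _ => hRm q
    have hUQ : (⋃ q ∈ S, R q) ⊆ Q := iUnion₂_subset fun q hq => (hS q hq).2.1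
    -- Chebyshev over the disjoint stopping cells; this smallness is what `hθ` converts into the
    -- factor θ for ν.
    have hUμ : μ (⋃ q ∈ S, R q) ≤ ε * μ Q := by
      have h1 : l * μ (⋃ q ∈ S, R q) ≤ l * (ε * μ Q) := by
        calc l * μ (⋃ q ∈ S, R q) = ∑' q : S, l * μ (R q) := by
              rw [measure_biUnion hSc hdis fun q _ => hRm q, ENNReal.tsum_mul_left]
          _ ≤ ∑' q : S, ∫⁻ x in R q, ‖b x - c k z‖ₑ ∂μ :=
              ENNReal.tsum_le_tsum fun q => (hS q q.2).2.2.1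
          _ = ∫⁻ x in ⋃ q ∈ S, R q, ‖b x - c k z‖ₑ ∂μ :=
              (lintegral_biUnion hSc (fun q _ => hRm q) hdis _).symm
          _ ≤ ∫⁻ x in Q, ‖b x - c k z‖ₑ ∂μ := lintegral_mono_set hUQ
          _ ≤ H * μ Q := hbmo k z
          _ ≤ (ε * l : ℝ≥0) * μ Q := by gcongr
          _ = _ := by push_cast; ring
      rwa [ENNReal.mul_le_mul_iff_right (by simpa using hl0.ne') (by simp)] at h1
    -- Passing from the constant of Q to that of a stopping cell costs one step Λ of the height,
    -- which drives the induction on j.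
    have hcc : ∀ q ∈ S, ‖c q.1 q.2 - c k z‖ₑ ≤ Λ := by
      intro q hq
      obtain ⟨⟨x, hx⟩, hqQ, _, hq2⟩ := hS q hq
      have hx' : idx q.1 x = q.2 := hx
      have h0 : μ (R q) ≠ 0 := by
        have := h.measure_pos q.1 x; rwa [hx'] at this
      have ht : μ (R q) ≠ ∞ := by
        have := h.measure_lt_top q.1 x; rwa [hx'] at this
      rw [← ENNReal.mul_le_mul_iff_left h0 ht]
      calc ‖c q.1 q.2 - c k z‖ₑ * μ (R q) = ∫⁻ x in R q, ‖c q.1 q.2 - c k z‖ₑ ∂μ := by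
            rw [setLIntegral_const]
        _ ≤ ∫⁻ x in R q, (‖b x - c q.1 q.2‖ₑ + ‖b x - c k z‖ₑ) ∂μ := by
            refine lintegral_mono fun x => ?_
            have : c q.1 q.2 - c k z = -(b x - c q.1 q.2) + (b x - c k z) := by abel
            rw [this]
            exact (enorm_add_le _ _).trans_eq (by rw [enorm_neg])
        _ = ∫⁻ x in R q, ‖b x - c q.1 q.2‖ₑ ∂μ + ∫⁻ x in R q, ‖b x - c k z‖ₑ ∂μ :=
            lintegral_add_left (hb _ _) _
        _ ≤ H * μ (R q) + N * l * μ (R q) := add_le_add (hbmo _ _) hq2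
        _ = ((H + N * l : ℝ≥0) : ℝ≥0∞) * μ (R q) := by push_cast; ring
        _ ≤ Λ * μ (R q) := by gcongr
    -- Off the stopping cells the oscillation is at most l ≤ Λ almost everywhere, so the exceptional
    -- set lives in these cells, where the height drops to j * Λ.
    have hsub : ∀ᵐ x ∂ν, x ∈ Q ∩ {x | ((j + 1 : ℕ) : ℝ≥0∞) * Λ < ‖b x - c k z‖ₑ} →
        x ∈ ⋃ q ∈ S, (R q ∩ {x | (j : ℝ≥0∞) * Λ < ‖b x - c q.1 q.2‖ₑ}) := by
      filter_upwards [hνμ (hdiff k z)] with x hx hxQ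
      by_cases hxU : x ∈ ⋃ q ∈ S, R q
      · obtain ⟨q, hq, hxq⟩ := mem_iUnion₂.1 hxU
        refine mem_iUnion₂.2 ⟨q, hq, hxq, ?_⟩
        by_contra hcon
        rw [mem_ofPred_eq, not_lt] at hcon
        refine absurd (mem_ofPred_eq ▸ hxQ.2) (not_lt.2 ?_)
        calc ‖b x - c k z‖ₑ ≤ ‖b x - c q.1 q.2‖ₑ + ‖c q.1 q.2 - c k z‖ₑ := by
              rw [← sub_add_sub_cancel (b x) (c q.1 q.2) (c k z)]; exact enorm_add_le _ _
          _ ≤ j * Λ + Λ := add_le_add hcon (hcc q hq)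
          _ = _ := by push_cast; ring
      · exfalso
        refine absurd (mem_ofPred_eq ▸ hxQ.2) (not_lt.2 ?_)
        calc ‖b x - c k z‖ₑ ≤ l := hx (hrest x hxQ.1 hxU)
          _ ≤ 1 * (Λ : ℝ≥0∞) := by rw [one_mul]; exact_mod_cast hlΛ
          _ ≤ _ := by gcongr; simp
    calc _ ≤ ν (⋃ q ∈ S, (R q ∩ {x | (j : ℝ≥0∞) * Λ < ‖b x - c q.1 q.2‖ₑ})) :=
          measure_mono_ae hsub
      _ ≤ ∑' q : S, ν (R q ∩ {x | (j : ℝ≥0∞) * Λ < ‖b x - c q.1.1 q.1.2‖ₑ}) :=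
          measure_biUnion_le _ hSc _
      _ ≤ ∑' q : S, θ ^ j * ν (R q) := ENNReal.tsum_le_tsum fun q => ih _ _
      _ = θ ^ j * ν (⋃ q ∈ S, R q) := by
          rw [ENNReal.tsum_mul_left, measure_biUnion hSc hdis fun q _ => hRm q]
      _ ≤ θ ^ j * (θ * ν Q) := by gcongr; exact hθ k z _ hUm hUQ hUμ
      _ = _ := by rw [pow_succ, mul_assoc]

end Stopping

/-! ### Dyadic cubes and their comparison with balls. -/

section Cubes

variable {n : ℕ}

/-- The index of the half-open cube of side `ℓ / 2 ^ m`, in the dyadic grid with corner `a`, that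
contains `x`. -/
def cubeIdx (a : EuclideanSpace ℝ (Fin n)) (ℓ : ℝ) (m : ℕ) (x : EuclideanSpace ℝ (Fin n)) :
    Fin n → ℤ :=
  fun i => ⌊2 ^ m * ((x i - a i) / ℓ)⌋

theorem cubeIdx_preimage {a : EuclideanSpace ℝ (Fin n)} {ℓ : ℝ} (hℓ : 0 < ℓ) (m : ℕ)
    (z : Fin n → ℤ) :
    cubeIdx a ℓ m ⁻¹' {z} = (MeasurableEquiv.toLp 2 (Fin n → ℝ)).symm ⁻¹'
      (Set.univ.pi fun i => Ico (a i + ℓ / 2 ^ m * z i) (a i + ℓ / 2 ^ m * z i + ℓ / 2 ^ m)) := by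
  ext x
  simp only [mem_preimage, mem_singleton_iff, Set.mem_pi, mem_univ, true_imp_iff, mem_Ico,
    funext_iff, cubeIdx, Int.floor_eq_iff]
  refine forall_congr' fun i => ?_
  have h2 : (0 : ℝ) < ℓ / 2 ^ m := by positivity
  have e : (2 : ℝ) ^ m * ((x i - a i) / ℓ) = (x i - a i) / (ℓ / 2 ^ m) := by
    field_simp
  change _ ↔ _ ≤ x i ∧ x i < _
  rw [e, le_div_iff₀ h2, div_lt_iff₀ h2]
  constructor
  · rintro ⟨h, h'⟩; constructor <;> linarith
  · rintro ⟨h, h'⟩; constructor <;> linarith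

theorem measurableSet_cubeIdx {a : EuclideanSpace ℝ (Fin n)} {ℓ : ℝ} (hℓ : 0 < ℓ) (m : ℕ)
    (z : Fin n → ℤ) : MeasurableSet (cubeIdx a ℓ m ⁻¹' {z}) := by
  rw [cubeIdx_preimage hℓ]
  exact (MeasurableEquiv.measurable _) (MeasurableSet.univ_pi fun i => measurableSet_Ico)

theorem volume_cubeIdx {a : EuclideanSpace ℝ (Fin n)} {ℓ : ℝ} (hℓ : 0 < ℓ) (m : ℕ)
    (z : Fin n → ℤ) : volume (cubeIdx a ℓ m ⁻¹' {z}) = ENNReal.ofReal (ℓ / 2 ^ m) ^ n := by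
  rw [cubeIdx_preimage hℓ, (EuclideanSpace.volume_preserving_symm_measurableEquiv_toLp
    (Fin n)).measure_preimage_equiv, volume_pi_pi]
  simp [Real.volume_Ico]

theorem cubeIdx_nested (a : EuclideanSpace ℝ (Fin n)) (ℓ : ℝ) (m : ℕ)
    (x y : EuclideanSpace ℝ (Fin n)) (h : cubeIdx a ℓ (m + 1) x = cubeIdx a ℓ (m + 1) y) :
    cubeIdx a ℓ m x = cubeIdx a ℓ m y := by
  funext i
  -- The index of the parent is the integer half of the index of the child, so the finer index
  -- determines the coarser one.
  have key : ∀ t : ℝ, ⌊2 ^ m * t⌋ = ⌊2 ^ (m + 1) * t⌋ / 2 := by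
    intro t
    have := Int.floor_div_natCast (2 ^ (m + 1) * t) 2
    push_cast at this
    rw [← this]
    congr 1
    ring
  have hi := congrFun h i
  simp only [cubeIdx] at hi ⊢
  rw [key, key, hi]

theorem dist_lt_of_cubeIdx_eq {a : EuclideanSpace ℝ (Fin n)} {ℓ : ℝ} (hℓ : 0 < ℓ) (m : ℕ)
    {x y : EuclideanSpace ℝ (Fin n)} (h : cubeIdx a ℓ m x = cubeIdx a ℓ m y) :
    dist x y < (√n + 1) * (ℓ / 2 ^ m) := by
  have h2 : (0 : ℝ) < ℓ / 2 ^ m := by positivity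
  have hi : ∀ i, dist (x i) (y i) ≤ ℓ / 2 ^ m := by
    intro i
    have := Int.abs_sub_lt_one_of_floor_eq_floor (congrFun h i)
    have e : (2 : ℝ) ^ m * ((x i - a i) / ℓ) - 2 ^ m * ((y i - a i) / ℓ)
        = (x i - y i) / (ℓ / 2 ^ m) := by
      field_simp; ring
    rw [e, abs_div, abs_of_pos h2, div_lt_one h2] at this
    rw [Real.dist_eq]; exact this.le
  rw [EuclideanSpace.dist_eq]
  calc √(∑ i, dist (x i) (y i) ^ 2) ≤ √(∑ _i : Fin n, (ℓ / 2 ^ m) ^ 2) := by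
        refine Real.sqrt_le_sqrt (Finset.sum_le_sum fun i _ => ?_)
        exact pow_le_pow_left₀ dist_nonneg (hi i) 2
    _ = √n * (ℓ / 2 ^ m) := by
        rw [Finset.sum_const, Finset.card_univ, Fintype.card_fin, nsmul_eq_mul,
          Real.sqrt_mul (Nat.cast_nonneg n), Real.sqrt_sq h2.le]
    _ < _ := by nlinarith

theorem isNestedGrid_cubeIdx (a : EuclideanSpace ℝ (Fin n)) {ℓ : ℝ} (hℓ : 0 < ℓ) :
    IsNestedGrid volume (cubeIdx a ℓ) (2 ^ n) where
  measurableSet := measurableSet_cubeIdx hℓ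
  nested := cubeIdx_nested a ℓ
  measure_pos m x := by
    rw [volume_cubeIdx hℓ]
    exact pow_ne_zero _ (by simp; positivity)
  measure_lt_top m x := by
    rw [volume_cubeIdx hℓ]
    exact ENNReal.pow_ne_top (by simp)
  measure_le_child m x := by
    rw [volume_cubeIdx hℓ, volume_cubeIdx hℓ]
    push_cast
    rw [← mul_pow]
    refine pow_le_pow_left' (le_of_eq ?_) _
    rw [show (2 : ℝ≥0∞) = ENNReal.ofReal 2 by simp, ← ENNReal.ofReal_mul (by norm_num)]
    congr 1
    field_simp
    ring

/-- The ratio of the volume of a ball that contains a cube to the volume of the cube. -/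
def ballCubeRatio (n : ℕ) : ℝ≥0 :=
  (Real.toNNReal (√n + 1)) ^ n * (volume (ball (0 : EuclideanSpace ℝ (Fin n)) 1)).toNNReal

theorem volume_ball_eq (x : EuclideanSpace ℝ (Fin n)) {r : ℝ} (hr : 0 < r) :
    volume (ball x r) = ENNReal.ofReal r ^ n * volume (ball (0 : EuclideanSpace ℝ (Fin n)) 1) := by
  rw [← mul_one r, Measure.addHaar_ball_mul_of_pos _ _ hr, finrank_euclideanSpace_fin, mul_one,
    ENNReal.ofReal_pow hr.le]

theorem cubeIdx_subset_ball {a : EuclideanSpace ℝ (Fin n)} {ℓ : ℝ} (hℓ : 0 < ℓ) (m : ℕ)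
    (x : EuclideanSpace ℝ (Fin n)) :
    cubeIdx a ℓ m ⁻¹' {cubeIdx a ℓ m x} ⊆ ball x ((√n + 1) * (ℓ / 2 ^ m)) :=
  fun _ hy => dist_lt_of_cubeIdx_eq hℓ m hy

theorem volume_ball_eq_cubeIdx {a : EuclideanSpace ℝ (Fin n)} {ℓ : ℝ} (hℓ : 0 < ℓ) (m : ℕ)
    (z : Fin n → ℤ) (x : EuclideanSpace ℝ (Fin n)) :
    volume (ball x ((√n + 1) * (ℓ / 2 ^ m)))
      = ballCubeRatio n * volume (cubeIdx a ℓ m ⁻¹' {z}) := by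
  rw [volume_ball_eq _ (by positivity), volume_cubeIdx hℓ, ballCubeRatio,
    ENNReal.ofReal_mul (by positivity), ENNReal.coe_mul,
    ENNReal.coe_toNNReal measure_ball_lt_top.ne, mul_pow]
  push_cast
  rw [ENNReal.ofReal]
  ring

theorem cubeIdx_nonempty (a : EuclideanSpace ℝ (Fin n)) {ℓ : ℝ} (hℓ : 0 < ℓ) (m : ℕ)
    (z : Fin n → ℤ) : (cubeIdx a ℓ m ⁻¹' {z}).Nonempty := by
  refine nonempty_of_measure_ne_zero (μ := volume) ?_
  rw [volume_cubeIdx hℓ]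
  exact pow_ne_zero _ (by simp; positivity)

theorem ball_subset_cubeIdx (x : EuclideanSpace ℝ (Fin n)) {r : ℝ} (hr : 0 < r) :
    ball x r ⊆ cubeIdx (x - WithLp.toLp 2 fun _ => r) (2 * r) 0 ⁻¹' {fun _ => 0} := by
  intro y hy
  rw [mem_preimage, mem_singleton_iff]
  funext i
  have h1 : |y i - x i| < r := by
    have h2 := EuclideanSpace.dist_eq y x
    have h3 : dist (y i) (x i) ≤ dist y x := by
      rw [h2]
      refine Real.le_sqrt_of_sq_le ?_
      exact Finset.single_le_sum (f := fun i => dist (y i) (x i) ^ 2)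
        (fun _ _ => sq_nonneg _) (Finset.mem_univ i)
    rw [← Real.dist_eq]
    exact h3.trans_lt hy
  obtain ⟨h4, h5⟩ := abs_lt.1 h1
  simp only [cubeIdx, PiLp.sub_apply, Int.floor_eq_iff]
  rw [pow_zero, one_mul, le_div_iff₀ (by positivity), div_lt_iff₀ (by positivity)]
  constructor <;> push_cast <;> linarith

end Cubes

/-! ### From geometric decay of the distribution to exponential integrability. -/

section Exponential

variable {α : Type*} [MeasurableSpace α]

/-- A discrete layer-cake argument: on jL < u ≤ (j+1)L the exponential is at most e^{δL(j+1)}, and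
summing over j leaves a geometric series. Its convergence is left to the choice of δ. -/
theorem lintegral_exp_le_of_measure_lt {ν : Measure α} {Q : Set α}
    {u : α → ℝ} (hu : Measurable u) (hu0 : ∀ x, 0 ≤ u x) {L δ : ℝ} (hL : 0 < L) (hδ : 0 < δ)
    {θ : ℝ≥0∞} (h : ∀ j : ℕ, ν (Q ∩ {x | j * L < u x}) ≤ θ ^ j * ν Q) :
    ∫⁻ x in Q, ENNReal.ofReal (Real.exp (δ * u x)) ∂ν ≤
      (1 + ENNReal.ofReal (Real.exp (δ * L)) *
        ∑' j : ℕ, (ENNReal.ofReal (Real.exp (δ * L)) * θ) ^ j) * ν Q := by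
  set e := ENNReal.ofReal (Real.exp (δ * L)) with he
  have hpt : ∀ x, ENNReal.ofReal (Real.exp (δ * u x)) ≤
      1 + ∑' j : ℕ, ({x | j * L < u x}.indicator (fun _ => e ^ (j + 1)) x) := by
    intro x
    rcases (hu0 x).eq_or_lt with h0 | h0
    · rw [← h0]; simp
    -- The last index with j * L < u x; it exists because u x > 0, and the points with u x = 0 are
    -- covered by the summand 1.
    · set j := ⌈u x / L⌉₊ - 1 with hj
      have hpos : 0 < ⌈u x / L⌉₊ := Nat.ceil_pos.2 (by positivity)
      have hj1 : (j : ℝ) * L < u x := by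
        rw [← lt_div_iff₀ hL]
        exact Nat.lt_ceil.1 (by omega)
      have hj2 : u x ≤ (j + 1) * L := by
        rw [← div_le_iff₀ hL]
        have := Nat.le_ceil (u x / L)
        have h3 : (⌈u x / L⌉₊ : ℝ) = j + 1 := by
          rw [hj]; exact_mod_cast (Nat.sub_add_cancel hpos).symm
        rwa [h3] at this
      calc ENNReal.ofReal (Real.exp (δ * u x)) ≤ e ^ (j + 1) := by
            rw [he, ← ENNReal.ofReal_pow (Real.exp_pos _).le, ← Real.exp_nat_mul]
            refine ENNReal.ofReal_le_ofReal (Real.exp_le_exp.2 ?_)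
            push_cast
            nlinarith
        _ = {x | j * L < u x}.indicator (fun _ => e ^ (j + 1)) x := by
            rw [indicator_of_mem]; exact hj1
        _ ≤ ∑' j : ℕ, ({x | j * L < u x}.indicator (fun _ => e ^ (j + 1)) x) :=
            ENNReal.le_tsum (f := fun j : ℕ => {x | j * L < u x}.indicator
              (fun _ => e ^ (j + 1)) x) j
        _ ≤ _ := le_add_self
  have hm : ∀ j : ℕ, MeasurableSet {x | j * L < u x} :=
    fun j => measurableSet_lt measurable_const hu
  calc _ ≤ ∫⁻ x in Q, (1 + ∑' j : ℕ, ({x | j * L < u x}.indicator (fun _ => e ^ (j + 1)) x)) ∂ν :=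
        lintegral_mono hpt
    _ = ν Q + ∑' j : ℕ, e ^ (j + 1) * ν (Q ∩ {x | j * L < u x}) := by
        rw [lintegral_add_left measurable_const, setLIntegral_const, one_mul,
          lintegral_tsum fun j => (measurable_const.indicator (hm j)).aemeasurable]
        congr 1
        refine tsum_congr fun j => ?_
        rw [lintegral_indicator_const (hm j), Measure.restrict_apply (hm j), inter_comm]
    _ ≤ ν Q + ∑' j : ℕ, e ^ (j + 1) * (θ ^ j * ν Q) := by
        gcongr with j; exact h j
    _ = _ := by
        rw [add_mul, one_mul]
        congr 1
        rw [← ENNReal.tsum_mul_left, ← ENNReal.tsum_mul_right]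
        refine tsum_congr fun j => ?_
        rw [mul_pow, pow_succ]; ring

end Exponential

/-! ### Quantitative absolute continuity on balls and cubes. -/

section AInfty

variable {n : ℕ}

theorem volume_ball_ne_zero (x : EuclideanSpace ℝ (Fin n)) {r : ℝ} (hr : 0 < r) :
    volume (ball x r) ≠ 0 := (measure_ball_pos _ _ hr).ne'

theorem volume_ball_ratio (x y : EuclideanSpace ℝ (Fin n)) {r R : ℝ} (hr : 0 < r) (hR : 0 < R) :
    volume (ball x R) = ENNReal.ofReal (R / r) ^ n * volume (ball y r) := by
  rw [volume_ball_eq x hR, volume_ball_eq y hr, ← mul_assoc, ← mul_pow,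
    ← ENNReal.ofReal_mul (by positivity), div_mul_cancel₀ _ hr.ne']

/-- Quantitative absolute continuity of `ν` on balls, in the form satisfied by `A_a` weights:
`ν(B) |F| ^ a ≤ C ν(F) |B| ^ a` for measurable subsets `F` of balls `B`. -/
structure IsAInfty (a : ℝ) (C : ℝ≥0) (ν : Measure (EuclideanSpace ℝ (Fin n))) : Prop where
  absolutelyContinuous : ν ≪ volume
  measure_ball_ne_top : ∀ x r, ν (ball x r) ≠ ∞
  le : ∀ x r, 0 < r → ∀ F ⊆ ball x r, MeasurableSet F →
    ν (ball x r) * volume F ^ a ≤ C * ν F * volume (ball x r) ^ a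

theorem isAInfty_volume : IsAInfty 1 1 (volume : Measure (EuclideanSpace ℝ (Fin n))) where
  absolutelyContinuous := Measure.AbsolutelyContinuous.rfl
  measure_ball_ne_top _ _ := measure_ball_lt_top.ne
  le x r hr F _ _ := by simp [mul_comm]

variable {a : ℝ} {C : ℝ≥0} {ν : Measure (EuclideanSpace ℝ (Fin n))}

/-- Doubling, by taking the smaller ball as the subset F in the defining inequality. -/
theorem IsAInfty.measure_ball_le (h : IsAInfty a C ν) (ha : 0 ≤ a)
    {x y : EuclideanSpace ℝ (Fin n)} {r R : ℝ} (hr : 0 < r) (hR : 0 < R)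
    (hsub : ball y r ⊆ ball x R) :
    ν (ball x R) ≤ C * (ENNReal.ofReal (R / r) ^ n) ^ a * ν (ball y r) := by
  have h0 : volume (ball y r) ^ a ≠ 0 := by
    simp [ENNReal.rpow_eq_zero_iff, volume_ball_ne_zero y hr, measure_ball_lt_top.ne]
  have ht : volume (ball y r) ^ a ≠ ∞ :=
    ENNReal.rpow_ne_top_of_nonneg ha measure_ball_lt_top.ne
  rw [← ENNReal.mul_le_mul_iff_left h0 ht]
  refine (h.le x R hR _ hsub measurableSet_ball).trans_eq ?_
  rw [volume_ball_ratio x y hr hR, ENNReal.mul_rpow_of_nonneg _ _ ha]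
  ring

/-- The A_∞ inequality bounds from below the ν-measure of the complement of F in the cube, which
fills at least half of it; hence F misses a fixed proportion of ν. The cube is placed inside a ball
of comparable volume, which is where `ballCubeRatio` enters. -/
theorem IsAInfty.cube_le (h : IsAInfty a C ν) (ha : 0 ≤ a) (hC : 0 < C)
    {o : EuclideanSpace ℝ (Fin n)} {ℓ : ℝ} (hℓ : 0 < ℓ) (m : ℕ) (z : Fin n → ℤ)
    {F : Set (EuclideanSpace ℝ (Fin n))} (hFm : MeasurableSet F)
    (hF : F ⊆ cubeIdx o ℓ m ⁻¹' {z})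
    (hF2 : volume F ≤ (1 / 2 : ℝ≥0) * volume (cubeIdx o ℓ m ⁻¹' {z})) :
    ν F ≤ (1 - (C * (2 * ballCubeRatio n : ℝ≥0∞) ^ a)⁻¹) * ν (cubeIdx o ℓ m ⁻¹' {z}) := by
  set Q := cubeIdx o ℓ m ⁻¹' {z} with hQ
  set K : ℝ≥0 := ballCubeRatio n
  have hQm : MeasurableSet Q := measurableSet_cubeIdx hℓ m z
  obtain ⟨x, hx⟩ := cubeIdx_nonempty o hℓ m z
  set B := ball x ((√n + 1) * (ℓ / 2 ^ m)) with hB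
  have hQB : Q ⊆ B := by
    have := cubeIdx_subset_ball (a := o) hℓ m x
    rwa [show cubeIdx o ℓ m x = z from hx] at this
  have hBv : volume B = K * volume Q := volume_ball_eq_cubeIdx hℓ m z x
  have hQ0 : volume Q ≠ 0 := by
    rw [hQ, volume_cubeIdx hℓ]; exact pow_ne_zero _ (by simp; positivity)
  have hQt : volume Q ≠ ∞ := by
    rw [hQ, volume_cubeIdx hℓ]; exact ENNReal.pow_ne_top (by simp)
  have hνQ : ν Q ≠ ∞ := ((measure_mono hQB).trans_lt (h.measure_ball_ne_top _ _).lt_top).ne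
  set G := Q \ F with hG
  have hGm : MeasurableSet G := hQm.diff hFm
  have hGQ : G ⊆ Q := sdiff_subset
  have hsum : ∀ μ : Measure (EuclideanSpace ℝ (Fin n)), μ F + μ G = μ Q := by
    intro μ
    rw [← measure_union disjoint_sdiff_right hGm, union_sdiff_cancel hF]
  have hG2 : volume Q ≤ 2 * volume G := by
    have h1 := hsum volume
    have h2 : volume Q ≤ (1 / 2 : ℝ≥0) * volume Q + volume G :=
      h1.symm.le.trans (by gcongr)
    have h3 : 2 * volume Q ≤ volume Q + 2 * volume G := by
      calc 2 * volume Q ≤ 2 * ((1 / 2 : ℝ≥0) * volume Q + volume G) := by gcongr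
        _ = _ := by
          rw [mul_add, ← mul_assoc]
          congr 1
          have : (2 : ℝ≥0∞) * (1 / 2 : ℝ≥0) = 1 := by
            rw [show (2 : ℝ≥0∞) = ((2 : ℝ≥0) : ℝ≥0∞) by simp, ← ENNReal.coe_mul]; simp
          rw [this, one_mul]
    rw [two_mul] at h3
    exact (ENNReal.add_le_add_iff_left hQt).1 h3
  have hK0 : (K : ℝ≥0∞) ≠ 0 := by
    intro h0
    rw [h0, zero_mul] at hBv
    exact hQ0 (measure_mono_null hQB hBv)
  have hkey : ν Q ≤ C * (2 * K : ℝ≥0∞) ^ a * ν G := by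
    have h1 := h.le x _ (by positivity) G (hGQ.trans hQB) hGm
    have h0 : volume Q ^ a ≠ 0 := by
      simp [ENNReal.rpow_eq_zero_iff, hQ0, hQt]
    have ht : volume Q ^ a ≠ ∞ := ENNReal.rpow_ne_top_of_nonneg ha hQt
    rw [← ENNReal.mul_le_mul_iff_left h0 ht]
    calc ν Q * volume Q ^ a ≤ ν B * (2 * volume G) ^ a := by gcongr
      _ = 2 ^ a * (ν B * volume G ^ a) := by rw [ENNReal.mul_rpow_of_nonneg _ _ ha]; ring
      _ ≤ 2 ^ a * (C * ν G * volume B ^ a) := by gcongr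
      _ = _ := by
        rw [hBv, ENNReal.mul_rpow_of_nonneg _ _ ha, ENNReal.mul_rpow_of_nonneg _ _ ha]; ring
  have hD0 : (C * (2 * K : ℝ≥0∞) ^ a) ≠ 0 := by
    refine mul_ne_zero (by simpa using hC.ne') ?_
    simp [ENNReal.rpow_eq_zero_iff, hK0, ENNReal.mul_eq_top]
  have hDt : (C * (2 * K : ℝ≥0∞) ^ a) ≠ ∞ :=
    ENNReal.mul_ne_top (by simp) (ENNReal.rpow_ne_top_of_nonneg ha
      (ENNReal.mul_ne_top (by simp) (by simp)))
  have hη : (C * (2 * K : ℝ≥0∞) ^ a)⁻¹ * ν Q ≤ ν G := by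
    rw [mul_comm, ← div_eq_mul_inv]
    exact ENNReal.div_le_of_le_mul' hkey
  rw [ENNReal.sub_mul (fun _ _ => hνQ), one_mul]
  refine ENNReal.le_sub_of_add_le_right ?_ ?_
  · exact (hη.trans_lt ((measure_mono hGQ).trans_lt hνQ.lt_top)).ne
  · exact (add_le_add_right hη _).trans (hsum ν).le

end AInfty

/-! ### John–Nirenberg inequality for A_∞ measures. -/

section JohnNirenberg

variable {n : ℕ} {𝕜 : Type*} [RCLike 𝕜]

/-- `b` has mean oscillation at most `H` about the constants `c x r` on the balls `B(x, r)`. -/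
def HasMeanOscillationLE (H : ℝ≥0) (b : EuclideanSpace ℝ (Fin n) → 𝕜)
    (c : EuclideanSpace ℝ (Fin n) → ℝ → 𝕜) : Prop :=
  ∀ x r, 0 < r → ∫⁻ y in ball x r, ‖b y - c x r‖ₑ ≤ H * volume (ball x r)

variable {H : ℝ≥0} {b : EuclideanSpace ℝ (Fin n) → 𝕜} {c : EuclideanSpace ℝ (Fin n) → ℝ → 𝕜}

theorem HasMeanOscillationLE.locallyIntegrable (h : HasMeanOscillationLE H b c)
    (hb : Measurable b) : LocallyIntegrable b volume := by
  intro x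
  refine ⟨ball x 1, ball_mem_nhds _ one_pos, ?_⟩
  have h1 : IntegrableOn (fun y => b y - c x 1) (ball x 1) := by
    refine ⟨(hb.sub_const _).aestronglyMeasurable, ?_⟩
    exact (h x 1 one_pos).trans_lt (ENNReal.mul_lt_top (by simp) measure_ball_lt_top)
  have h2 : IntegrableOn (fun _ => c x 1) (ball x 1) :=
    integrableOn_const measure_ball_lt_top.ne
  exact (h1.add h2).congr (Filter.Eventually.of_forall fun y => by simp)

/-- Averaging the triangle inequality over the smaller ball; the volume ratio is the price of using
the oscillation bound of the larger one. -/
theorem HasMeanOscillationLE.enorm_sub_le (h : HasMeanOscillationLE H b c) (hb : Measurable b)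
    {x y : EuclideanSpace ℝ (Fin n)} {r R : ℝ} (hr : 0 < r) (hR : 0 < R)
    (hsub : ball y r ⊆ ball x R) :
    ‖c y r - c x R‖ₑ ≤ H * (1 + ENNReal.ofReal (R / r) ^ n) := by
  have h0 := volume_ball_ne_zero y hr
  have ht : volume (ball y r) ≠ ∞ := measure_ball_lt_top.ne
  rw [← ENNReal.mul_le_mul_iff_left h0 ht]
  have hbm : Measurable fun z => ‖b z - c y r‖ₑ := (hb.sub_const _).enorm
  calc ‖c y r - c x R‖ₑ * volume (ball y r) = ∫⁻ _z in ball y r, ‖c y r - c x R‖ₑ := by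
        rw [setLIntegral_const]
    _ ≤ ∫⁻ z in ball y r, (‖b z - c y r‖ₑ + ‖b z - c x R‖ₑ) := by
        refine lintegral_mono fun z => ?_
        have : c y r - c x R = -(b z - c y r) + (b z - c x R) := by abel
        rw [this]
        exact (enorm_add_le _ _).trans_eq (by rw [enorm_neg])
    _ = (∫⁻ z in ball y r, ‖b z - c y r‖ₑ) + ∫⁻ z in ball y r, ‖b z - c x R‖ₑ :=
        lintegral_add_left hbm _
    _ ≤ H * volume (ball y r) + H * volume (ball x R) :=
        add_le_add (h y r hr) ((lintegral_mono_set hsub).trans (h x R hR))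
    _ = _ := by rw [volume_ball_ratio x y hr hR]; ring

/-- Lebesgue differentiation along the cubes of a dyadic grid. -/
theorem ae_enorm_le_of_cubeIdx {b : EuclideanSpace ℝ (Fin n) → 𝕜}
    (hb : LocallyIntegrable b volume) (hbm : Measurable b) (o : EuclideanSpace ℝ (Fin n)) {ℓ : ℝ}
    (hℓ : 0 < ℓ) (d : 𝕜) (l : ℝ≥0) (k : ℕ) :
    ∀ᵐ x, (∀ m, k ≤ m → ∫⁻ y in cubeIdx o ℓ m ⁻¹' {cubeIdx o ℓ m x}, ‖b y - d‖ₑ ≤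
      l * volume (cubeIdx o ℓ m ⁻¹' {cubeIdx o ℓ m x})) → ‖b x - d‖ₑ ≤ l := by
  filter_upwards [(IsUnifLocDoublingMeasure.vitaliFamily
    (volume : Measure (EuclideanSpace ℝ (Fin n))) 1).ae_tendsto_lintegral_enorm_sub_div hb]
    with x hx hm
  set ρ : ℕ → ℝ := fun m => (√n + 1) * (ℓ / 2 ^ m) with hρ
  have hρ0 : ∀ m, 0 < ρ m := fun m => by positivity
  have hρlim : Filter.Tendsto ρ Filter.atTop (nhdsWithin 0 (Ioi 0)) := by
    refine tendsto_nhdsWithin_iff.2 ⟨?_, Filter.Eventually.of_forall hρ0⟩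
    have h1 : Filter.Tendsto (fun m : ℕ => (√n + 1) * ℓ * (1 / 2 : ℝ) ^ m) Filter.atTop
        (nhds ((√n + 1) * ℓ * 0)) :=
      (tendsto_pow_atTop_nhds_zero_of_lt_one (by norm_num) (by norm_num)).const_mul _
    rw [mul_zero] at h1
    refine h1.congr fun m => ?_
    rw [hρ]; simp only [one_div, inv_pow]; ring
  -- The cubes are not centred at x, but each lies in a ball about x whose volume is a fixed
  -- multiple of its own, so differentiation along closed balls suffices.
  have hlim := hx.comp (IsUnifLocDoublingMeasure.tendsto_closedBall_filterAt volume
    (K := 1) (fun _ : ℕ => x) ρ hρlim (Filter.Eventually.of_forall fun m => by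
      simpa using (hρ0 m).le))
  have hlim2 : Filter.Tendsto (fun m : ℕ => (ballCubeRatio n : ℝ≥0∞) *
      ((∫⁻ y in closedBall x (ρ m), ‖b y - b x‖ₑ) / volume (closedBall x (ρ m))) + l)
      Filter.atTop (nhds ((ballCubeRatio n : ℝ≥0∞) * 0 + l)) :=
    (ENNReal.Tendsto.const_mul hlim (Or.inr (by simp))).add_const _
  rw [mul_zero, zero_add] at hlim2
  refine ge_of_tendsto hlim2 ?_
  filter_upwards [Filter.eventually_ge_atTop k] with m hkm
  set Q := cubeIdx o ℓ m ⁻¹' {cubeIdx o ℓ m x} with hQ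
  have hQ0 : volume Q ≠ 0 := (isNestedGrid_cubeIdx o hℓ).measure_pos m x
  have hQt : volume Q ≠ ∞ := (isNestedGrid_cubeIdx o hℓ).measure_lt_top m x
  have hQB : Q ⊆ closedBall x (ρ m) := (cubeIdx_subset_ball hℓ m x).trans ball_subset_closedBall
  have hvol : volume (closedBall x (ρ m)) = ballCubeRatio n * volume Q := by
    rw [← volume_ball_eq_cubeIdx hℓ m _ x]
    rcases Nat.eq_zero_or_pos n with rfl | hn
    · rw [Subsingleton.eq_univ_of_nonempty (nonempty_closedBall.2 (hρ0 m).le),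
        Subsingleton.eq_univ_of_nonempty (nonempty_ball.2 (hρ0 m))]
    · have : Nontrivial (EuclideanSpace ℝ (Fin n)) :=
        Module.nontrivial_of_finrank_pos (R := ℝ) (by simpa using hn)
      exact Measure.addHaar_closedBall_eq_addHaar_ball _ _ _
  have hK0 : (ballCubeRatio n : ℝ≥0∞) ≠ 0 := by
    intro h0
    rw [h0, zero_mul] at hvol
    exact hQ0 (measure_mono_null hQB hvol)
  rw [← ENNReal.mul_le_mul_iff_left hQ0 hQt]
  calc ‖b x - d‖ₑ * volume Q = ∫⁻ _y in Q, ‖b x - d‖ₑ := by rw [setLIntegral_const]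
    _ ≤ ∫⁻ y in Q, (‖b y - b x‖ₑ + ‖b y - d‖ₑ) := by
        refine lintegral_mono fun y => ?_
        have : b x - d = -(b y - b x) + (b y - d) := by abel
        rw [this]
        exact (enorm_add_le _ _).trans_eq (by rw [enorm_neg])
    _ = (∫⁻ y in Q, ‖b y - b x‖ₑ) + ∫⁻ y in Q, ‖b y - d‖ₑ :=
        lintegral_add_left (hbm.sub_const _).enorm _
    _ ≤ (∫⁻ y in closedBall x (ρ m), ‖b y - b x‖ₑ) + l * volume Q :=
        add_le_add (lintegral_mono_set hQB) (hm m hkm)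
    _ = _ := by
        rw [add_mul, hvol]
        congr 1
        rw [ENNReal.div_eq_inv_mul, ENNReal.mul_inv (Or.inl hK0) (Or.inl (by simp))]
        have e1 := ENNReal.mul_inv_cancel hK0 (by simp)
        have e2 := ENNReal.inv_mul_cancel hQ0 hQt
        calc _ = 1 * 1 * ∫⁻ y in closedBall x (ρ m), ‖b y - b x‖ₑ := by simp
          _ = (ballCubeRatio n * (ballCubeRatio n : ℝ≥0∞)⁻¹) * ((volume Q)⁻¹ * volume Q) *
              ∫⁻ y in closedBall x (ρ m), ‖b y - b x‖ₑ := by rw [e1, e2]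
          _ = _ := by ring

/-- Taking e^{δL} = 2/(1 + θ) works, since 2θ < 1 + θ. -/
theorem exists_exp_mul_lt_one {θ : ℝ≥0∞} (hθ : θ < 1) {L : ℝ} (hL : 0 < L) :
    ∃ δ : ℝ, 0 < δ ∧ ENNReal.ofReal (Real.exp (δ * L)) * θ < 1 := by
  have ht : θ ≠ ∞ := (hθ.trans ENNReal.one_lt_top).ne
  have h1 : θ.toReal < 1 := by
    rw [← ENNReal.toReal_one]; exact (ENNReal.toReal_lt_toReal ht (by simp)).2 hθ
  have h0 : 0 ≤ θ.toReal := ENNReal.toReal_nonneg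
  have h2 : 1 < 2 / (1 + θ.toReal) := by rw [lt_div_iff₀ (by linarith)]; linarith
  refine ⟨Real.log (2 / (1 + θ.toReal)) / L, div_pos (Real.log_pos h2) hL, ?_⟩
  rw [div_mul_cancel₀ _ hL.ne', Real.exp_log (by linarith)]
  nth_rewrite 2 [← ENNReal.ofReal_toReal ht]
  rw [← ENNReal.ofReal_mul (by linarith), ← ENNReal.ofReal_one]
  refine (ENNReal.ofReal_lt_ofReal_iff one_pos).2 ?_
  rw [div_mul_eq_mul_div, div_lt_one (by linarith)]
  linarith

/-- **John–Nirenberg inequality** on balls with respect to an `A_∞` measure. -/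
theorem IsAInfty.exists_lintegral_exp_le (𝕜 : Type*) [RCLike 𝕜] {a : ℝ} {C : ℝ≥0}
    {ν : Measure (EuclideanSpace ℝ (Fin n))} (hν : IsAInfty a C ν) (ha : 0 ≤ a) (hC : 0 < C)
    (H : ℝ≥0) :
    ∃ (δ : ℝ) (K : ℝ≥0), 0 < δ ∧ ∀ (b : EuclideanSpace ℝ (Fin n) → 𝕜)
      (c : EuclideanSpace ℝ (Fin n) → ℝ → 𝕜), Measurable b → HasMeanOscillationLE H b c →
      ∀ x r, 0 < r →
        ∫⁻ y in ball x r, ENNReal.ofReal (Real.exp (δ * ‖b y - c x r‖)) ∂ν ≤ K * ν (ball x r) := by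
  -- H' bounds the oscillation on cubes about constants of enclosing balls. The height l is at least
  -- 2H', so that the stopping cells fill at most half of a cube, and the extra 1 keeps it positive
  -- when H = 0. Λ dominates both l and the jump H' + 2^n l between a cube and a stopping cell.
  set H' : ℝ≥0 := H * ballCubeRatio n with hH'
  set l : ℝ≥0 := 2 * H' + 1 with hl
  set Λ : ℝ≥0 := H' + 2 ^ n * l + l with hΛ
  have hl0 : 0 < l := by positivity
  have hΛ0 : (0 : ℝ) < Λ := by
    have : 0 < Λ := by positivity
    exact_mod_cast this
  set η : ℝ≥0∞ := (C * (2 * ballCubeRatio n : ℝ≥0∞) ^ a)⁻¹ with hη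
  have hη0 : η ≠ 0 := by
    rw [hη, Ne, ENNReal.inv_eq_zero]
    exact ENNReal.mul_ne_top (by simp) (ENNReal.rpow_ne_top_of_nonneg ha
      (ENNReal.mul_ne_top (by simp) (by simp)))
  have hθ : 1 - η < 1 := ENNReal.sub_lt_self (by simp) (by simp) hη0
  obtain ⟨δ, hδ, hδθ⟩ := exists_exp_mul_lt_one hθ hΛ0
  set e := ENNReal.ofReal (Real.exp (δ * Λ)) with he
  -- D bounds the difference between the constant of B(x, r) and that of the ball around the root
  -- cube, whose radius is 2(√n + 1) r.
  set D : ℝ≥0 := H * (1 + Real.toNNReal ((√n + 1) * 2) ^ n) with hD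
  set K₁ : ℝ≥0∞ := 1 + e * (1 - e * (1 - η))⁻¹ with hK₁
  have hK₁t : K₁ ≠ ∞ := by
    refine ENNReal.add_ne_top.2 ⟨by simp, ENNReal.mul_ne_top (by simp [he]) ?_⟩
    rw [Ne, ENNReal.inv_eq_top, tsub_eq_zero_iff_le, not_le]
    exact hδθ
  set K₂ : ℝ≥0∞ := ENNReal.ofReal (Real.exp (δ * D)) * (K₁ *
    (C * (ENNReal.ofReal ((√n + 1) * 2) ^ n) ^ a)) with hK₂
  have hK₂t : K₂ ≠ ∞ := by
    refine ENNReal.mul_ne_top (by simp) (ENNReal.mul_ne_top hK₁t (ENNReal.mul_ne_top (by simp)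
      (ENNReal.rpow_ne_top_of_nonneg ha (ENNReal.pow_ne_top (by simp)))))
  refine ⟨δ, K₂.toNNReal, hδ, fun b c hb hbc x r hr => ?_⟩
  rw [ENNReal.coe_toNNReal hK₂t]
  set o := x - WithLp.toLp 2 fun _ => r with ho
  have h2r : 0 < 2 * r := by positivity
  -- Constants are given on balls only, so each cube borrows that of a ball centred at a chosen
  -- point of it.
  choose y hy using fun (m : ℕ) (z : Fin n → ℤ) => cubeIdx_nonempty o h2r m z
  set ρ : ℕ → ℝ := fun m => (√n + 1) * (2 * r / 2 ^ m) with hρ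
  have hρ0 : ∀ m, 0 < ρ m := fun m => by positivity
  have hQB : ∀ m z, cubeIdx o (2 * r) m ⁻¹' {z} ⊆ ball (y m z) (ρ m) := by
    intro m z
    have := cubeIdx_subset_ball (a := o) h2r m (y m z)
    rwa [show cubeIdx o (2 * r) m (y m z) = z from hy m z] at this
  have hdist := (isNestedGrid_cubeIdx o h2r).measure_lt_enorm_sub_le (ν := ν)
    hν.absolutelyContinuous (ε := 1 / 2) (H := H') (l := l) (Λ := Λ) (θ := 1 - η) hl0
    (by rw [hl, mul_add, ← mul_assoc]; simp) (by rw [hl]; linarith [zero_le (a := H')])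
    (by rw [hΛ]; exact le_add_self)
    (by rw [hΛ]; exact le_self_add)
    (fun m z E hE hEQ hE2 => hν.cube_le ha hC h2r m z hE hEQ hE2)
    (b := b) (c := fun m z => c (y m z) (ρ m)) (fun m z => (hb.sub_const _).enorm)
    (fun m z => by
      refine (lintegral_mono_set (hQB m z)).trans ((hbc _ _ (hρ0 m)).trans_eq ?_)
      rw [volume_ball_eq_cubeIdx h2r m z, hH']
      push_cast; ring)
    (fun k z => ae_enorm_le_of_cubeIdx (hbc.locallyIntegrable hb) hb o h2r _ l k)
  set Q := cubeIdx o (2 * r) 0 ⁻¹' {fun _ => 0} with hQ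
  set c₀ := c (y 0 fun _ => 0) (ρ 0) with hc₀
  have hBQ : ball x r ⊆ Q := ball_subset_cubeIdx x hr
  have hexp := lintegral_exp_le_of_measure_lt (ν := ν) (Q := Q) (u := fun v => ‖b v - c₀‖)
    (hb.sub_const _).norm (fun _ => norm_nonneg _) (L := Λ) (δ := δ) hΛ0 hδ (θ := 1 - η)
    (fun j => by
      refine le_trans (measure_mono ?_) (hdist j 0 fun _ => 0)
      rintro v ⟨hv, hv'⟩
      refine ⟨hv, ?_⟩
      rw [mem_ofPred_eq] at hv' ⊢
      rw [← ofReal_norm, ← ENNReal.ofReal_coe_nnreal, ← ENNReal.ofReal_natCast,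
        ← ENNReal.ofReal_mul (by positivity)]
      exact (ENNReal.ofReal_lt_ofReal_iff_of_nonneg (by positivity)).2 hv')
  rw [ENNReal.tsum_geometric] at hexp
  have hcD : ‖c x r - c₀‖ ≤ D := by
    have h1 := hbc.enorm_sub_le hb hr (hρ0 0) (hBQ.trans (hQB 0 _))
    have h2 : ρ 0 / r = (√n + 1) * 2 := by rw [hρ]; field_simp
    rw [h2, ← ofReal_norm] at h1
    have h3 : ENNReal.ofReal ‖c x r - c₀‖ ≤ ENNReal.ofReal D := by
      rw [ENNReal.ofReal_coe_nnreal, hD]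
      push_cast
      exact h1
    exact (ENNReal.ofReal_le_ofReal_iff D.2).1 h3
  calc ∫⁻ v in ball x r, ENNReal.ofReal (Real.exp (δ * ‖b v - c x r‖)) ∂ν
      ≤ ∫⁻ v in Q, ENNReal.ofReal (Real.exp (δ * D)) *
          ENNReal.ofReal (Real.exp (δ * ‖b v - c₀‖)) ∂ν := by
        refine (lintegral_mono_set hBQ).trans (lintegral_mono fun v => ?_)
        rw [← ENNReal.ofReal_mul (Real.exp_pos _).le, ← Real.exp_add, ← mul_add]
        refine ENNReal.ofReal_le_ofReal (Real.exp_le_exp.2 (mul_le_mul_of_nonneg_left ?_ hδ.le))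
        calc ‖b v - c x r‖ = ‖(b v - c₀) - (c x r - c₀)‖ := by congr 1; abel
          _ ≤ ‖b v - c₀‖ + ‖c x r - c₀‖ := norm_sub_le _ _
          _ ≤ _ := by linarith
    _ ≤ ENNReal.ofReal (Real.exp (δ * D)) * (K₁ * ν Q) := by
        rw [lintegral_const_mul' _ _ (by simp)]
        gcongr
    _ ≤ ENNReal.ofReal (Real.exp (δ * D)) * (K₁ * (C * (ENNReal.ofReal ((√n + 1) * 2) ^ n) ^ a *
          ν (ball x r))) := by
        gcongr
        have h2 : ρ 0 / r = (√n + 1) * 2 := by rw [hρ]; field_simp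
        rw [← h2]
        exact (measure_mono (hQB 0 _)).trans
          (hν.measure_ball_le ha hr (hρ0 0) (hBQ.trans (hQB 0 _)))
    _ = _ := by rw [hK₂]; ring

end JohnNirenberg

/-! ### Moments of the oscillation and logarithmic growth. -/

section Oscillation

variable {n : ℕ} {𝕜 : Type*} [RCLike 𝕜]
  {H : ℝ≥0} {b : EuclideanSpace ℝ (Fin n) → 𝕜} {c : EuclideanSpace ℝ (Fin n) → ℝ → 𝕜}

/-- The oscillation constants grow at most logarithmically in the radius. -/
theorem HasMeanOscillationLE.norm_sub_le_log (h : HasMeanOscillationLE H b c) (hb : Measurable b)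
    (x : EuclideanSpace ℝ (Fin n)) {r t : ℝ} (hr : 0 < r) (hrt : r ≤ t) :
    ‖c x r - c x t‖ ≤ 2 * (H * (1 + 2 ^ n)) * (1 + Real.log (t / r)) := by
  set M : ℝ := H * (1 + 2 ^ n) with hM
  have hM0 : 0 ≤ M := by positivity
  have step : ∀ s u : ℝ, 0 < s → s ≤ u → u ≤ 2 * s → ‖c x s - c x u‖ ≤ M := by
    intro s u hs hsu hu
    have h1 := h.enorm_sub_le hb (x := x) (y := x) hs (hs.trans_le hsu) (ball_subset_ball hsu)
    have h2 : ‖c x s - c x u‖ₑ ≤ ENNReal.ofReal M := by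
      refine h1.trans ?_
      rw [hM, ENNReal.ofReal_mul (by positivity), ENNReal.ofReal_coe_nnreal,
        ENNReal.ofReal_add zero_le_one (by positivity), ENNReal.ofReal_one,
        ENNReal.ofReal_pow (by norm_num)]
      gcongr
      rw [div_le_iff₀ hs]; exact hu
    rw [← ofReal_norm] at h2
    exact (ENNReal.ofReal_le_ofReal_iff hM0).1 h2
  have chain : ∀ k : ℕ, ‖c x r - c x (2 ^ k * r)‖ ≤ k * M := by
    intro k
    induction k with
    | zero => simp
    | succ k ih =>
      have h1 := step (2 ^ k * r) (2 ^ (k + 1) * r) (by positivity)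
        (by rw [pow_succ]; nlinarith [show 0 < 2 ^ k * r by positivity])
        (by rw [pow_succ]; linarith)
      have h2 := norm_sub_le_norm_sub_add_norm_sub (c x r) (c x (2 ^ k * r))
        (c x (2 ^ (k + 1) * r))
      push_cast
      linarith
  have h1 : 1 ≤ t / r := by rwa [le_div_iff₀ hr, one_mul]
  -- After k doublings one last step of ratio at most 2 reaches t, so the total is (k + 1) M; since
  -- log 2 ≥ 1/2, k is at most 2 log (t / r).
  obtain ⟨k, hk, hk'⟩ := exists_nat_pow_near h1 (one_lt_two (α := ℝ))
  rw [le_div_iff₀ hr] at hk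
  rw [div_lt_iff₀ hr] at hk'
  have h3 := step (2 ^ k * r) t (by positivity) hk (by rw [pow_succ] at hk'; linarith)
  have h4 := norm_sub_le_norm_sub_add_norm_sub (c x r) (c x (2 ^ k * r)) (c x t)
  have h5 : (k : ℝ) ≤ 2 * Real.log (t / r) := by
    have h6 : (2 : ℝ) ^ k ≤ t / r := by rwa [le_div_iff₀ hr]
    have h7 := Real.log_le_log (by positivity) h6
    rw [Real.log_pow] at h7
    have h8 : (1 / 2 : ℝ) ≤ Real.log 2 := by linarith [Real.log_two_gt_d9]
    nlinarith [show (0 : ℝ) ≤ k by positivity]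
  have h6 := chain k
  nlinarith

/-- This is v ≤ e^v at v = δu/P, raised to the power P. -/
theorem rpow_le_exp {P δ u : ℝ} (hP : 0 < P) (hδ : 0 < δ) (hu : 0 ≤ u) :
    u ^ P ≤ (P / δ) ^ P * Real.exp (δ * u) := by
  have h1 : u ≤ (P / δ) * Real.exp (δ * u / P) := by
    have h2 : δ * u / P ≤ Real.exp (δ * u / P) := by
      linarith [Real.add_one_le_exp (δ * u / P)]
    calc u = (P / δ) * (δ * u / P) := by field_simp
      _ ≤ _ := by gcongr
  calc u ^ P ≤ ((P / δ) * Real.exp (δ * u / P)) ^ P := Real.rpow_le_rpow hu h1 hP.le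
    _ = _ := by
      rw [Real.mul_rpow (by positivity) (Real.exp_pos _).le, ← Real.exp_mul]
      congr 2
      field_simp

/-- Weighted moments of the oscillation about the constant of a smaller concentric ball. -/
theorem IsAInfty.exists_moment_le (𝕜 : Type*) [RCLike 𝕜] {a : ℝ} {C : ℝ≥0}
    {ν : Measure (EuclideanSpace ℝ (Fin n))} (hν : IsAInfty a C ν) (ha : 0 ≤ a) (hC : 0 < C)
    (H : ℝ≥0) {P : ℝ} (hP : 1 ≤ P) :
    ∃ K : ℝ≥0, ∀ (b : EuclideanSpace ℝ (Fin n) → 𝕜)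
      (c : EuclideanSpace ℝ (Fin n) → ℝ → 𝕜), Measurable b → HasMeanOscillationLE H b c →
      ∀ (x : EuclideanSpace ℝ (Fin n)) (r t : ℝ), 0 < r → r ≤ t → ∀ A : ℝ≥0∞,
        (∫⁻ y in ball x t, (A + ‖b y - c x r‖ₑ) ^ P ∂ν) ^ (1 / P) ≤
          K * (A + ENNReal.ofReal (1 + Real.log (t / r))) * ν (ball x t) ^ (1 / P) := by
  obtain ⟨δ, K, hδ, hJN⟩ := hν.exists_lintegral_exp_le 𝕜 ha hC H
  have hP0 : 0 < P := by linarith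
  have hP1 : 0 ≤ 1 / P := by positivity
  set D : ℝ≥0 := 2 * (H * (1 + 2 ^ n)) with hD
  set K₁ : ℝ≥0∞ := ((1 + D : ℝ≥0) : ℝ≥0∞) + ENNReal.ofReal (P / δ) * (K : ℝ≥0∞) ^ (1 / P)
  have hK₁ : K₁ ≠ ∞ := ENNReal.add_ne_top.2 ⟨ENNReal.coe_ne_top, ENNReal.mul_ne_top (by simp)
    (ENNReal.rpow_ne_top_of_nonneg hP1 (by simp))⟩
  refine ⟨K₁.toNNReal, fun b c hb hbc x r t hr hrt A => ?_⟩
  rw [ENNReal.coe_toNNReal hK₁]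
  have hL0 : 0 ≤ Real.log (t / r) := Real.log_nonneg (by rwa [le_div_iff₀ hr, one_mul])
  set L := 1 + Real.log (t / r) with hL
  have ht : 0 < t := hr.trans_le hrt
  have hcc : ‖c x r - c x t‖ₑ ≤ D * ENNReal.ofReal L := by
    rw [← ofReal_norm, ← ENNReal.ofReal_coe_nnreal, ← ENNReal.ofReal_mul (NNReal.coe_nonneg D)]
    refine ENNReal.ofReal_le_ofReal ?_
    have := hbc.norm_sub_le_log hb x hr hrt
    rw [hD]; push_cast; exact this
  have hu : ∫⁻ y in ball x t, ‖b y - c x t‖ₑ ^ P ∂ν ≤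
      ENNReal.ofReal (P / δ) ^ P * (K * ν (ball x t)) := by
    refine le_trans ?_ (mul_le_mul_right (hJN b c hb hbc x t ht) _)
    rw [← lintegral_const_mul' _ _ (ENNReal.rpow_ne_top_of_nonneg hP0.le (by simp))]
    refine lintegral_mono fun y => ?_
    rw [← ofReal_norm, ENNReal.ofReal_rpow_of_nonneg (norm_nonneg _) hP0.le,
      ENNReal.ofReal_rpow_of_nonneg (by positivity) hP0.le,
      ← ENNReal.ofReal_mul (by positivity)]
    exact ENNReal.ofReal_le_ofReal (rpow_le_exp hP0 hδ (norm_nonneg _))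
  -- Recentring at c x t costs D * L. This constant joins A, and Minkowski's inequality separates it
  -- from the oscillation controlled by John–Nirenberg on B(x, t).
  calc (∫⁻ y in ball x t, (A + ‖b y - c x r‖ₑ) ^ P ∂ν) ^ (1 / P)
      ≤ (∫⁻ y in ball x t, ((A + D * ENNReal.ofReal L) + ‖b y - c x t‖ₑ) ^ P ∂ν) ^ (1 / P) := by
        refine ENNReal.rpow_le_rpow (lintegral_mono fun y => ENNReal.rpow_le_rpow ?_ hP0.le) hP1
        have : b y - c x r = (b y - c x t) - (c x r - c x t) := by abel
        calc A + ‖b y - c x r‖ₑ ≤ A + (‖b y - c x t‖ₑ + ‖c x r - c x t‖ₑ) := by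
              gcongr; rw [this]; exact enorm_sub_le
          _ ≤ A + (‖b y - c x t‖ₑ + D * ENNReal.ofReal L) := by gcongr
          _ = _ := by ring
    _ ≤ (∫⁻ y in ball x t, (A + D * ENNReal.ofReal L) ^ P ∂ν) ^ (1 / P) +
          (∫⁻ y in ball x t, ‖b y - c x t‖ₑ ^ P ∂ν) ^ (1 / P) :=
        ENNReal.lintegral_Lp_add_le aemeasurable_const (hb.sub_const _).enorm.aemeasurable hP
    _ ≤ (A + D * ENNReal.ofReal L) * ν (ball x t) ^ (1 / P) +
          (ENNReal.ofReal (P / δ) ^ P * (K * ν (ball x t))) ^ (1 / P) := by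
        gcongr
        rw [setLIntegral_const, ENNReal.mul_rpow_of_nonneg _ _ hP1, ← ENNReal.rpow_mul,
          mul_one_div_cancel hP0.ne', ENNReal.rpow_one]
    _ = ((A + D * ENNReal.ofReal L) + ENNReal.ofReal (P / δ) * (K : ℝ≥0∞) ^ (1 / P)) *
          ν (ball x t) ^ (1 / P) := by
        rw [ENNReal.mul_rpow_of_nonneg _ _ hP1, ENNReal.mul_rpow_of_nonneg _ _ hP1,
          ← ENNReal.rpow_mul, mul_one_div_cancel hP0.ne', ENNReal.rpow_one]
        ring
    _ ≤ _ := by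
        gcongr
        have hL1 : (1 : ℝ≥0∞) ≤ A + ENNReal.ofReal L := by
          refine le_trans ?_ le_add_self
          rw [← ENNReal.ofReal_one]
          exact ENNReal.ofReal_le_ofReal (by linarith)
        calc _ ≤ (1 + D) * (A + ENNReal.ofReal L) +
              ENNReal.ofReal (P / δ) * (K : ℝ≥0∞) ^ (1 / P) * (A + ENNReal.ofReal L) := by
              refine add_le_add ?_ (le_mul_of_one_le_right' hL1)
              rw [add_mul, one_mul, mul_add]
              exact add_le_add le_self_add le_add_self
          _ = _ := by simp only [K₁]; push_cast; ring

/-- The part of the oscillation above a multiple of `1 + log (t / r)` has, on `B(x, t)`, moments of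
the size of the smaller ball `B(x, r)`. -/
theorem exists_tail_moment_le (n : ℕ) (𝕜 : Type*) [RCLike 𝕜] (H : ℝ≥0) {P : ℝ} (hP : 0 < P) :
    ∃ D K : ℝ≥0, ∀ (b : EuclideanSpace ℝ (Fin n) → 𝕜)
      (c : EuclideanSpace ℝ (Fin n) → ℝ → 𝕜), Measurable b → HasMeanOscillationLE H b c →
      ∀ (x : EuclideanSpace ℝ (Fin n)) (r t : ℝ), 0 < r → r ≤ t →
        ∫⁻ y in ball x t, (‖b y - c x r‖ₑ - D * ENNReal.ofReal (1 + Real.log (t / r))) ^ P ≤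
          K * volume (ball x r) := by
  obtain ⟨δ, K, hδ, hJN⟩ := (isAInfty_volume (n := n)).exists_lintegral_exp_le 𝕜 zero_le_one
    one_pos H
  set D₁ : ℝ≥0 := 2 * (H * (1 + 2 ^ n)) with hD₁
  -- D₁ pays for the change of constants. Subtracting a further (n / δ) log (t / r) multiplies
  -- e^{δu} by (r / t)^n, exactly the ratio of the volumes of B(x, r) and B(x, t).
  refine ⟨D₁ + Real.toNNReal (n / δ), Real.toNNReal ((P / δ) ^ P) * K,
    fun b c hb hbc x r t hr hrt => ?_⟩
  have ht : 0 < t := hr.trans_le hrt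
  have hL0 : 0 ≤ Real.log (t / r) := Real.log_nonneg (by rwa [le_div_iff₀ hr, one_mul])
  have hpt : ∀ y, (‖b y - c x r‖ₑ - ((D₁ + Real.toNNReal (n / δ) : ℝ≥0) : ℝ≥0∞) *
      ENNReal.ofReal (1 + Real.log (t / r))) ^ P ≤
      (ENNReal.ofReal ((P / δ) ^ P) * ENNReal.ofReal (r / t) ^ n) *
        ENNReal.ofReal (Real.exp (δ * ‖b y - c x t‖)) := by
    intro y
    set u := ‖b y - c x t‖ with hu
    set v := max (u - n / δ * Real.log (t / r)) 0 with hv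
    have h1 : ‖b y - c x r‖ₑ - ((D₁ + Real.toNNReal (n / δ) : ℝ≥0) : ℝ≥0∞) *
        ENNReal.ofReal (1 + Real.log (t / r)) ≤ ENNReal.ofReal v := by
      rw [tsub_le_iff_right, ← ofReal_norm, ← ENNReal.ofReal_coe_nnreal,
        ← ENNReal.ofReal_mul (NNReal.coe_nonneg _), ← ENNReal.ofReal_add (le_max_right _ _)
        (by positivity)]
      refine ENNReal.ofReal_le_ofReal ?_
      have h2 := hbc.norm_sub_le_log hb x hr hrt
      have h3 : ‖b y - c x r‖ ≤ u + ‖c x r - c x t‖ := by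
        rw [hu, show b y - c x r = (b y - c x t) - (c x r - c x t) by abel]
        exact norm_sub_le _ _
      have h4 := le_max_left (u - n / δ * Real.log (t / r)) 0
      rw [← hv] at h4
      push_cast
      rw [Real.coe_toNNReal _ (by positivity)]
      have h5 : (0 : ℝ) ≤ n / δ := by positivity
      have h6 : (D₁ : ℝ) = 2 * (H * (1 + 2 ^ n)) := by rw [hD₁]; push_cast; rfl
      rw [h6]
      nlinarith
    calc _ ≤ ENNReal.ofReal v ^ P := ENNReal.rpow_le_rpow h1 hP.le
      _ ≤ ENNReal.ofReal ((P / δ) ^ P * ((r / t) ^ n * Real.exp (δ * u))) := by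
          rw [ENNReal.ofReal_rpow_of_nonneg (le_max_right _ _) hP.le]
          refine ENNReal.ofReal_le_ofReal ?_
          rcases le_total (u - n / δ * Real.log (t / r)) 0 with h | h
          · rw [max_eq_right h, Real.zero_rpow hP.ne']
            positivity
          · rw [max_eq_left h]
            refine (rpow_le_exp hP hδ h).trans (le_of_eq ?_)
            congr 1
            have h2 : δ * (u - n / δ * Real.log (t / r)) = δ * u + n * Real.log (r / t) := by
              rw [Real.log_div ht.ne' hr.ne', Real.log_div hr.ne' ht.ne']; field_simp; ring
            rw [h2, Real.exp_add, Real.exp_nat_mul, Real.exp_log (by positivity), mul_comm]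
      _ = _ := by
          rw [ENNReal.ofReal_mul (by positivity), ENNReal.ofReal_mul (by positivity),
            ENNReal.ofReal_pow (by positivity)]
          ring
  refine (lintegral_mono hpt).trans ?_
  rw [lintegral_const_mul' _ _ (ENNReal.mul_ne_top (by simp) (ENNReal.pow_ne_top (by simp)))]
  refine (mul_le_mul_right (hJN b c hb hbc x t ht) _).trans (le_of_eq ?_)
  rw [volume_ball_ratio x x ht hr]
  push_cast
  rw [ENNReal.ofReal]
  ring

end Oscillation

/-! ### Weights as A_∞ measures; reverse Hölder inequality for A_1. -/

section Weights

variable {n : ℕ}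

/-- The two weights `v` and `σ = v ^ (1 - a')` of an `A_a` pair are `A_∞`. -/
theorem isAInfty_of_dual {a : ℝ} (ha : 1 < a) {C : ℝ≥0} {v σ : EuclideanSpace ℝ (Fin n) → ℝ≥0∞}
    (hv : Measurable v) (hσ : Measurable σ) (hvt : ∀ x r, ∫⁻ y in ball x r, v y ≠ ∞)
    (hdual : ∀ᵐ y, v y ^ (1 / a) * σ y ^ (1 / a.conjExponent) = 1)
    (h : ∀ x r, 0 < r → (∫⁻ y in ball x r, v y) * (∫⁻ y in ball x r, σ y) ^ (a - 1) ≤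
      C * volume (ball x r) ^ a) :
    IsAInfty a C (volume.withDensity v) where
  absolutelyContinuous := withDensity_absolutelyContinuous _ _
  measure_ball_ne_top x r := by
    rw [withDensity_apply _ measurableSet_ball]; exact hvt x r
  le x r hr F hF hFm := by
    have ha0 : 0 < a := by linarith
    have hc : a.HolderConjugate a.conjExponent := Real.HolderConjugate.conjExponent ha
    rw [withDensity_apply _ measurableSet_ball, withDensity_apply _ hFm]
    -- Hölder applied to 1 = v^{1/a} σ^{1/a'} on F; enlarging the domain of the σ integral to the
    -- ball then brings in the A_a condition.
    have h1 : volume F ≤ (∫⁻ y in F, v y) ^ (1 / a) *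
        (∫⁻ y in F, σ y) ^ (1 / a.conjExponent) := by
      calc volume F = ∫⁻ y in F, v y ^ (1 / a) * σ y ^ (1 / a.conjExponent) := by
            rw [lintegral_congr_ae (ae_restrict_of_ae hdual)]; simp
        _ ≤ _ := ENNReal.lintegral_mul_le_Lp_mul_Lq _ hc (hv.pow_const _).aemeasurable
            (hσ.pow_const _).aemeasurable
        _ = _ := by
            simp_rw [← ENNReal.rpow_mul]
            rw [one_div_mul_cancel ha0.ne', one_div_mul_cancel hc.symm.pos.ne']
            simp
    have h2 : volume F ^ a ≤ (∫⁻ y in F, v y) * (∫⁻ y in ball x r, σ y) ^ (a - 1) := by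
      calc volume F ^ a ≤ ((∫⁻ y in F, v y) ^ (1 / a) *
            (∫⁻ y in ball x r, σ y) ^ (1 / a.conjExponent)) ^ a := by
            refine ENNReal.rpow_le_rpow (h1.trans ?_) ha0.le
            gcongr
            have := hc.symm.pos
            positivity
        _ = _ := by
            rw [ENNReal.mul_rpow_of_nonneg _ _ ha0.le, ← ENNReal.rpow_mul, ← ENNReal.rpow_mul,
              one_div_mul_cancel ha0.ne', ENNReal.rpow_one]
            congr 2
            rw [Real.conjExponent]
            field_simp [show a - 1 ≠ 0 by linarith]
    calc _ ≤ (∫⁻ y in ball x r, v y) *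
          ((∫⁻ y in F, v y) * (∫⁻ y in ball x r, σ y) ^ (a - 1)) := by gcongr
      _ = (∫⁻ y in F, v y) *
          ((∫⁻ y in ball x r, v y) * (∫⁻ y in ball x r, σ y) ^ (a - 1)) := by ring
      _ ≤ (∫⁻ y in F, v y) * (C * volume (ball x r) ^ a) := mul_le_mul_right (h x r hr) _
      _ = _ := by ring

theorem setLIntegral_ball_ne_zero {v : EuclideanSpace ℝ (Fin n) → ℝ≥0∞} (hv : AEMeasurable v)
    (hv0 : ∀ᵐ y, 0 < v y) (x : EuclideanSpace ℝ (Fin n)) {r : ℝ} (hr : 0 < r) :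
    ∫⁻ y in ball x r, v y ≠ 0 := by
  intro h0
  rw [lintegral_eq_zero_iff' hv.restrict] at h0
  have h1 : ∀ᵐ _y ∂(volume.restrict (ball x r)), False := by
    filter_upwards [h0, ae_restrict_of_ae hv0] with y hy hy'
    exact hy'.ne' hy
  rw [Filter.eventually_false_iff_eq_bot, ae_eq_bot, Measure.restrict_eq_zero] at h1
  exact volume_ball_ne_zero x hr h1

/-- The **reverse Hölder inequality** for `A_1` weights. -/
theorem exists_reverse_holder {w : EuclideanSpace ℝ (Fin n) → ℝ≥0∞} (hw : Measurable w)
    (hw0 : ∀ᵐ y, 0 < w y ∧ w y < ∞) (hwt : ∀ x r, ∫⁻ y in ball x r, w y ≠ ∞) {C : ℝ≥0}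
    (hC : ∀ x r, 0 < r → ∀ᵐ y ∂(volume.restrict (ball x r)),
      ∫⁻ y in ball x r, w y ≤ C * volume (ball x r) * w y)
    {ε₀ : ℝ} (hε₀ : 0 < ε₀) (hA : IsAInfty 1 (C + 1) (volume.withDensity w)) :
    ∃ (ε : ℝ) (K : ℝ≥0), 0 < ε ∧ ε ≤ ε₀ ∧ ∀ x r, 0 < r →
      ∫⁻ y in ball x r, w y ^ (1 + ε) ≤
        K * ((∫⁻ y in ball x r, w y) / volume (ball x r)) ^ ε * ∫⁻ y in ball x r, w y := by
  set C₁ : ℝ := max C 1 with hC₁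
  set H : ℝ≥0 := Real.toNNReal (Real.log C₁) + 1 with hH
  -- John–Nirenberg is used for the measure w dx itself: exponential integrability of log w against
  -- w is extra integrability of w.
  obtain ⟨δ, K, hδ, hJN⟩ := hA.exists_lintegral_exp_le ℝ zero_le_one (by positivity) H
  set avg : EuclideanSpace ℝ (Fin n) → ℝ → ℝ≥0∞ :=
    fun x r => (∫⁻ y in ball x r, w y) / volume (ball x r) with havg
  have havg0 : ∀ x r, 0 < r → avg x r ≠ 0 := fun x r hr =>
    ENNReal.div_ne_zero.2 ⟨setLIntegral_ball_ne_zero hw.aemeasurable (hw0.mono fun _ h => h.1) x hr,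
      measure_ball_lt_top.ne⟩
  have havgt : ∀ x r, 0 < r → avg x r ≠ ∞ := fun x r hr =>
    ENNReal.div_ne_top (hwt x r) (volume_ball_ne_zero x hr)
  set b : EuclideanSpace ℝ (Fin n) → ℝ := fun y => Real.log (w y).toReal with hb
  set c : EuclideanSpace ℝ (Fin n) → ℝ → ℝ := fun x r => Real.log (avg x r).toReal with hc
  have hbm : Measurable b := hw.ennreal_toReal.log
  have hosc : HasMeanOscillationLE H b c := by
    intro x r hr
    have hpt : ∀ᵐ y ∂(volume.restrict (ball x r)), ‖b y - c x r‖ₑ ≤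
        Real.toNNReal (Real.log C₁) + w y * (avg x r)⁻¹ := by
      filter_upwards [hC x r hr, ae_restrict_of_ae hw0] with y hy hy0
      have hA0 : 0 < (avg x r).toReal := ENNReal.toReal_pos (havg0 x r hr) (havgt x r hr)
      have hw1 : 0 < (w y).toReal := ENNReal.toReal_pos hy0.1.ne' hy0.2.ne
      have h1 : (avg x r).toReal ≤ C₁ * (w y).toReal := by
        have h2 : avg x r ≤ ENNReal.ofReal C₁ * w y := by
          refine ENNReal.div_le_of_le_mul (hy.trans ?_)
          calc (C : ℝ≥0∞) * volume (ball x r) * w y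
              ≤ ENNReal.ofReal C₁ * volume (ball x r) * w y := by
                gcongr
                rw [← ENNReal.ofReal_coe_nnreal]
                exact ENNReal.ofReal_le_ofReal (le_max_left _ _)
            _ = _ := by ring
        have h3 := ENNReal.toReal_mono (ENNReal.mul_ne_top (by simp) hy0.2.ne) h2
        rwa [ENNReal.toReal_mul, ENNReal.toReal_ofReal (by positivity)] at h3
      have hC1 : (1 : ℝ) ≤ C₁ := le_max_right _ _
      have hlogC : 0 ≤ Real.log C₁ := Real.log_nonneg hC1
      -- The lower deviation of log w is bounded by the A_1 condition and the upper one by log q ≤ q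
      -- - 1; the quotient w / avg has mean one, hence the summand 1 in H.
      have h4 : |b y - c x r| ≤ Real.log C₁ + (w y).toReal / (avg x r).toReal := by
        have hq : 0 < (w y).toReal / (avg x r).toReal := by positivity
        rw [abs_le]
        constructor
        · have := Real.log_le_log hA0 h1
          rw [Real.log_mul (by positivity) hw1.ne'] at this
          simp only [hb, hc]
          linarith
        · have := Real.log_le_sub_one_of_pos hq
          rw [Real.log_div hw1.ne' hA0.ne'] at this
          simp only [hb, hc]
          linarith
      calc ‖b y - c x r‖ₑ = ENNReal.ofReal |b y - c x r| := by
            rw [← ofReal_norm, Real.norm_eq_abs]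
        _ ≤ ENNReal.ofReal (Real.log C₁ + (w y).toReal / (avg x r).toReal) :=
            ENNReal.ofReal_le_ofReal h4
        _ = _ := by
            rw [ENNReal.ofReal_add hlogC (by positivity), ENNReal.ofReal_div_of_pos hA0,
              ENNReal.ofReal_toReal hy0.2.ne, ENNReal.ofReal_toReal (havgt x r hr),
              div_eq_mul_inv, ENNReal.ofReal]
    calc ∫⁻ y in ball x r, ‖b y - c x r‖ₑ
        ≤ ∫⁻ y in ball x r, (Real.toNNReal (Real.log C₁) + w y * (avg x r)⁻¹) :=
          lintegral_mono_ae hpt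
      _ = Real.toNNReal (Real.log C₁) * volume (ball x r) +
            (∫⁻ y in ball x r, w y) * (avg x r)⁻¹ := by
          rw [lintegral_add_left measurable_const, setLIntegral_const,
            lintegral_mul_const _ hw]
      _ = _ := by
          rw [hH]
          push_cast
          rw [add_mul, one_mul]
          congr 1
          rw [havg]
          simp only
          rw [ENNReal.inv_div (Or.inl measure_ball_lt_top.ne)
            (Or.inl (volume_ball_ne_zero x hr))]
          exact ENNReal.mul_div_cancel (setLIntegral_ball_ne_zero hw.aemeasurable
            (hw0.mono fun _ h => h.1) x hr) (hwt x r)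
  refine ⟨min δ ε₀, K, lt_min hδ hε₀, min_le_right _ _, fun x r hr => ?_⟩
  set ε := min δ ε₀ with hε
  have hε0 : 0 < ε := lt_min hδ hε₀
  have hA0 : 0 < (avg x r).toReal := ENNReal.toReal_pos (havg0 x r hr) (havgt x r hr)
  -- Here w^{1+ε} = avg^ε w (w / avg)^ε, and the last factor is at most e^{δ|b - c|} because ε ≤ δ.
  have hpt : ∀ᵐ y ∂(volume.restrict (ball x r)), w y ^ (1 + ε) ≤
      avg x r ^ ε * (w y * ENNReal.ofReal (Real.exp (δ * ‖b y - c x r‖))) := by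
    filter_upwards [ae_restrict_of_ae hw0] with y hy0
    have hw1 : 0 < (w y).toReal := ENNReal.toReal_pos hy0.1.ne' hy0.2.ne
    rw [ENNReal.rpow_add_of_nonneg _ _ zero_le_one hε0.le, ENNReal.rpow_one, mul_left_comm]
    gcongr
    have e1 : w y ^ ε = ENNReal.ofReal (Real.exp (ε * b y)) := by
      conv_lhs => rw [← ENNReal.ofReal_toReal hy0.2.ne]
      rw [ENNReal.ofReal_rpow_of_pos hw1, Real.rpow_def_of_pos hw1, mul_comm]
    have e2 : avg x r ^ ε = ENNReal.ofReal (Real.exp (ε * c x r)) := by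
      conv_lhs => rw [← ENNReal.ofReal_toReal (havgt x r hr)]
      rw [ENNReal.ofReal_rpow_of_pos hA0, Real.rpow_def_of_pos hA0, mul_comm]
    rw [e1, e2, ← ENNReal.ofReal_mul (Real.exp_pos _).le, ← Real.exp_add]
    refine ENNReal.ofReal_le_ofReal (Real.exp_le_exp.2 ?_)
    have h1 : ε * (b y - c x r) ≤ δ * ‖b y - c x r‖ :=
      calc ε * (b y - c x r) ≤ ε * ‖b y - c x r‖ :=
            mul_le_mul_of_nonneg_left (Real.le_norm_self _) hε0.le
        _ ≤ _ := mul_le_mul_of_nonneg_right (min_le_left _ _) (norm_nonneg _)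
    linarith
  refine (lintegral_mono_ae hpt).trans ?_
  rw [lintegral_const_mul' _ _ (ENNReal.rpow_ne_top_of_nonneg hε0.le (havgt x r hr))]
  have h1 := hJN b c hbm hosc x r hr
  rw [withDensity_apply _ measurableSet_ball, restrict_withDensity measurableSet_ball,
    lintegral_withDensity_eq_lintegral_mul _ hw (by fun_prop)] at h1
  calc _ ≤ avg x r ^ ε * (K * ∫⁻ y in ball x r, w y) := by gcongr; exact h1
    _ = _ := by ring

end Weights

/-! ### Rough kernels in polar coordinates. -/

section Kernel

variable {n : ℕ} {𝕜 : Type*} [RCLike 𝕜]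

theorem IsRoughKernel.comp_homeomorphUnitSphereProd {s : ℝ≥0∞}
    {Ω : EuclideanSpace ℝ (Fin n) → 𝕜} (hΩ : IsRoughKernel s Ω)
    (x : ({0}ᶜ : Set (EuclideanSpace ℝ (Fin n)))) :
    Ω (homeomorphUnitSphereProd (EuclideanSpace ℝ (Fin n)) x).1 = Ω x := by
  have hx : (x : EuclideanSpace ℝ (Fin n)) ≠ 0 := x.2
  rw [homeomorphUnitSphereProd_apply_fst_coe]
  exact hΩ.homogeneous _ _ (by positivity) hx

variable [Nontrivial (EuclideanSpace ℝ (Fin n))]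

theorem ae_of_ae_homeomorphUnitSphereProd {Q : EuclideanSpace ℝ (Fin n) → Prop}
    (h : ∀ᵐ x : ({0}ᶜ : Set (EuclideanSpace ℝ (Fin n))) ∂(volume.comap Subtype.val), Q x) :
    ∀ᵐ x, Q x := by
  rw [← restrict_compl_singleton (μ := (volume : Measure (EuclideanSpace ℝ (Fin n)))) 0,
    ← map_comap_subtype_coe (measurableSet_singleton _).compl,
    (MeasurableEmbedding.subtype_coe (measurableSet_singleton _).compl).ae_map_iff]
  exact h

theorem IsRoughKernel.aestronglyMeasurable {s : ℝ≥0∞} {Ω : EuclideanSpace ℝ (Fin n) → 𝕜}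
    (hΩ : IsRoughKernel s Ω) : AEStronglyMeasurable Ω volume := by
  have mp := (volume : Measure (EuclideanSpace ℝ (Fin n))).measurePreserving_homeomorphUnitSphereProd
  rw [← restrict_compl_singleton (μ := (volume : Measure (EuclideanSpace ℝ (Fin n)))) 0,
    ← map_comap_subtype_coe (measurableSet_singleton _).compl,
    (MeasurableEmbedding.subtype_coe (measurableSet_singleton _).compl).aestronglyMeasurable_map_iff]
  have h1 := (hΩ.memLp.1.comp_fst
    (ν := Measure.volumeIoiPow (Module.finrank ℝ (EuclideanSpace ℝ (Fin n)) - 1)))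
  refine (h1.comp_measurePreserving mp).congr (Filter.Eventually.of_forall fun x => ?_)
  exact hΩ.comp_homeomorphUnitSphereProd x

/-- Size of a rough kernel: essentially bounded if `s = ∞`, and otherwise with `s`-th power of
bounded average over the balls centred at the origin. -/
def IsRoughSize (s : ℝ≥0∞) (M : ℝ≥0) (k : EuclideanSpace ℝ (Fin n) → ℝ≥0∞) : Prop :=
  (s = ∞ ∧ ∀ᵐ z, k z ≤ M) ∨
    (s ≠ ∞ ∧ ∀ ρ, 0 < ρ → ∫⁻ z in ball 0 ρ, k z ^ s.toReal ≤
      M * volume (ball (0 : EuclideanSpace ℝ (Fin n)) ρ))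

/-- By homogeneity |Ω|^s does not depend on the radius, so in polar coordinates its integral over
B(0, ρ) is ρ^n / n times the integral over the sphere, a multiple of the volume. For s = ∞ the
essential bound is carried over by the same coordinates. -/
theorem IsRoughKernel.exists_isRoughSize {s : ℝ≥0∞} (hs : s ≠ 0)
    {Ω : EuclideanSpace ℝ (Fin n) → 𝕜} (hΩ : IsRoughKernel s Ω) :
    ∃ M : ℝ≥0, IsRoughSize s M (fun z => ‖Ω z‖ₑ) := by
  have mp := (volume : Measure (EuclideanSpace ℝ (Fin n))).measurePreserving_homeomorphUnitSphereProd
  set e := homeomorphUnitSphereProd (EuclideanSpace ℝ (Fin n)) with he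
  set τ : Measure (Ioi (0 : ℝ)) :=
    Measure.volumeIoiPow (Module.finrank ℝ (EuclideanSpace ℝ (Fin n)) - 1) with hτ
  rcases eq_or_ne s ∞ with rfl | hst
  · have h1 := hΩ.memLp.2
    rw [eLpNorm_exponent_top] at h1
    refine ⟨(eLpNormEssSup (fun x : sphere (0 : EuclideanSpace ℝ (Fin n)) 1 => Ω x)
      (volume : Measure (EuclideanSpace ℝ (Fin n))).toSphere).toNNReal, Or.inl ⟨rfl, ?_⟩⟩
    · refine ae_of_ae_homeomorphUnitSphereProd ?_
      have h2 := ae_le_eLpNormEssSup (f := fun x : sphere (0 : EuclideanSpace ℝ (Fin n)) 1 => Ω x)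
        (μ := (volume : Measure (EuclideanSpace ℝ (Fin n))).toSphere)
      have h3 := mp.quasiMeasurePreserving.ae
        ((Measure.quasiMeasurePreserving_fst (ν := τ)).ae h2)
      filter_upwards [h3] with x hx
      rw [hΩ.comp_homeomorphUnitSphereProd x] at hx
      refine hx.trans (le_of_eq ?_)
      exact (ENNReal.coe_toNNReal h1.ne).symm
  · have hs0 : 0 < s.toReal := ENNReal.toReal_pos hs hst
    set I := ∫⁻ θ : sphere (0 : EuclideanSpace ℝ (Fin n)) 1, ‖Ω θ‖ₑ ^ s.toReal
      ∂(volume : Measure (EuclideanSpace ℝ (Fin n))).toSphere with hI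
    have hIt : I ≠ ∞ := by
      have h1 := hΩ.memLp.2
      rw [eLpNorm_lt_top_iff_lintegral_rpow_enorm_lt_top hs hst] at h1
      exact h1.ne
    set d := Module.finrank ℝ (EuclideanSpace ℝ (Fin n)) with hd
    have hd0 : 0 < d := Module.finrank_pos
    set V := volume (ball (0 : EuclideanSpace ℝ (Fin n)) 1) with hV
    have hV0 : V ≠ 0 := volume_ball_ne_zero _ one_pos
    have hVt : V ≠ ∞ := measure_ball_lt_top.ne
    set M : ℝ≥0∞ := I * ENNReal.ofReal (1 / d) * V⁻¹ with hM
    have hMt : M ≠ ∞ := ENNReal.mul_ne_top (ENNReal.mul_ne_top hIt (by simp))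
      (ENNReal.inv_ne_top.2 hV0)
    refine ⟨M.toNNReal, Or.inr ⟨hst, fun ρ hρ => ?_⟩⟩
    rw [ENNReal.coe_toNNReal hMt]
    have hm : AEMeasurable (fun θ : sphere (0 : EuclideanSpace ℝ (Fin n)) 1 =>
        ‖Ω θ‖ₑ ^ s.toReal) (volume : Measure (EuclideanSpace ℝ (Fin n))).toSphere :=
      hΩ.memLp.1.enorm.pow_const _
    calc ∫⁻ z in ball 0 ρ, ‖Ω z‖ₑ ^ s.toReal
        = ∫⁻ z in ({0}ᶜ : Set (EuclideanSpace ℝ (Fin n))),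
            (ball 0 ρ).indicator (fun z => ‖Ω z‖ₑ ^ s.toReal) z := by
          rw [restrict_compl_singleton, lintegral_indicator measurableSet_ball]
      _ = ∫⁻ z : ({0}ᶜ : Set (EuclideanSpace ℝ (Fin n))),
            (ball (0 : EuclideanSpace ℝ (Fin n)) ρ).indicator (fun z => ‖Ω z‖ₑ ^ s.toReal) z
              ∂(volume.comap Subtype.val) :=
          (lintegral_subtype_comap (measurableSet_singleton _).compl _).symm
      _ = ∫⁻ z : ({0}ᶜ : Set (EuclideanSpace ℝ (Fin n))),
            (fun u : sphere (0 : EuclideanSpace ℝ (Fin n)) 1 × Ioi (0 : ℝ) =>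
              ‖Ω u.1‖ₑ ^ s.toReal * (Iio (⟨ρ, hρ⟩ : Ioi (0 : ℝ))).indicator 1 u.2) (e z)
              ∂(volume.comap Subtype.val) := by
          refine lintegral_congr fun z => ?_
          simp only
          rw [hΩ.comp_homeomorphUnitSphereProd z]
          have hiff : (z : EuclideanSpace ℝ (Fin n)) ∈ ball 0 ρ ↔
              (e z).2 ∈ Iio (⟨ρ, hρ⟩ : Ioi (0 : ℝ)) := by
            rw [mem_ball_zero_iff, mem_Iio, ← Subtype.coe_lt_coe,
              homeomorphUnitSphereProd_apply_snd_coe]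
          by_cases hz : (z : EuclideanSpace ℝ (Fin n)) ∈ ball 0 ρ
          · rw [indicator_of_mem hz, indicator_of_mem (hiff.1 hz)]; simp
          · rw [indicator_of_notMem hz, indicator_of_notMem (mt hiff.2 hz), mul_zero]
      _ = ∫⁻ u, ‖Ω u.1‖ₑ ^ s.toReal * (Iio (⟨ρ, hρ⟩ : Ioi (0 : ℝ))).indicator 1 u.2
              ∂((volume : Measure (EuclideanSpace ℝ (Fin n))).toSphere.prod τ) :=
          mp.lintegral_comp_emb e.measurableEmbedding
            (fun u : sphere (0 : EuclideanSpace ℝ (Fin n)) 1 × Ioi (0 : ℝ) =>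
              ‖Ω u.1‖ₑ ^ s.toReal * (Iio (⟨ρ, hρ⟩ : Ioi (0 : ℝ))).indicator 1 u.2)
      _ = I * τ (Iio ⟨ρ, hρ⟩) := by
          rw [lintegral_prod_mul hm (measurable_one.indicator measurableSet_Iio).aemeasurable,
            lintegral_indicator_one measurableSet_Iio]
      _ = M * volume (ball (0 : EuclideanSpace ℝ (Fin n)) ρ) := by
          have hdn : d = n := by simp [hd]
          rw [hτ, Measure.volumeIoiPow_apply_Iio, Nat.sub_add_cancel hd0, Nat.cast_pred hd0,
            sub_add_cancel, volume_ball_eq 0 hρ, hM]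
          have e1 := ENNReal.inv_mul_cancel hV0 hVt
          calc _ = I * (ENNReal.ofReal (1 / d) * ENNReal.ofReal ρ ^ n) := by
                simp only
                rw [← ENNReal.ofReal_pow hρ.le, ← ENNReal.ofReal_mul (by positivity), hdn]
                congr 2; ring
            _ = I * ENNReal.ofReal (1 / d) * (V⁻¹ * V) * ENNReal.ofReal ρ ^ n := by
                rw [e1]; ring
            _ = _ := by rw [hV]; ring
      _ ≤ _ := le_rfl

end Kernel

/-! ### Hölder's inequality against a rough kernel. -/

section Size

variable {n : ℕ}

theorem IsRoughSize.congr {s : ℝ≥0∞} {M : ℝ≥0} {k k' : EuclideanSpace ℝ (Fin n) → ℝ≥0∞}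
    (h : IsRoughSize s M k) (hk : k =ᵐ[volume] k') : IsRoughSize s M k' := by
  rcases h with ⟨hs, h⟩ | ⟨hs, h⟩
  · refine Or.inl ⟨hs, ?_⟩
    filter_upwards [h, hk] with z hz hz'
    rwa [← hz']
  · refine Or.inr ⟨hs, fun ρ hρ => le_trans (le_of_eq ?_) (h ρ hρ)⟩
    refine lintegral_congr_ae (ae_restrict_of_ae ?_)
    filter_upwards [hk] with z hz
    rw [hz]

theorem measurePreserving_sub_left (x : EuclideanSpace ℝ (Fin n)) :
    MeasurePreserving (fun y : EuclideanSpace ℝ (Fin n) => x - y) volume volume := by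
  simp_rw [sub_eq_add_neg]
  exact (measurePreserving_add_left volume x).comp (Measure.measurePreserving_neg volume)

/-- Hölder's inequality against a power of a rough kernel. -/
theorem IsRoughSize.exists_lintegral_le {s : ℝ≥0∞} {M : ℝ≥0}
    {k : EuclideanSpace ℝ (Fin n) → ℝ≥0∞} (h : IsRoughSize s M k) (hk : Measurable k) {P : ℝ}
    (hP : 1 ≤ P) (hPs : ENNReal.ofReal P < s) :
    ∃ M' : ℝ≥0, ∀ (x : EuclideanSpace ℝ (Fin n)) (ρ : ℝ), 0 < ρ →
      ∀ τ : EuclideanSpace ℝ (Fin n) → EuclideanSpace ℝ (Fin n), MeasurePreserving τ →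
      τ ⁻¹' ball 0 ρ = ball x ρ → ∀ g : EuclideanSpace ℝ (Fin n) → ℝ≥0∞, Measurable g →
        ∫⁻ y in ball x ρ, k (τ y) ^ P * g y ≤
          M' * volume (ball x ρ) ^ (1 - 1 / (s / ENNReal.ofReal P).conjExponent.toReal) *
          (∫⁻ y in ball x ρ, g y ^ (s / ENNReal.ofReal P).conjExponent.toReal) ^
            (1 / (s / ENNReal.ofReal P).conjExponent.toReal) := by
  have hP0 : 0 < P := by linarith
  rcases h with ⟨rfl, h⟩ | ⟨hst, h⟩
  -- For s = ∞ the conjugate exponent is 1, the power of the volume vanishes, and the kernel is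
  -- simply bounded.
  · have hq : ((∞ : ℝ≥0∞) / ENNReal.ofReal P).conjExponent.toReal = 1 := by
      rw [ENNReal.top_div_of_ne_top (by simp)]
      simp [ENNReal.conjExponent]
    rw [hq]
    refine ⟨M ^ P, fun x ρ hρ τ hτ hτb g hg => ?_⟩
    simp only [sub_self, div_one, ENNReal.rpow_zero, ENNReal.rpow_one, mul_one]
    rw [← lintegral_const_mul _ hg]
    refine lintegral_mono_ae (ae_restrict_of_ae ?_)
    filter_upwards [hτ.quasiMeasurePreserving.ae h] with y hy
    gcongr
    rw [ENNReal.coe_rpow_of_nonneg _ hP0.le]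
    exact ENNReal.rpow_le_rpow hy hP0.le
  · set S := s.toReal / P with hS
    have hPS : P < s.toReal := by
      have := (ENNReal.toReal_lt_toReal (by simp) hst).2 hPs
      rwa [ENNReal.toReal_ofReal hP0.le] at this
    have hS1 : 1 < S := by rwa [hS, one_lt_div hP0]
    have hq : (s / ENNReal.ofReal P).conjExponent.toReal = S.conjExponent := by
      have h1 : s / ENNReal.ofReal P = ((Real.toNNReal S : ℝ≥0) : ℝ≥0∞) := by
        rw [← ENNReal.ofReal_toReal hst, ← ENNReal.ofReal_div_of_pos hP0, ENNReal.ofReal]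
      rw [h1, ← ENNReal.coe_conjExponent (by simpa using hS1), ENNReal.coe_toReal,
        NNReal.conjExponent, NNReal.coe_div, NNReal.coe_sub (by simpa using hS1.le),
        Real.coe_toNNReal _ (by linarith), Real.conjExponent]
      simp
    rw [hq]
    have hc : S.HolderConjugate S.conjExponent := Real.HolderConjugate.conjExponent hS1
    refine ⟨M ^ (1 / S), fun x ρ hρ τ hτ hτb g hg => ?_⟩
    have h1 : 1 - 1 / S.conjExponent = 1 / S := by
      have := hc.inv_add_inv_eq_one
      simp only [one_div]; linarith
    rw [h1]
    refine (ENNReal.lintegral_mul_le_Lp_mul_Lq _ hc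
      ((hk.comp hτ.measurable).pow_const _).aemeasurable hg.aemeasurable).trans ?_
    refine mul_le_mul_left ?_ _
    rw [ENNReal.coe_rpow_of_nonneg _ (by positivity), ← ENNReal.mul_rpow_of_nonneg _ _
      (by positivity)]
    refine ENNReal.rpow_le_rpow ?_ (by positivity)
    have h2 : volume (ball x ρ) = volume (ball (0 : EuclideanSpace ℝ (Fin n)) ρ) := by
      rw [volume_ball_eq x hρ, volume_ball_eq 0 hρ]
    rw [h2]
    refine le_trans (le_of_eq ?_) (h ρ hρ)
    rw [← hτ.setLIntegral_comp_preimage measurableSet_ball (hk.pow_const _), hτb]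
    refine lintegral_congr fun y => ?_
    rw [← ENNReal.rpow_mul, hS, mul_div_cancel₀ _ hP0.ne']
    rfl

end Size

/-! ### Conjugate exponents with s possibly infinite. -/

section Exponents

theorem one_le_toReal_conjExponent {u : ℝ≥0∞} (hu : 1 < u) : 1 ≤ u.conjExponent.toReal := by
  have h1 : u.conjExponent ≠ ∞ := by
    rw [ENNReal.conjExponent]
    refine ENNReal.add_ne_top.2 ⟨by simp, ENNReal.inv_ne_top.2 ?_⟩
    exact (tsub_pos_of_lt hu).ne'
  rw [← ENNReal.toReal_one]
  exact ENNReal.toReal_mono h1 le_self_add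

/-- Since 1/s reads as 0 for s = ∞, later exponent identities need no separate case. -/
theorem one_div_toReal_conjExponent {s : ℝ≥0∞} {P : ℝ} (hP : 0 < P)
    (hPs : ENNReal.ofReal P < s) :
    1 / (s / ENNReal.ofReal P).conjExponent.toReal = 1 - P * s⁻¹.toReal := by
  rcases eq_or_ne s ∞ with rfl | hst
  · rw [ENNReal.top_div_of_ne_top (by simp)]
    simp [ENNReal.conjExponent]
  · have hPS : P < s.toReal := by
      have := (ENNReal.toReal_lt_toReal (by simp) hst).2 hPs
      rwa [ENNReal.toReal_ofReal hP.le] at this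
    set S := s.toReal / P with hS
    have hS1 : 1 < S := by rwa [hS, one_lt_div hP]
    have h1 : s / ENNReal.ofReal P = ((Real.toNNReal S : ℝ≥0) : ℝ≥0∞) := by
      rw [← ENNReal.ofReal_toReal hst, ← ENNReal.ofReal_div_of_pos hP, ENNReal.ofReal]
    rw [h1, ← ENNReal.coe_conjExponent (by simpa using hS1), ENNReal.coe_toReal,
      NNReal.conjExponent, NNReal.coe_div, NNReal.coe_sub (by simpa using hS1.le),
      Real.coe_toNNReal _ (by linarith), ENNReal.toReal_inv, hS]
    have : s.toReal ≠ 0 := by linarith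
    push_cast
    field_simp

end Exponents

/-! ### The local commutator estimate for s' < p. -/

section Local

variable {n : ℕ} {𝕜 : Type*} [RCLike 𝕜]

/-- `∫_{B(x₀, t)} |b(x) - b(y)| k(x - y) F(y) dy`. -/
def commAvg (b : EuclideanSpace ℝ (Fin n) → 𝕜) (k F : EuclideanSpace ℝ (Fin n) → ℝ≥0∞)
    (x₀ : EuclideanSpace ℝ (Fin n)) (t : ℝ) (x : EuclideanSpace ℝ (Fin n)) : ℝ≥0∞ :=
  ∫⁻ y in ball x₀ t, ‖b x - b y‖ₑ * k (x - y) * F y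

/-- The localized commutator estimate: for `b` of mean oscillation at most `1`, the `L_p(w)` norm of
`commAvg` on `B(x₀, r)` is controlled by `(1 + ln (t / r)) |B(x₀, t)| U(x₀, r) / U(x₀, t)` times
the `L_p(w)` norm of `F` on `B(x₀, t)`. -/
def LocalCommutatorBound (𝕜 : Type*) [RCLike 𝕜] (p : ℝ) (w k : EuclideanSpace ℝ (Fin n) → ℝ≥0∞)
    (U : EuclideanSpace ℝ (Fin n) → ℝ → ℝ≥0∞) (K : ℝ≥0) : Prop :=
  ∀ (b : EuclideanSpace ℝ (Fin n) → 𝕜) (c : EuclideanSpace ℝ (Fin n) → ℝ → 𝕜),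
    Measurable b → HasMeanOscillationLE 1 b c →
    ∀ F : EuclideanSpace ℝ (Fin n) → ℝ≥0∞, Measurable F →
    ∀ (x₀ : EuclideanSpace ℝ (Fin n)) (r t : ℝ), 0 < r → r ≤ t →
      (∫⁻ x in ball x₀ r, commAvg b k F x₀ t x ^ p * w x) ^ (1 / p) ≤
        K * ENNReal.ofReal (1 + Real.log (t / r)) * volume (ball x₀ t) * U x₀ r *
          ((∫⁻ y in ball x₀ t, F y ^ p * w y) ^ (1 / p) / U x₀ t)

/-- Hölder's inequality against a power of a rough kernel, localized to a subset of a ball. -/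
theorem IsRoughSize.exists_setLIntegral_le {s : ℝ≥0∞} {M : ℝ≥0}
    {k : EuclideanSpace ℝ (Fin n) → ℝ≥0∞} (h : IsRoughSize s M k) (hk : Measurable k) {P : ℝ}
    (hP : 1 ≤ P) (hPs : ENNReal.ofReal P < s) {q : ℝ}
    (hq : q = (s / ENNReal.ofReal P).conjExponent.toReal) :
    ∃ M' : ℝ≥0, ∀ (x₀ z : EuclideanSpace ℝ (Fin n)) (t : ℝ), z ∈ ball x₀ t →
      ∀ (D : Set (EuclideanSpace ℝ (Fin n))), MeasurableSet D → D ⊆ ball x₀ t →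
      ∀ g : EuclideanSpace ℝ (Fin n) → ℝ≥0∞, Measurable g →
        (∫⁻ y in D, k (z - y) ^ P * g y ≤
          M' * volume (ball x₀ t) ^ (1 - 1 / q) * (∫⁻ y in D, g y ^ q) ^ (1 / q)) ∧
        (∫⁻ y in D, k (y - z) ^ P * g y ≤
          M' * volume (ball x₀ t) ^ (1 - 1 / q) * (∫⁻ y in D, g y ^ q) ^ (1 / q)) := by
  obtain ⟨M', hM'⟩ := h.exists_lintegral_le hk hP hPs
  rw [← hq] at hM'
  have hq1 : 1 ≤ q := by
    rw [hq]
    refine one_le_toReal_conjExponent ?_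
    rw [ENNReal.lt_div_iff_mul_lt (Or.inl (by simp; linarith)) (Or.inl (by simp)), one_mul]
    exact hPs
  have hq0 : 0 < q := by linarith
  have hq2 : 0 ≤ 1 - 1 / q := by
    have : 1 / q ≤ 1 := by rw [div_le_one hq0]; exact hq1
    linarith
  refine ⟨M' * (2 ^ n) ^ (1 - 1 / q), fun x₀ z t hz D hD hDt g hg => ?_⟩
  have ht : 0 < t := dist_nonneg.trans_lt hz
  -- The kernel is controlled on balls about its own singularity z; recentring from x₀ doubles the
  -- radius and costs the power of 2^n in the constant.
  have hDz : D ⊆ ball z (2 * t) := by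
    intro y hy
    have h1 : dist y x₀ < t := hDt hy
    have h2 : dist z x₀ < t := hz
    have := dist_triangle_right y z x₀
    rw [mem_ball]; linarith
  have main : ∀ τ : EuclideanSpace ℝ (Fin n) → EuclideanSpace ℝ (Fin n), MeasurePreserving τ →
      τ ⁻¹' ball 0 (2 * t) = ball z (2 * t) →
      ∫⁻ y in D, k (τ y) ^ P * g y ≤ (M' * (2 ^ n) ^ (1 - 1 / q) : ℝ≥0) *
        volume (ball x₀ t) ^ (1 - 1 / q) * (∫⁻ y in D, g y ^ q) ^ (1 / q) := by
    intro τ hτ hτb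
    have h1 := hM' z (2 * t) (by positivity) τ hτ hτb (D.indicator g) (hg.indicator hD)
    have e1 : ∫⁻ y in ball z (2 * t), k (τ y) ^ P * D.indicator g y
        = ∫⁻ y in D, k (τ y) ^ P * g y := by
      have : ∀ y, k (τ y) ^ P * D.indicator g y = D.indicator (fun y => k (τ y) ^ P * g y) y := by
        intro y
        by_cases hy : y ∈ D <;> simp [hy]
      simp_rw [this]
      rw [lintegral_indicator hD, Measure.restrict_restrict hD, inter_eq_left.2 hDz]
    have e2 : ∫⁻ y in ball z (2 * t), D.indicator g y ^ q = ∫⁻ y in D, g y ^ q := by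
      have : ∀ y, D.indicator g y ^ q = D.indicator (fun y => g y ^ q) y := by
        intro y
        by_cases hy : y ∈ D <;> simp [hy, hq0]
      simp_rw [this]
      rw [lintegral_indicator hD, Measure.restrict_restrict hD, inter_eq_left.2 hDz]
    rw [e1, e2, volume_ball_ratio z x₀ ht (by positivity : 0 < 2 * t),
      mul_div_cancel_right₀ _ ht.ne', ENNReal.mul_rpow_of_nonneg _ _ hq2] at h1
    refine h1.trans (le_of_eq ?_)
    rw [ENNReal.coe_mul, ENNReal.coe_rpow_of_nonneg _ hq2]
    push_cast
    rw [show ENNReal.ofReal 2 = 2 by simp]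
    ring
  refine ⟨main (fun y => z - y) (measurePreserving_sub_left z) ?_,
    main (fun y => y - z) (measurePreserving_sub_right volume z) ?_⟩
  · ext y; simp [dist_eq_norm, norm_sub_rev]
  · ext y; simp [dist_eq_norm]

theorem one_le_ofReal_one_add_log {r t : ℝ} (hr : 0 < r) (hrt : r ≤ t) :
    (1 : ℝ≥0∞) ≤ ENNReal.ofReal (1 + Real.log (t / r)) := by
  rw [← ENNReal.ofReal_one]
  refine ENNReal.ofReal_le_ofReal ?_
  have : 0 ≤ Real.log (t / r) := Real.log_nonneg (by rwa [le_div_iff₀ hr, one_mul])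
  linarith

/-- Inserting a constant decouples x from y in the oscillation; it is used with d = c x₀ r. -/
theorem commAvg_le {b : EuclideanSpace ℝ (Fin n) → 𝕜} {k F : EuclideanSpace ℝ (Fin n) → ℝ≥0∞}
    (d : 𝕜) (x₀ : EuclideanSpace ℝ (Fin n)) (t : ℝ) (x : EuclideanSpace ℝ (Fin n)) :
    commAvg b k F x₀ t x ≤
      ∫⁻ y in ball x₀ t, k (x - y) * ((‖b x - d‖ₑ + ‖b y - d‖ₑ) * F y) := by
  refine lintegral_mono fun y => ?_
  have h : b x - b y = (b x - d) - (b y - d) := by abel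
  calc ‖b x - b y‖ₑ * k (x - y) * F y ≤ (‖b x - d‖ₑ + ‖b y - d‖ₑ) * k (x - y) * F y := by
        gcongr; rw [h]; exact enorm_sub_le
    _ = _ := by ring

theorem measurable_commAvg {b : EuclideanSpace ℝ (Fin n) → 𝕜}
    {k F : EuclideanSpace ℝ (Fin n) → ℝ≥0∞} (hb : Measurable b) (hk : Measurable k)
    (hF : Measurable F) (x₀ : EuclideanSpace ℝ (Fin n)) (t : ℝ) :
    Measurable (commAvg b k F x₀ t) := by
  unfold commAvg
  refine Measurable.lintegral_prod_right ?_
  fun_prop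

theorem setLIntegral_mul_withDensity {w f : EuclideanSpace ℝ (Fin n) → ℝ≥0∞} (hw : Measurable w)
    (hf : Measurable f) {D : Set (EuclideanSpace ℝ (Fin n))} (hD : MeasurableSet D) :
    ∫⁻ y in D, f y ∂(volume.withDensity w) = ∫⁻ y in D, f y * w y := by
  rw [restrict_withDensity hD, lintegral_withDensity_eq_lintegral_mul _ hw hf]
  simp_rw [Pi.mul_apply, mul_comm]

theorem rpow_setLIntegral_le_mul {p : ℝ} (hp : 0 < p)
    {f h w : EuclideanSpace ℝ (Fin n) → ℝ≥0∞} (hh : Measurable h) (hw : Measurable w)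
    {D : Set (EuclideanSpace ℝ (Fin n))} (hD : MeasurableSet D) {G : ℝ≥0∞}
    (hf : ∀ x ∈ D, f x ≤ G * h x) :
    (∫⁻ x in D, f x ^ p * w x) ^ (1 / p) ≤ G * (∫⁻ x in D, h x ^ p * w x) ^ (1 / p) := by
  calc (∫⁻ x in D, f x ^ p * w x) ^ (1 / p)
      ≤ (∫⁻ x in D, G ^ p * (h x ^ p * w x)) ^ (1 / p) := by
        refine ENNReal.rpow_le_rpow (setLIntegral_mono' hD fun x hx => ?_) (by positivity)
        rw [← mul_assoc, ← ENNReal.mul_rpow_of_nonneg _ _ hp.le]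
        exact mul_le_mul_left (ENNReal.rpow_le_rpow (hf x hx) hp.le) _
    _ = _ := by
        rw [lintegral_const_mul (G ^ p) (f := fun x => h x ^ p * w x) (by fun_prop),
          ENNReal.mul_rpow_of_nonneg _ _ (by positivity), ← ENNReal.rpow_mul,
          mul_one_div_cancel hp.ne', ENNReal.rpow_one]

/-- The localized commutator estimate when `w` is an `A_{p / s'}` weight and `s' < p`. -/
theorem localCommutatorBound_of_lt (𝕜 : Type*) [RCLike 𝕜] {p : ℝ} {s : ℝ≥0∞} {M C : ℝ≥0}
    (hs : 1 < s) {w σ k : EuclideanSpace ℝ (Fin n) → ℝ≥0∞} (hp : 1 < p) (hk : Measurable k)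
    (hks : IsRoughSize s M k) (hw : Measurable w) (hσ : Measurable σ) {a : ℝ} (ha : 1 < a)
    (hap : s.conjExponent.toReal * a = p)
    (hdual : ∀ᵐ y, w y ^ (1 / a) * σ y ^ (1 / a.conjExponent) = 1)
    (hw0 : ∀ x r, 0 < r → ∫⁻ y in ball x r, w y ≠ 0) (hwt : ∀ x r, ∫⁻ y in ball x r, w y ≠ ∞)
    (hwσ : ∀ x r, 0 < r → (∫⁻ y in ball x r, w y) * (∫⁻ y in ball x r, σ y) ^ (a - 1) ≤
      C * volume (ball x r) ^ a)
    {a₁ a₂ : ℝ} (ha₁ : 0 ≤ a₁) (ha₂ : 0 ≤ a₂) {C₁ C₂ : ℝ≥0} (hC₁ : 0 < C₁) (hC₂ : 0 < C₂)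
    (hwA : IsAInfty a₁ C₁ (volume.withDensity w)) (hσA : IsAInfty a₂ C₂ (volume.withDensity σ)) :
    ∃ K : ℝ≥0, LocalCommutatorBound 𝕜 p w k (fun x r => wBall w x r ^ (1 / p)) K := by
  set q := s.conjExponent.toReal with hq
  have hq1 : 1 ≤ q := one_le_toReal_conjExponent hs
  have hq0 : 0 < q := by linarith
  have hp0 : 0 < p := by linarith
  have ha0 : 0 < a := by linarith
  have hc : a.HolderConjugate a.conjExponent := Real.HolderConjugate.conjExponent ha
  set m := q * a.conjExponent with hm
  have hm1 : 1 ≤ m := one_le_mul_of_one_le_of_one_le hq1 hc.symm.lt.le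
  have hm0 : 0 < m := by linarith
  obtain ⟨M', hM'⟩ := hks.exists_setLIntegral_le hk le_rfl (by simpa using hs) (q := q)
    (by rw [hq]; simp)
  obtain ⟨K₁, hK₁⟩ := hσA.exists_moment_le 𝕜 ha₂ hC₂ 1 hm1
  obtain ⟨K₂, hK₂⟩ := hwA.exists_moment_le 𝕜 ha₁ hC₁ 1 hp.le
  refine ⟨M' * K₁ * C ^ (1 / p) * (2 * K₂), fun b c hb hbc F hF x₀ r t hr hrt => ?_⟩
  have ht : 0 < t := hr.trans_le hrt
  set L := ENNReal.ofReal (1 + Real.log (t / r)) with hL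
  have hL1 : 1 ≤ L := one_le_ofReal_one_add_log hr hrt
  set V := volume (ball x₀ t) with hV
  have hV0 : V ≠ 0 := volume_ball_ne_zero x₀ ht
  have hVt : V ≠ ∞ := measure_ball_lt_top.ne
  set W := ∫⁻ y in ball x₀ t, w y with hW
  have hW0 : W ≠ 0 := hw0 x₀ t ht
  have hWt : W ≠ ∞ := hwt x₀ t
  set Φ := (∫⁻ y in ball x₀ t, F y ^ p * w y) ^ (1 / p) with hΦ
  set α : EuclideanSpace ℝ (Fin n) → ℝ≥0∞ := fun x => ‖b x - c x₀ r‖ₑ with hα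
  have hαm : Measurable α := (hb.sub_const _).enorm
  -- The A_a condition raised to the power 1/p; this is the origin of the gauge U x₀ t in the
  -- denominator.
  have hσt : (∫⁻ y in ball x₀ t, σ y) ^ (1 / m) ≤ (C : ℝ≥0∞) ^ (1 / p) * V ^ (1 / q) / W ^ (1 / p) := by
    have h1 : (∫⁻ y in ball x₀ t, σ y) ^ (a - 1) ≤ C * V ^ a / W := by
      rw [ENNReal.le_div_iff_mul_le (Or.inl hW0) (Or.inl hWt), mul_comm]
      exact hwσ x₀ t ht
    have e1 : (a - 1) * (1 / p) = 1 / m := by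
      rw [hm, Real.conjExponent, ← hap]
      field_simp [show a - 1 ≠ 0 by linarith]
    have e2 : a * (1 / p) = 1 / q := by
      rw [← hap]; field_simp
    have h2 := ENNReal.rpow_le_rpow h1 (show 0 ≤ 1 / p by positivity)
    rwa [← ENNReal.rpow_mul, e1, ENNReal.div_rpow_of_nonneg _ _ (by positivity),
      ENNReal.mul_rpow_of_nonneg _ _ (by positivity), ← ENNReal.rpow_mul, e2] at h2
  set G := M' * V ^ (1 - 1 / q) * (Φ * (K₁ * ((C : ℝ≥0∞) ^ (1 / p) * V ^ (1 / q) / W ^ (1 / p))))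
    with hG
  have hpt : ∀ x ∈ ball x₀ r, commAvg b k F x₀ t x ≤ G * (L + α x) := by
    intro x hx
    have hxt : x ∈ ball x₀ t := ball_subset_ball hrt hx
    set g : EuclideanSpace ℝ (Fin n) → ℝ≥0∞ := fun y => (α x + α y) * F y with hg
    have hgm : Measurable g := (hαm.const_add _).mul hF
    have h1 := (hM' x₀ x t hxt (ball x₀ t) measurableSet_ball subset_rfl g hgm).1
    simp only [ENNReal.rpow_one] at h1
    refine (commAvg_le (c x₀ r) x₀ t x).trans (h1.trans ?_)
    -- Hölder with exponents a and a' after inserting w^{1/a} σ^{1/a'} = 1; the identity q a = p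
    -- restores the L_p(w) norm of F.
    have h2 : ∫⁻ y in ball x₀ t, g y ^ q ≤ (∫⁻ y in ball x₀ t, F y ^ p * w y) ^ (1 / a) *
        (∫⁻ y in ball x₀ t, (α x + α y) ^ m * σ y) ^ (1 / a.conjExponent) := by
      calc ∫⁻ y in ball x₀ t, g y ^ q
          = ∫⁻ y in ball x₀ t, (F y ^ q * w y ^ (1 / a)) *
              ((α x + α y) ^ q * σ y ^ (1 / a.conjExponent)) := by
            refine lintegral_congr_ae (ae_restrict_of_ae ?_)
            filter_upwards [hdual] with y hy
            calc g y ^ q = (α x + α y) ^ q * F y ^ q * 1 := by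
                  rw [hg, ENNReal.mul_rpow_of_nonneg _ _ hq0.le, mul_one]
              _ = _ := by rw [← hy]; ring
        _ ≤ _ := ENNReal.lintegral_mul_le_Lp_mul_Lq _ hc
            ((hF.pow_const _).mul (hw.pow_const _)).aemeasurable
            (((hαm.const_add _).pow_const _).mul (hσ.pow_const _)).aemeasurable
        _ = _ := by
            have e1 := one_div_mul_cancel ha0.ne'
            have e2 := one_div_mul_cancel hc.symm.pos.ne'
            congr 2
            · congr 1
              funext y
              rw [ENNReal.mul_rpow_of_nonneg _ _ ha0.le, ← ENNReal.rpow_mul, ← ENNReal.rpow_mul,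
                e1, hap, ENNReal.rpow_one]
            · congr 1
              funext y
              rw [ENNReal.mul_rpow_of_nonneg _ _ hc.symm.pos.le, ← ENNReal.rpow_mul,
                ← ENNReal.rpow_mul, e2, ENNReal.rpow_one]
    have h3 : (∫⁻ y in ball x₀ t, g y ^ q) ^ (1 / q) ≤
        Φ * (∫⁻ y in ball x₀ t, (α x + α y) ^ m * σ y) ^ (1 / m) := by
      refine (ENNReal.rpow_le_rpow h2 (show 0 ≤ 1 / q by positivity)).trans (le_of_eq ?_)
      rw [ENNReal.mul_rpow_of_nonneg _ _ (by positivity), ← ENNReal.rpow_mul, ← ENNReal.rpow_mul,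
        hΦ, hm, ← hap]
      congr 2 <;> rw [one_div_mul_one_div, mul_comm]
    -- The free constant of the moment bound is α x, so x and y are treated together; the x
    -- dependence left is L + α x.
    have h4 := hK₁ b c hb hbc x₀ r t hr hrt (α x)
    rw [withDensity_apply _ measurableSet_ball, setLIntegral_mul_withDensity hσ
      ((hαm.const_add _).pow_const _) measurableSet_ball] at h4
    calc _ ≤ M' * V ^ (1 - 1 / q) * (Φ * (K₁ * (α x + L) *
          ((C : ℝ≥0∞) ^ (1 / p) * V ^ (1 / q) / W ^ (1 / p)))) := by
          refine mul_le_mul_right (h3.trans (mul_le_mul_right (h4.trans ?_) _)) _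
          exact mul_le_mul_right hσt _
      _ = _ := by rw [hG]; ring
  have hK2 := hK₂ b c hb hbc x₀ r r hr le_rfl L
  rw [withDensity_apply _ measurableSet_ball, setLIntegral_mul_withDensity hw
      ((hαm.const_add _).pow_const _) measurableSet_ball, div_self hr.ne', Real.log_one, add_zero,
      ENNReal.ofReal_one] at hK2
  calc (∫⁻ x in ball x₀ r, commAvg b k F x₀ t x ^ p * w x) ^ (1 / p)
      ≤ G * (∫⁻ x in ball x₀ r, (L + α x) ^ p * w x) ^ (1 / p) :=
        rpow_setLIntegral_le_mul hp0 (hαm.const_add _) hw measurableSet_ball hpt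
    _ ≤ G * (K₂ * (L + 1) * (∫⁻ y in ball x₀ r, w y) ^ (1 / p)) := by gcongr
    _ ≤ G * (K₂ * (L + L) * (∫⁻ y in ball x₀ r, w y) ^ (1 / p)) := by gcongr
    _ = _ := by
        have hVV : V ^ (1 - 1 / q) * V ^ (1 / q) = V := by
          rw [← ENNReal.rpow_add _ _ hV0 hVt, sub_add_cancel, ENNReal.rpow_one]
        simp only [wBall]
        rw [hG, ← hW]
        push_cast
        rw [ENNReal.coe_rpow_of_nonneg _ (by positivity : (0 : ℝ) ≤ 1 / p)]
        simp only [div_eq_mul_inv, one_mul] at hVV ⊢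
        conv_rhs => rw [← hVV]
        ring

end Local

/-! ### The endpoint s' = p with an A_1 weight. -/

section Endpoint

variable {n : ℕ}

/-- The trilinear Hölder inequality behind Young's inequality with an additional factor. -/
theorem lintegral_mul_mul_le_young {X : Type*} [MeasurableSpace X] {μ : Measure X} {S p Q : ℝ}
    (hS : 0 < S) (hp : 0 < p) (hSp : 1 / S + 1 / p = 1) (hQS : S ≤ Q) (hQp : p ≤ Q)
    {f g h : X → ℝ≥0∞} (hf : Measurable f) (hg : Measurable g) (hh : Measurable h) :
    ∫⁻ y, f y * (h y * g y) ∂μ ≤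
      (∫⁻ y, f y ^ S * g y ^ p ∂μ) ^ (1 / Q) * (∫⁻ y, f y ^ S ∂μ) ^ (1 / S - 1 / Q) *
        (∫⁻ y, g y ^ p ∂μ) ^ (1 / p - 1 / Q) * (∫⁻ y, h y ^ Q ∂μ) ^ (1 / Q) := by
  have hQ : 0 < Q := hS.trans_le hQS
  have h1 : 0 ≤ 1 / S - 1 / Q := sub_nonneg.2 (one_div_le_one_div_of_le hS hQS)
  have h2 : 0 ≤ 1 / p - 1 / Q := sub_nonneg.2 (one_div_le_one_div_of_le hp hQp)
  have h3 : 0 ≤ 1 / Q := by positivity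
  -- Hölder with four factors, whose exponents add up to 1/S + 1/p = 1.
  have := ENNReal.lintegral_prod_norm_pow_le (μ := μ) (Finset.univ : Finset (Fin 4))
    (f := ![fun y => f y ^ S * g y ^ p, fun y => f y ^ S, fun y => g y ^ p, fun y => h y ^ Q])
    (p := ![1 / Q, 1 / S - 1 / Q, 1 / p - 1 / Q, 1 / Q])
    (by
      intro i _
      fin_cases i
      · exact ((hf.pow_const _).mul (hg.pow_const _)).aemeasurable
      · exact (hf.pow_const _).aemeasurable
      · exact (hg.pow_const _).aemeasurable
      · exact (hh.pow_const _).aemeasurable)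
    (by simp [Fin.sum_univ_four]; simp at hSp; linarith)
    (by
      intro i _
      fin_cases i
      · exact h3
      · exact h1
      · exact h2
      · exact h3)
  simp only [Fin.prod_univ_four, Matrix.cons_val_zero, Matrix.cons_val_one, Matrix.cons_val] at this
  refine le_trans (le_of_eq ?_) this
  refine lintegral_congr fun y => ?_
  rw [ENNReal.mul_rpow_of_nonneg _ _ h3, ← ENNReal.rpow_mul, ← ENNReal.rpow_mul,
    ← ENNReal.rpow_mul, ← ENNReal.rpow_mul, ← ENNReal.rpow_mul, mul_one_div_cancel hQ.ne',
    ENNReal.rpow_one]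
  have e1 : f y ^ (S * (1 / Q)) * f y ^ (S * (1 / S - 1 / Q)) = f y := by
    rw [← ENNReal.rpow_add_of_nonneg _ _ (by positivity) (by positivity)]
    rw [show S * (1 / Q) + S * (1 / S - 1 / Q) = 1 by field_simp; ring, ENNReal.rpow_one]
  have e2 : g y ^ (p * (1 / Q)) * g y ^ (p * (1 / p - 1 / Q)) = g y := by
    rw [← ENNReal.rpow_add_of_nonneg _ _ (by positivity) (by positivity)]
    rw [show p * (1 / Q) + p * (1 / p - 1 / Q) = 1 by field_simp; ring, ENNReal.rpow_one]
  calc f y * (h y * g y) = (f y ^ (S * (1 / Q)) * f y ^ (S * (1 / S - 1 / Q))) *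
        (h y * (g y ^ (p * (1 / Q)) * g y ^ (p * (1 / p - 1 / Q)))) := by rw [e1, e2]
    _ = _ := by ring

theorem IsRoughSize.setLIntegral_rpow_le {s : ℝ≥0∞} {M : ℝ≥0}
    {k : EuclideanSpace ℝ (Fin n) → ℝ≥0∞} (h : IsRoughSize s M k) (hk : Measurable k)
    (hs : s ≠ ∞) {x₀ z : EuclideanSpace ℝ (Fin n)} {t : ℝ} (hz : z ∈ ball x₀ t)
    {D : Set (EuclideanSpace ℝ (Fin n))} (hDt : D ⊆ ball x₀ t) :
    (∫⁻ y in D, k (z - y) ^ s.toReal ≤ (M * 2 ^ n : ℝ≥0) * volume (ball x₀ t)) ∧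
    (∫⁻ y in D, k (y - z) ^ s.toReal ≤ (M * 2 ^ n : ℝ≥0) * volume (ball x₀ t)) := by
  replace h : ∀ ρ, 0 < ρ → ∫⁻ z in ball 0 ρ, k z ^ s.toReal ≤
      M * volume (ball (0 : EuclideanSpace ℝ (Fin n)) ρ) := by
    rcases h with ⟨rfl, -⟩ | ⟨-, h⟩
    · exact absurd rfl hs
    · exact h
  have ht : 0 < t := dist_nonneg.trans_lt hz
  have hDz : D ⊆ ball z (2 * t) := by
    intro y hy
    have h1 : dist y x₀ < t := hDt hy
    have h2 : dist z x₀ < t := hz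
    have := dist_triangle_right y z x₀
    rw [mem_ball]; linarith
  have main : ∀ τ : EuclideanSpace ℝ (Fin n) → EuclideanSpace ℝ (Fin n), MeasurePreserving τ →
      τ ⁻¹' ball 0 (2 * t) = ball z (2 * t) →
      ∫⁻ y in D, k (τ y) ^ s.toReal ≤ (M * 2 ^ n : ℝ≥0) * volume (ball x₀ t) := by
    intro τ hτ hτb
    calc ∫⁻ y in D, k (τ y) ^ s.toReal ≤ ∫⁻ y in ball z (2 * t), k (τ y) ^ s.toReal :=
          lintegral_mono_set hDz
      _ = ∫⁻ y in ball 0 (2 * t), k y ^ s.toReal := by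
          rw [← hτ.setLIntegral_comp_preimage measurableSet_ball (hk.pow_const _), hτb]
      _ ≤ M * volume (ball (0 : EuclideanSpace ℝ (Fin n)) (2 * t)) := h _ (by positivity)
      _ = _ := by
          rw [volume_ball_ratio 0 x₀ ht (by positivity : 0 < 2 * t),
            mul_div_cancel_right₀ _ ht.ne']
          push_cast
          rw [show ENNReal.ofReal 2 = 2 by simp]
          ring
  refine ⟨main (fun y => z - y) (measurePreserving_sub_left z) ?_,
    main (fun y => y - z) (measurePreserving_sub_right volume z) ?_⟩
  · ext y; simp [dist_eq_norm, norm_sub_rev]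
  · ext y; simp [dist_eq_norm]

/-- Integrating the A_1 lower bound for w over F gives the inequality with exponent 1. The constant
is C + 1 so that it is positive. -/
theorem isAInfty_of_A1 {w : EuclideanSpace ℝ (Fin n) → ℝ≥0∞} (hw : Measurable w)
    (hwt : ∀ x r, ∫⁻ y in ball x r, w y ≠ ∞) {C : ℝ≥0}
    (hC : ∀ x r, 0 < r → ∀ᵐ y ∂(volume.restrict (ball x r)),
      ∫⁻ y in ball x r, w y ≤ C * volume (ball x r) * w y) :
    IsAInfty 1 (C + 1) (volume.withDensity w) where
  absolutelyContinuous := withDensity_absolutelyContinuous _ _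
  measure_ball_ne_top x r := by
    rw [withDensity_apply _ measurableSet_ball]; exact hwt x r
  le x r hr F hF hFm := by
    rw [withDensity_apply _ measurableSet_ball, withDensity_apply _ hFm, ENNReal.rpow_one,
      ENNReal.rpow_one]
    calc (∫⁻ y in ball x r, w y) * volume F = ∫⁻ _z in F, (∫⁻ y in ball x r, w y) := by
          rw [setLIntegral_const]
      _ ≤ ∫⁻ z in F, C * volume (ball x r) * w z :=
          lintegral_mono_ae (ae_mono (Measure.restrict_mono hF le_rfl) (hC x r hr))
      _ = C * (∫⁻ z in F, w z) * volume (ball x r) := by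
          rw [lintegral_const_mul _ hw]; ring
      _ ≤ _ := by gcongr; exact le_self_add

/-- The weighted estimate of a rough convolution with a function `γ F` on `B(x₀, t)`, where the
`Q`-th moment of `γ` has the size of the smaller ball `B(x₀, r)`. -/
theorem exists_young_tail_le {p : ℝ} (hp : 1 < p) {s : ℝ≥0∞} (hst : s ≠ ∞)
    (hsp : 1 / s.toReal + 1 / p = 1) {M C : ℝ≥0} {w k : EuclideanSpace ℝ (Fin n) → ℝ≥0∞}
    (hk : Measurable k) (hks : IsRoughSize s M k) (hw : Measurable w)
    (hw0 : ∀ᵐ y, 0 < w y ∧ w y < ∞) (hwt : ∀ x r, ∫⁻ y in ball x r, w y ≠ ∞)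
    (hC : ∀ x r, 0 < r → ∀ᵐ y ∂(volume.restrict (ball x r)),
      ∫⁻ y in ball x r, w y ≤ C * volume (ball x r) * w y) :
    ∃ Q : ℝ, 0 < Q ∧ ∀ K₀ : ℝ≥0, ∃ K : ℝ≥0, ∀ F γ : EuclideanSpace ℝ (Fin n) → ℝ≥0∞,
      Measurable F → Measurable γ → ∀ (x₀ : EuclideanSpace ℝ (Fin n)) (r t : ℝ), 0 < r → r ≤ t →
      ∫⁻ y in ball x₀ t, γ y ^ Q ≤ K₀ * volume (ball x₀ r) →
      (∫⁻ x in ball x₀ r, (∫⁻ y in ball x₀ t, k (x - y) * (γ y * F y)) ^ p * w x) ^ (1 / p) ≤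
        K * volume (ball x₀ t) ^ (1 - 1 / p) * (∫⁻ y in ball x₀ t, F y ^ p) ^ (1 / p) *
          (∫⁻ x in ball x₀ r, w x) ^ (1 / p) := by
  have hp0 : 0 < p := by linarith
  set S := s.toReal with hS
  have hS0 : 0 < S := by
    rcases ENNReal.toReal_nonneg.eq_or_lt with h | h
    · exfalso
      rw [hS, ← h, div_zero, zero_add, div_eq_one_iff_eq hp0.ne'] at hsp
      linarith
    · exact h
  obtain ⟨ε, Kr, hε, hεS, hRH⟩ := exists_reverse_holder hw hw0 hwt hC (ε₀ := p / S) (by positivity)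
    (isAInfty_of_A1 hw hwt hC)
  -- With this Q, the power p/Q is inverse to the Hölder exponent (1 + ε)/ε conjugate to the gain 1
  -- + ε for w, so h ends up with exponent one and Fubini applies. The bound ε ≤ p/S ensures S ≤ Q.
  set Q := p * (1 + ε) / ε with hQ
  have hQ0 : 0 < Q := by positivity
  have hQp : p ≤ Q := by rw [hQ, le_div_iff₀ hε]; nlinarith
  have hQS : S ≤ Q := by
    rw [hQ, le_div_iff₀ hε]
    rw [le_div_iff₀ hS0] at hεS
    nlinarith
  set e := 1 / Q with he
  have he0 : 0 < e := by positivity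
  have he2 : 0 ≤ 1 / S - e := sub_nonneg.2 (one_div_le_one_div_of_le hS0 hQS)
  have he3 : 0 ≤ 1 / p - e := sub_nonneg.2 (one_div_le_one_div_of_le hp0 hQp)
  refine ⟨Q, hQ0, fun K₀ => ⟨(M * 2 ^ n) ^ (1 / S) * K₀ ^ e * Kr ^ (1 / p - e),
    fun F γ hF hγ x₀ r t hr hrt hγQ => ?_⟩⟩
  have ht : 0 < t := hr.trans_le hrt
  set V := volume (ball x₀ t) with hV
  have hV0 : V ≠ 0 := volume_ball_ne_zero x₀ ht
  have hVt : V ≠ ∞ := measure_ball_lt_top.ne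
  set v := volume (ball x₀ r) with hv
  have hv0 : v ≠ 0 := volume_ball_ne_zero x₀ hr
  have hvt : v ≠ ∞ := measure_ball_lt_top.ne
  set Ψ := ∫⁻ y in ball x₀ t, F y ^ p with hΨ
  set m := ∫⁻ x in ball x₀ r, w x with hm
  set N : ℝ≥0∞ := ((M * 2 ^ n : ℝ≥0) : ℝ≥0∞) with hN
  have hm0 : m ≠ 0 := setLIntegral_ball_ne_zero hw.aemeasurable (hw0.mono fun _ h => h.1) x₀ hr
  have hmt : m ≠ ∞ := hwt x₀ r
  set h : EuclideanSpace ℝ (Fin n) → ℝ≥0∞ :=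
    fun x => ∫⁻ y in ball x₀ t, k (x - y) ^ S * F y ^ p with hh
  have hhm : Measurable h := by
    refine Measurable.lintegral_prod_right ?_
    fun_prop
  have hpt : ∀ x ∈ ball x₀ r, ∫⁻ y in ball x₀ t, k (x - y) * (γ y * F y) ≤
      ((N * V) ^ (1 / S - e) * Ψ ^ (1 / p - e) * (K₀ * v) ^ e) * h x ^ e := by
    intro x hx
    have hxt : x ∈ ball x₀ t := ball_subset_ball hrt hx
    have h1 := lintegral_mul_mul_le_young (μ := volume.restrict (ball x₀ t)) hS0 hp0 hsp hQS hQp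
      (f := fun y => k (x - y)) (g := F) (h := γ) (hk.comp (measurable_const.sub measurable_id))
      hF hγ
    refine h1.trans ?_
    have h2 := (hks.setLIntegral_rpow_le hk hst hxt (D := ball x₀ t) subset_rfl).1
    calc _ ≤ h x ^ e * (N * V) ^ (1 / S - e) * Ψ ^ (1 / p - e) * (K₀ * v) ^ e := by
          gcongr
      _ = _ := by ring
  have hhint : ∫⁻ x in ball x₀ r, h x ≤ N * V * Ψ := by
    calc ∫⁻ x in ball x₀ r, h x
        = ∫⁻ y in ball x₀ t, ∫⁻ x in ball x₀ r, k (x - y) ^ S * F y ^ p := by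
          refine lintegral_lintegral_swap (Measurable.aemeasurable ?_)
          fun_prop
      _ ≤ ∫⁻ y in ball x₀ t, N * V * F y ^ p := by
          refine setLIntegral_mono' measurableSet_ball fun y hy => ?_
          rw [lintegral_mul_const _ (by fun_prop)]
          gcongr
          exact (hks.setLIntegral_rpow_le hk hst hy (ball_subset_ball hrt)).2
      _ = _ := lintegral_const_mul _ (hF.pow_const _)
  have hε1 : (1 + ε).HolderConjugate ((1 + ε) / ε) := by
    have := Real.HolderConjugate.conjExponent (show (1 : ℝ) < 1 + ε by linarith)
    rwa [Real.conjExponent, add_sub_cancel_left] at this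
  have hpe : p * e * ((1 + ε) / ε) = 1 := by
    rw [he, hQ]; field_simp
  -- Reverse Hölder on B(x₀, r) produces v^{-e}, which cancels against v^e from the moment of γ:
  -- this is why that moment must have the size of the small ball.
  have hhw : (∫⁻ x in ball x₀ r, (h x ^ e) ^ p * w x) ^ (1 / p) ≤
      (N * V * Ψ) ^ e * ((Kr : ℝ≥0∞) ^ (1 / p - e) * (m ^ (1 / p) * (v ^ e)⁻¹)) := by
    have h1 : ∫⁻ x in ball x₀ r, (h x ^ e) ^ p * w x ≤
        (N * V * Ψ) ^ (e * p) * (Kr * (m / v) ^ ε * m) ^ (1 / (1 + ε)) := by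
      refine (ENNReal.lintegral_mul_le_Lp_mul_Lq _ hε1.symm
        ((hhm.pow_const _).pow_const _).aemeasurable hw.aemeasurable).trans ?_
      have e1 : 1 / ((1 + ε) / ε) = e * p := by
        rw [he, hQ]; field_simp
      rw [e1]
      have e2 : ∀ x, ((h x ^ e) ^ p) ^ ((1 + ε) / ε) = h x := by
        intro x
        rw [← ENNReal.rpow_mul, ← ENNReal.rpow_mul, show e * (p * ((1 + ε) / ε)) = 1 by linarith,
          ENNReal.rpow_one]
      simp_rw [e2]
      refine mul_le_mul' (ENNReal.rpow_le_rpow hhint (by positivity))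
        (ENNReal.rpow_le_rpow (hRH x₀ r hr) (by positivity))
    refine (ENNReal.rpow_le_rpow h1 (by positivity)).trans (le_of_eq ?_)
    have e3 : 1 / (1 + ε) * (1 / p) = 1 / p - e := by
      rw [he, hQ]; field_simp; ring
    have e4 : ε * (1 / p - e) = e := by
      rw [he, hQ]; field_simp; ring
    have e5 : e * p * (1 / p) = e := by field_simp
    rw [ENNReal.mul_rpow_of_nonneg _ _ (by positivity), ← ENNReal.rpow_mul, e5,
      ← ENNReal.rpow_mul, e3, ENNReal.mul_rpow_of_nonneg _ _ he3,
      ENNReal.mul_rpow_of_nonneg _ _ he3, ← ENNReal.rpow_mul, e4,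
      ENNReal.div_rpow_of_nonneg _ _ he0.le]
    have e6 : m ^ (1 / p) = m ^ e * m ^ (1 / p - e) := by
      rw [← ENNReal.rpow_add _ _ hm0 hmt, add_sub_cancel]
    rw [e6, div_eq_mul_inv (m ^ e)]
    ring
  refine (rpow_setLIntegral_le_mul hp0 (hhm.pow_const e) hw measurableSet_ball hpt).trans
    ((mul_le_mul_right hhw _).trans (le_of_eq ?_))
  have e7 : (N * V) ^ (1 / S) = (N * V) ^ (1 / S - e) * (N * V) ^ e := by
    rw [← ENNReal.rpow_add_of_nonneg _ _ he2 he0.le, sub_add_cancel]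
  have e8 : Ψ ^ (1 / p) = Ψ ^ (1 / p - e) * Ψ ^ e := by
    rw [← ENNReal.rpow_add_of_nonneg _ _ he3 he0.le, sub_add_cancel]
  have e9 : v ^ e * (v ^ e)⁻¹ = 1 := ENNReal.mul_inv_cancel
    (by simp [ENNReal.rpow_eq_zero_iff, hv0, hvt]) (ENNReal.rpow_ne_top_of_nonneg he0.le hvt)
  have e10 : 1 - 1 / p = 1 / S := by linarith
  rw [e10, ENNReal.coe_mul, ENNReal.coe_mul, ENNReal.coe_rpow_of_nonneg _ (by positivity),
    ENNReal.coe_rpow_of_nonneg _ he0.le, ENNReal.coe_rpow_of_nonneg _ he3]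
  calc _ = ((N * V) ^ (1 / S - e) * (N * V) ^ e) * (Ψ ^ (1 / p - e) * Ψ ^ e) *
        ((K₀ : ℝ≥0∞) ^ e * (Kr : ℝ≥0∞) ^ (1 / p - e)) * (v ^ e * (v ^ e)⁻¹) * m ^ (1 / p) := by
        rw [ENNReal.mul_rpow_of_nonneg (N * V) Ψ he0.le,
          ENNReal.mul_rpow_of_nonneg (K₀ : ℝ≥0∞) v he0.le]
        ring
    _ = _ := by
        rw [← e7, ← e8, e9, ENNReal.mul_rpow_of_nonneg _ _ (by positivity : 0 ≤ 1 / S)]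
        ring

/-- The localized commutator estimate when `w` is an `A_1` weight and `s' = p`. -/
theorem localCommutatorBound_of_eq (𝕜 : Type*) [RCLike 𝕜] {p : ℝ} {s : ℝ≥0∞} {M C : ℝ≥0}
    (hs : 1 < s) {w k : EuclideanSpace ℝ (Fin n) → ℝ≥0∞} (hp : 1 < p) (hk : Measurable k)
    (hks : IsRoughSize s M k) (hw : Measurable w) (hps : s.conjExponent.toReal = p)
    (hw0 : ∀ᵐ y, 0 < w y ∧ w y < ∞) (hwt : ∀ x r, ∫⁻ y in ball x r, w y ≠ ∞)
    (hC : ∀ x r, 0 < r → ∀ᵐ y ∂(volume.restrict (ball x r)),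
      ∫⁻ y in ball x r, w y ≤ C * volume (ball x r) * w y) :
    ∃ K : ℝ≥0, LocalCommutatorBound 𝕜 p w k (fun x r => wBall w x r ^ (1 / p)) K := by
  have hp0 : 0 < p := by linarith
  have hexp := one_div_toReal_conjExponent (s := s) one_pos (by simpa using hs)
  simp only [ENNReal.ofReal_one, div_one, one_mul] at hexp
  rw [hps, ENNReal.toReal_inv] at hexp
  have hst : s ≠ ∞ := by
    rintro rfl
    simp at hexp
    linarith
  have hsp : 1 / s.toReal + 1 / p = 1 := by rw [hexp]; simp
  obtain ⟨M', hM'⟩ := hks.exists_setLIntegral_le hk le_rfl (by simpa using hs) (q := p)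
    (by rw [← hps]; simp)
  obtain ⟨K₂, hK₂⟩ := (isAInfty_of_A1 hw hwt hC).exists_moment_le 𝕜 zero_le_one (by positivity)
    1 hp.le
  -- The reverse Hölder exponent fixes Q, then Q fixes the truncation level D and the moment
  -- constant K₀, and only then is K₃ available.
  obtain ⟨Q, hQ, hyoung⟩ := exists_young_tail_le hp hst hsp hk hks hw hw0 hwt hC
  obtain ⟨D, K₀, htail⟩ := exists_tail_moment_le n 𝕜 1 hQ
  obtain ⟨K₃, hK₃⟩ := hyoung K₀
  refine ⟨(M' * (1 + D) * (2 * K₂) + K₃) * C ^ (1 / p), fun b c hb hbc F hF x₀ r t hr hrt => ?_⟩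
  have ht : 0 < t := hr.trans_le hrt
  set L := ENNReal.ofReal (1 + Real.log (t / r)) with hL
  have hL1 : 1 ≤ L := one_le_ofReal_one_add_log hr hrt
  set V := volume (ball x₀ t) with hV
  have hV0 : V ≠ 0 := volume_ball_ne_zero x₀ ht
  have hVt : V ≠ ∞ := measure_ball_lt_top.ne
  set W := ∫⁻ y in ball x₀ t, w y with hW
  have hW0 : W ≠ 0 := setLIntegral_ball_ne_zero hw.aemeasurable (hw0.mono fun _ h => h.1) x₀ ht
  have hWt : W ≠ ∞ := hwt x₀ t
  set m := ∫⁻ x in ball x₀ r, w x with hm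
  set Φ := (∫⁻ y in ball x₀ t, F y ^ p * w y) ^ (1 / p) with hΦ
  set Ψ := (∫⁻ y in ball x₀ t, F y ^ p) ^ (1 / p) with hΨ
  set α : EuclideanSpace ℝ (Fin n) → ℝ≥0∞ := fun x => ‖b x - c x₀ r‖ₑ with hα
  have hαm : Measurable α := (hb.sub_const _).enorm
  -- The oscillation in y is at most D * L + γ: the first part is a constant and needs only Hölder,
  -- the second is rare enough for the Young-type bound.
  set γ : EuclideanSpace ℝ (Fin n) → ℝ≥0∞ := fun x => α x - D * L with hγ
  have hγm : Measurable γ := hαm.sub measurable_const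
  -- The A_1 condition bounds w from below by its mean, which turns the unweighted norm of F into
  -- the weighted one.
  have hΨΦ : Ψ ≤ (C : ℝ≥0∞) ^ (1 / p) * V ^ (1 / p) / W ^ (1 / p) * Φ := by
    have h1 : ∫⁻ y in ball x₀ t, F y ^ p ≤ C * V / W * ∫⁻ y in ball x₀ t, F y ^ p * w y := by
      rw [mul_comm, ← mul_div_assoc, ENNReal.le_div_iff_mul_le (Or.inl hW0) (Or.inl hWt)]
      calc (∫⁻ y in ball x₀ t, F y ^ p) * W = ∫⁻ y in ball x₀ t, F y ^ p * W :=
            (lintegral_mul_const _ (hF.pow_const _)).symm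
        _ ≤ ∫⁻ y in ball x₀ t, (F y ^ p * w y) * (C * V) := by
            refine lintegral_mono_ae ?_
            filter_upwards [hC x₀ t ht] with y hy
            calc F y ^ p * W ≤ F y ^ p * (C * V * w y) := by gcongr
              _ = _ := by ring
        _ = _ := lintegral_mul_const _ ((hF.pow_const _).mul hw)
    refine (ENNReal.rpow_le_rpow h1 (by positivity : 0 ≤ 1 / p)).trans (le_of_eq ?_)
    rw [ENNReal.mul_rpow_of_nonneg _ _ (by positivity), ENNReal.div_rpow_of_nonneg _ _
      (by positivity), ENNReal.mul_rpow_of_nonneg _ _ (by positivity)]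
  set T : EuclideanSpace ℝ (Fin n) → ℝ≥0∞ :=
    fun x => ∫⁻ y in ball x₀ t, k (x - y) * (γ y * F y) with hT
  have hTm : Measurable T := by
    refine Measurable.lintegral_prod_right ?_
    fun_prop
  set G := M' * V ^ (1 - 1 / p) * Ψ * (1 + D) with hG
  have hpt : ∀ x ∈ ball x₀ r, commAvg b k F x₀ t x ≤ G * (L + α x) + T x := by
    intro x hx
    have hxt : x ∈ ball x₀ t := ball_subset_ball hrt hx
    have hkx : Measurable fun y => k (x - y) := hk.comp (measurable_const.sub measurable_id)
    calc commAvg b k F x₀ t x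
        ≤ ∫⁻ y in ball x₀ t, k (x - y) * ((α x + α y) * F y) := commAvg_le (c x₀ r) x₀ t x
      _ ≤ ∫⁻ y in ball x₀ t, (k (x - y) * ((α x + D * L) * F y) + k (x - y) * (γ y * F y)) := by
          refine lintegral_mono fun y => ?_
          rw [← mul_add, ← add_mul]
          refine mul_le_mul_right (mul_le_mul_left ?_ _) _
          rw [add_assoc]
          exact add_le_add le_rfl le_add_tsub
      _ = (∫⁻ y in ball x₀ t, k (x - y) * ((α x + D * L) * F y)) + T x :=
          lintegral_add_left (hkx.mul (hF.const_mul _)) _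
      _ ≤ G * (L + α x) + T x := by
          gcongr
          have h1 := (hM' x₀ x t hxt (ball x₀ t) measurableSet_ball subset_rfl
            (fun y => (α x + D * L) * F y) (hF.const_mul _)).1
          simp only [ENNReal.rpow_one] at h1
          refine h1.trans ?_
          have h2 : (∫⁻ y in ball x₀ t, ((α x + D * L) * F y) ^ p) ^ (1 / p)
              = (α x + D * L) * Ψ := by
            simp_rw [ENNReal.mul_rpow_of_nonneg _ _ hp0.le]
            rw [lintegral_const_mul _ (hF.pow_const _),
              ENNReal.mul_rpow_of_nonneg _ _ (by positivity), ← ENNReal.rpow_mul,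
              mul_one_div_cancel hp0.ne', ENNReal.rpow_one]
          rw [h2]
          calc M' * V ^ (1 - 1 / p) * ((α x + D * L) * Ψ)
              ≤ M' * V ^ (1 - 1 / p) * (((1 + D) * (L + α x)) * Ψ) := by
                gcongr
                rw [add_mul, one_mul]
                exact add_le_add le_add_self (by gcongr; exact le_self_add)
            _ = _ := by rw [hG]; ring
  have hK2 := hK₂ b c hb hbc x₀ r r hr le_rfl L
  rw [withDensity_apply _ measurableSet_ball, setLIntegral_mul_withDensity hw
      ((hαm.const_add _).pow_const _) measurableSet_ball, div_self hr.ne', Real.log_one, add_zero,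
      ENNReal.ofReal_one] at hK2
  have hTle := hK₃ F γ hF hγm x₀ r t hr hrt (htail b c hb hbc x₀ r t hr hrt)
  calc (∫⁻ x in ball x₀ r, commAvg b k F x₀ t x ^ p * w x) ^ (1 / p)
      ≤ (∫⁻ x in ball x₀ r, (G * (L + α x) + T x) ^ p * w x) ^ (1 / p) := by
        refine ENNReal.rpow_le_rpow (setLIntegral_mono' measurableSet_ball fun x hx => ?_)
          (by positivity)
        exact mul_le_mul_left (ENNReal.rpow_le_rpow (hpt x hx) hp0.le) _
    _ ≤ (∫⁻ x in ball x₀ r, (G * (L + α x)) ^ p * w x) ^ (1 / p) +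
          (∫⁻ x in ball x₀ r, T x ^ p * w x) ^ (1 / p) := by
        have h1 : Measurable fun x => G * (L + α x) := (hαm.const_add _).const_mul _
        rw [← setLIntegral_mul_withDensity (f := fun x => (G * (L + α x) + T x) ^ p) hw
            ((h1.add hTm).pow_const p) measurableSet_ball,
          ← setLIntegral_mul_withDensity hw (h1.pow_const p) measurableSet_ball,
          ← setLIntegral_mul_withDensity hw (hTm.pow_const p) measurableSet_ball]
        exact ENNReal.lintegral_Lp_add_le h1.aemeasurable hTm.aemeasurable hp.le
    _ ≤ G * (K₂ * (L + L) * m ^ (1 / p)) +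
          K₃ * V ^ (1 - 1 / p) * Ψ * m ^ (1 / p) * L := by
        refine add_le_add ?_ (hTle.trans (le_mul_of_one_le_right' hL1))
        refine (rpow_setLIntegral_le_mul hp0 (hαm.const_add _) hw measurableSet_ball
          fun x _ => le_rfl).trans (mul_le_mul_right (hK2.trans ?_) _)
        gcongr
    _ = (M' * (1 + D) * (2 * K₂) + K₃) * (V ^ (1 - 1 / p) * Ψ) * m ^ (1 / p) * L := by
        rw [hG]; ring
    _ ≤ (M' * (1 + D) * (2 * K₂) + K₃) * (V ^ (1 - 1 / p) *
          ((C : ℝ≥0∞) ^ (1 / p) * V ^ (1 / p) / W ^ (1 / p) * Φ)) * m ^ (1 / p) * L := by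
        gcongr
    _ = _ := by
        have hVV : V ^ (1 - 1 / p) * V ^ (1 / p) = V := by
          rw [← ENNReal.rpow_add _ _ hV0 hVt, sub_add_cancel, ENNReal.rpow_one]
        simp only [wBall]
        rw [← hW, ← hm]
        push_cast
        rw [ENNReal.coe_rpow_of_nonneg _ (by positivity : (0 : ℝ) ≤ 1 / p)]
        simp only [div_eq_mul_inv, one_mul] at hVV ⊢
        conv_rhs => rw [← hVV]
        ring

end Endpoint

/-! ### The local commutator estimate for the dual condition. -/

section Dual

variable {n : ℕ}

/-- The localized commutator estimate when `p < s` and `v = w ^ (1 - p')` is an `A_{p' / s'}`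
weight, with `a = p' / s'`. -/
theorem localCommutatorBound_dual (𝕜 : Type*) [RCLike 𝕜] {p : ℝ} {s : ℝ≥0∞} {M C : ℝ≥0}
    (hs : 1 < s) {w v k : EuclideanSpace ℝ (Fin n) → ℝ≥0∞} (hp : 1 < p)
    (hps : ENNReal.ofReal p < s) (hk : Measurable k)
    (hks : IsRoughSize s M k) (hw : Measurable w) (hv : Measurable v) {a q : ℝ}
    (hq : q = (s / ENNReal.ofReal p).conjExponent.toReal)
    (hap : s.conjExponent.toReal * a = p.conjExponent)
    (hdual : ∀ᵐ y, w y ^ (1 / p) * v y ^ (1 / p.conjExponent) = 1)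
    (hwt : ∀ x r, ∫⁻ y in ball x r, w y ≠ ∞)
    (hσ0 : ∀ x r, 0 < r → ∫⁻ y in ball x r, w y ^ q ≠ 0)
    (hσt : ∀ x r, ∫⁻ y in ball x r, w y ^ q ≠ ∞)
    (hvσ : ∀ x r, 0 < r → (∫⁻ y in ball x r, v y) * (∫⁻ y in ball x r, w y ^ q) ^ (a - 1) ≤
      C * volume (ball x r) ^ a)
    {a₁ a₂ : ℝ} (ha₁ : 0 ≤ a₁) (ha₂ : 0 ≤ a₂) {C₁ C₂ : ℝ≥0} (hC₁ : 0 < C₁) (hC₂ : 0 < C₂)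
    (hvA : IsAInfty a₁ C₁ (volume.withDensity v))
    (hσA : IsAInfty a₂ C₂ (volume.withDensity fun y => w y ^ q)) :
    ∃ K : ℝ≥0, LocalCommutatorBound 𝕜 p w k (fun x r => lpBall q w x r ^ (1 / p)) K := by
  have hp0 : 0 < p := by linarith
  have hc : p.HolderConjugate p.conjExponent := Real.HolderConjugate.conjExponent hp
  have hps1 : 1 < s / ENNReal.ofReal p := by
    rwa [ENNReal.lt_div_iff_mul_lt (by simp) (by simp), one_mul]
  have hq1 : 1 ≤ q := hq ▸ one_le_toReal_conjExponent hps1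
  have hq0 : 0 < q := by linarith
  set s₁ := s.conjExponent.toReal with hs₁
  have hs1 : 1 ≤ s₁ := one_le_toReal_conjExponent hs
  have hexp := one_div_toReal_conjExponent hp0 hps
  rw [← hq] at hexp
  have hexp1 := one_div_toReal_conjExponent (s := s) one_pos (by simpa using hs)
  simp only [ENNReal.ofReal_one, div_one, one_mul] at hexp1
  rw [← hs₁] at hexp1
  set p' := p.conjExponent with hp'
  have hp'0 : 0 < p' := hc.symm.pos
  have hpp : 1 / p + 1 / p' = 1 := by
    simpa [one_div] using hc.inv_add_inv_eq_one
  set m := p * q with hm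
  have hm1 : 1 ≤ m := one_le_mul_of_one_le_of_one_le hp.le hq1
  have hm0 : 0 < m := by linarith
  have ha0 : a ≠ 0 := by
    rintro rfl
    simp only [mul_zero] at hap
    linarith
  have e2 : a * (1 / p') = 1 / s₁ := by
    rw [← hap]
    field_simp
  -- With a = p'/s' and 1/q = 1 - p/s, this and `e2` make the A_a condition, raised to the power
  -- 1/p', produce the gauge St.
  have e1 : (a - 1) * (1 / p') = 1 / m := by
    have h2 : 1 / m = 1 / p * (1 / q) := by rw [hm]; field_simp
    rw [sub_mul, e2, h2, hexp, hexp1, one_mul, mul_sub, mul_one, ← mul_assoc,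
      one_div_mul_cancel hp0.ne']
    linarith
  have e3 : (1 - 1 / q) * (1 / p) + 1 / s₁ = 1 := by
    rw [hexp, hexp1]; field_simp; ring
  obtain ⟨M', hM'⟩ := hks.exists_setLIntegral_le hk hp.le hps hq
  obtain ⟨K₁, hK₁⟩ := hσA.exists_moment_le 𝕜 ha₂ hC₂ 1 hm1
  obtain ⟨K₂, hK₂⟩ := hvA.exists_moment_le 𝕜 ha₁ hC₁ 1 hc.symm.lt.le
  refine ⟨M' ^ (1 / p) * K₁ * C ^ (1 / p') * (2 * K₂), fun b c hb hbc F hF x₀ r t hr hrt => ?_⟩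
  have ht : 0 < t := hr.trans_le hrt
  set L := ENNReal.ofReal (1 + Real.log (t / r)) with hL
  have hL1 : 1 ≤ L := one_le_ofReal_one_add_log hr hrt
  set V := volume (ball x₀ t) with hV
  have hV0 : V ≠ 0 := volume_ball_ne_zero x₀ ht
  have hVt : V ≠ ∞ := measure_ball_lt_top.ne
  set Sr := (∫⁻ y in ball x₀ r, w y ^ q) ^ (1 / m) with hSr
  set St := (∫⁻ y in ball x₀ t, w y ^ q) ^ (1 / m) with hSt
  have hSt0 : St ≠ 0 := by simp [hSt, ENNReal.rpow_eq_zero_iff, hσ0 x₀ t ht, hσt x₀ t]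
  have hStt : St ≠ ∞ := ENNReal.rpow_ne_top_of_nonneg (by positivity) (hσt x₀ t)
  set Φ := (∫⁻ y in ball x₀ t, F y ^ p * w y) ^ (1 / p) with hΦ
  set α : EuclideanSpace ℝ (Fin n) → ℝ≥0∞ := fun x => ‖b x - c x₀ r‖ₑ with hα
  have hαm : Measurable α := (hb.sub_const _).enorm
  have hvt : (∫⁻ y in ball x₀ t, v y) ^ (1 / p') ≤
      (C : ℝ≥0∞) ^ (1 / p') * V ^ (1 / s₁) / St := by
    rw [ENNReal.le_div_iff_mul_le (Or.inl hSt0) (Or.inl hStt)]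
    have h2 := ENNReal.rpow_le_rpow (hvσ x₀ t ht) (show 0 ≤ 1 / p' by positivity)
    rwa [ENNReal.mul_rpow_of_nonneg _ _ (by positivity), ← ENNReal.rpow_mul, e1,
      ENNReal.mul_rpow_of_nonneg _ _ (by positivity), ← ENNReal.rpow_mul, e2] at h2
  set G := (M' : ℝ≥0∞) ^ (1 / p) * V ^ ((1 - 1 / q) * (1 / p)) * K₁ * Sr with hG
  -- For fixed y, Hölder in x over the small ball puts k^p in L_{s/p} and w in L_q; only Sr, the
  -- gauge at radius r, appears.
  have hinner : ∀ y ∈ ball x₀ t,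
      (∫⁻ x in ball x₀ r, (k (x - y) * ((α x + α y) * F y)) ^ p * w x) ^ (1 / p) ≤
        G * (F y * (1 + α y)) := by
    intro y hy
    have h1 := (hM' x₀ y t hy (ball x₀ r) measurableSet_ball (ball_subset_ball hrt)
      (fun x => (α y + α x) ^ p * w x) (((hαm.const_add _).pow_const _).mul hw)).2
    have h2 := hK₁ b c hb hbc x₀ r r hr le_rfl (α y)
    rw [withDensity_apply _ measurableSet_ball, setLIntegral_mul_withDensity (hw.pow_const q)
      ((hαm.const_add _).pow_const _) measurableSet_ball, div_self hr.ne', Real.log_one, add_zero,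
      ENNReal.ofReal_one] at h2
    calc (∫⁻ x in ball x₀ r, (k (x - y) * ((α x + α y) * F y)) ^ p * w x) ^ (1 / p)
        = (F y ^ p * ∫⁻ x in ball x₀ r, k (x - y) ^ p * ((α y + α x) ^ p * w x)) ^ (1 / p) := by
          rw [← lintegral_const_mul _ (by fun_prop)]
          congr 2
          funext x
          rw [ENNReal.mul_rpow_of_nonneg _ _ hp0.le, ENNReal.mul_rpow_of_nonneg _ _ hp0.le,
            add_comm (α x)]
          ring
      _ = F y * (∫⁻ x in ball x₀ r, k (x - y) ^ p * ((α y + α x) ^ p * w x)) ^ (1 / p) := by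
          rw [ENNReal.mul_rpow_of_nonneg _ _ (by positivity), ← ENNReal.rpow_mul,
            mul_one_div_cancel hp0.ne', ENNReal.rpow_one]
      _ ≤ F y * (M' * V ^ (1 - 1 / q) *
            (∫⁻ x in ball x₀ r, ((α y + α x) ^ p * w x) ^ q) ^ (1 / q)) ^ (1 / p) := by
          refine mul_le_mul_right (ENNReal.rpow_le_rpow h1 (by positivity)) _
      _ = F y * ((M' : ℝ≥0∞) ^ (1 / p) * V ^ ((1 - 1 / q) * (1 / p)) *
            (∫⁻ x in ball x₀ r, (α y + α x) ^ m * w x ^ q) ^ (1 / m)) := by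
          rw [ENNReal.mul_rpow_of_nonneg _ _ (by positivity), ENNReal.mul_rpow_of_nonneg _ _
            (by positivity), ← ENNReal.rpow_mul, ← ENNReal.rpow_mul,
            show 1 / q * (1 / p) = 1 / m by rw [hm]; field_simp]
          simp_rw [ENNReal.mul_rpow_of_nonneg _ _ hq0.le, ← ENNReal.rpow_mul]
          rfl
      _ ≤ F y * ((M' : ℝ≥0∞) ^ (1 / p) * V ^ ((1 - 1 / q) * (1 / p)) *
            (K₁ * (α y + 1) * Sr)) := by
          exact mul_le_mul_right (mul_le_mul_right h2 _) _
      _ = _ := by rw [hG]; ring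
  have : IsFiniteMeasure ((volume.withDensity w).restrict (ball x₀ r)) := by
    refine ⟨?_⟩
    rw [Measure.restrict_apply_univ, withDensity_apply _ measurableSet_ball]
    exact (hwt x₀ r).lt_top
  -- Since p < s, k^p can be integrated in x, so the norm is moved inside the integral in y before
  -- Hölder is applied.
  have hmink : (∫⁻ x in ball x₀ r, commAvg b k F x₀ t x ^ p * w x) ^ (1 / p) ≤
      ∫⁻ y in ball x₀ t, G * (F y * (1 + α y)) := by
    calc (∫⁻ x in ball x₀ r, commAvg b k F x₀ t x ^ p * w x) ^ (1 / p)
        ≤ (∫⁻ x in ball x₀ r, (∫⁻ y in ball x₀ t, k (x - y) * ((α x + α y) * F y)) ^ p * w x)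
            ^ (1 / p) := by
          refine ENNReal.rpow_le_rpow (lintegral_mono fun x => ?_) (by positivity)
          exact mul_le_mul_left (ENNReal.rpow_le_rpow (commAvg_le (c x₀ r) x₀ t x) hp0.le) _
      _ = (∫⁻ x in ball x₀ r, (∫⁻ y in ball x₀ t, k (x - y) * ((α x + α y) * F y)) ^ p
            ∂(volume.withDensity w)) ^ (1 / p) := by
          rw [setLIntegral_mul_withDensity hw _ measurableSet_ball]
          refine Measurable.pow_const (Measurable.lintegral_prod_right ?_) _
          fun_prop
      _ ≤ ∫⁻ y in ball x₀ t, (∫⁻ x in ball x₀ r, (k (x - y) * ((α x + α y) * F y)) ^ p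
            ∂(volume.withDensity w)) ^ (1 / p) := by
          refine lintegral_rpow_lintegral_le _ _ hp (f := fun x y => k (x - y) * ((α x + α y) * F y)) ?_
          unfold Function.uncurry
          fun_prop
      _ ≤ _ := by
          refine setLIntegral_mono' measurableSet_ball fun y hy => ?_
          rw [setLIntegral_mul_withDensity hw (by fun_prop) measurableSet_ball]
          exact hinner y hy
  -- The remaining oscillation in y is integrated against v = w^{1-p'}, for which John–Nirenberg
  -- holds.
  have hhol : ∫⁻ y in ball x₀ t, F y * (1 + α y) ≤
      Φ * (∫⁻ y in ball x₀ t, (1 + α y) ^ p' * v y) ^ (1 / p') := by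
    calc ∫⁻ y in ball x₀ t, F y * (1 + α y)
        = ∫⁻ y in ball x₀ t, (F y * w y ^ (1 / p)) * ((1 + α y) * v y ^ (1 / p')) := by
          refine lintegral_congr_ae (ae_restrict_of_ae ?_)
          filter_upwards [hdual] with y hy
          calc F y * (1 + α y) = F y * (1 + α y) * 1 := (mul_one _).symm
            _ = _ := by rw [← hy]; ring
      _ ≤ _ := ENNReal.lintegral_mul_le_Lp_mul_Lq _ hc
          (hF.mul (hw.pow_const _)).aemeasurable
          ((hαm.const_add _).mul (hv.pow_const _)).aemeasurable
      _ = _ := by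
          congr 2
          · congr 1
            funext y
            rw [ENNReal.mul_rpow_of_nonneg _ _ hp0.le, ← ENNReal.rpow_mul,
              one_div_mul_cancel hp0.ne', ENNReal.rpow_one]
          · congr 1
            funext y
            rw [ENNReal.mul_rpow_of_nonneg _ _ hp'0.le, ← ENNReal.rpow_mul,
              one_div_mul_cancel hp'0.ne', ENNReal.rpow_one]
  have hK2 := hK₂ b c hb hbc x₀ r t hr hrt 1
  rw [withDensity_apply _ measurableSet_ball, setLIntegral_mul_withDensity hv
      ((hαm.const_add _).pow_const _) measurableSet_ball] at hK2
  have hU : ∀ ρ, lpBall q w x₀ ρ ^ (1 / p) = (∫⁻ y in ball x₀ ρ, w y ^ q) ^ (1 / m) := by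
    intro ρ
    rw [lpBall, ← ENNReal.rpow_mul, show 1 / q * (1 / p) = 1 / m by rw [hm]; field_simp]
  simp only [hU]
  calc (∫⁻ x in ball x₀ r, commAvg b k F x₀ t x ^ p * w x) ^ (1 / p)
      ≤ G * ∫⁻ y in ball x₀ t, F y * (1 + α y) := by
        rwa [← lintegral_const_mul _ (by fun_prop)]
    _ ≤ G * (Φ * (K₂ * (L + L) * ((C : ℝ≥0∞) ^ (1 / p') * V ^ (1 / s₁) / St))) := by
        refine mul_le_mul_right (hhol.trans (mul_le_mul_right (hK2.trans ?_) _)) _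
        gcongr
    _ = _ := by
        have hVV : V ^ ((1 - 1 / q) * (1 / p)) * V ^ (1 / s₁) = V := by
          rw [← ENNReal.rpow_add _ _ hV0 hVt, e3, ENNReal.rpow_one]
        rw [hG]
        push_cast
        rw [ENNReal.coe_rpow_of_nonneg _ (by positivity : (0 : ℝ) ≤ 1 / p),
          ENNReal.coe_rpow_of_nonneg _ (by positivity : (0 : ℝ) ≤ 1 / p')]
        rw [← hSr, ← hSt]
        simp only [div_eq_mul_inv, one_mul] at hVV ⊢
        conv_rhs => rw [← hVV]
        ring

end Dual

/-! ### Consequences of the Muckenhoupt conditions. -/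

section Muckenhoupt

variable {n : ℕ} {w : EuclideanSpace ℝ (Fin n) → ℝ≥0∞}

theorem rpow_mul_rpow_dual {a : ℝ} (ha : 1 < a) {x : ℝ≥0∞} (h0 : 0 < x) (ht : x < ∞) :
    x ^ (1 / a) * (x ^ (1 - a.conjExponent)) ^ (1 / a.conjExponent) = 1 := by
  have hc := (Real.HolderConjugate.conjExponent ha).inv_add_inv_eq_one
  have h' : a.conjExponent ≠ 0 := (Real.HolderConjugate.conjExponent ha).symm.pos.ne'
  rw [← ENNReal.rpow_mul, ← ENNReal.rpow_add _ _ h0.ne' ht.ne, sub_mul, one_mul,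
    mul_one_div_cancel h', one_div, one_div, show a⁻¹ + (a.conjExponent⁻¹ - 1) = 0 by linarith,
    ENNReal.rpow_zero]

theorem setLIntegral_ball_mul_le_of_apConst {a : ℝ} (ha : 1 < a) {C : ℝ≥0}
    (h : apConst a w ≤ C) (x : EuclideanSpace ℝ (Fin n)) {r : ℝ} (hr : 0 < r) :
    (∫⁻ y in ball x r, w y) * (∫⁻ y in ball x r, w y ^ (1 - a.conjExponent)) ^ (a - 1) ≤
      C * volume (ball x r) ^ a := by
  set V := volume (ball x r) with hV
  have hV0 : V ≠ 0 := volume_ball_ne_zero x hr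
  have hVt : V ≠ ∞ := measure_ball_lt_top.ne
  have h1 : (⨍⁻ y in ball x r, w y ∂volume) *
      (⨍⁻ y in ball x r, w y ^ (1 - a / (a - 1)) ∂volume) ^ (a - 1) ≤ C := by
    simp only [apConst, iSup_le_iff] at h
    exact h x r hr
  rw [setLAverage_eq, setLAverage_eq, ← hV] at h1
  have h2 : V ^ a = V * V ^ (a - 1) := by
    conv_lhs => rw [show a = 1 + (a - 1) by ring]
    rw [ENNReal.rpow_add _ _ hV0 hVt, ENNReal.rpow_one]
  have h3 : ∀ X Y : ℝ≥0∞, X * Y ^ (a - 1) = (X / V * (Y / V) ^ (a - 1)) * V ^ a := by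
    intro X Y
    have hV1 : V ^ (a - 1) ≠ 0 := by simp [ENNReal.rpow_eq_zero_iff, hV0, hVt]
    have hV2 : V ^ (a - 1) ≠ ∞ := ENNReal.rpow_ne_top_of_nonneg (by linarith) hVt
    rw [ENNReal.div_rpow_of_nonneg _ _ (by linarith), h2]
    calc X * Y ^ (a - 1) = X * Y ^ (a - 1) * (V⁻¹ * V) * ((V ^ (a - 1))⁻¹ * V ^ (a - 1)) := by
          rw [ENNReal.inv_mul_cancel hV0 hVt, ENNReal.inv_mul_cancel hV1 hV2, mul_one, mul_one]
      _ = _ := by simp only [div_eq_mul_inv]; ring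
  rw [h3]
  exact mul_le_mul_left h1 _

/-- An `A_a` weight, `1 < a`, and its dual weight are both `A_∞` weights. -/
theorem MemAp.exists_dual {a : ℝ} (ha : 1 < a) (hw : Measurable w) (h : MemAp a w) :
    ∃ C : ℝ≥0, ∃ C' : ℝ≥0, 0 < C ∧ 0 < C' ∧
      (∀ x r, 0 < r → (∫⁻ y in ball x r, w y) *
        (∫⁻ y in ball x r, w y ^ (1 - a.conjExponent)) ^ (a - 1) ≤ C * volume (ball x r) ^ a) ∧
      (∀ x r, 0 < r → ∫⁻ y in ball x r, w y ^ (1 - a.conjExponent) ≠ 0) ∧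
      (∀ x r, ∫⁻ y in ball x r, w y ^ (1 - a.conjExponent) ≠ ∞) ∧
      IsAInfty a C (volume.withDensity w) ∧
      IsAInfty a.conjExponent C' (volume.withDensity fun y => w y ^ (1 - a.conjExponent)) := by
  have hconst : apConst a w < ∞ := by
    rcases h.2 with h | h
    · exact h.2
    · exact absurd h.1 ha.ne'
  have hc : a.HolderConjugate a.conjExponent := Real.HolderConjugate.conjExponent ha
  obtain ⟨-, hpos, hloc⟩ := h.1
  set C : ℝ≥0 := (apConst a w).toNNReal + 1 with hC
  have hC0 : 0 < C := by positivity
  have hCle : apConst a w ≤ C := by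
    rw [hC, ENNReal.coe_add, ENNReal.coe_toNNReal hconst.ne]
    exact le_self_add
  have hb := fun x r hr => setLIntegral_ball_mul_le_of_apConst ha hCle x (r := r) hr
  have hw0 : ∀ x r, 0 < r → ∫⁻ y in ball x r, w y ≠ 0 := fun x r hr =>
    setLIntegral_ball_ne_zero hw.aemeasurable (hpos.mono fun _ h => h.1) x hr
  have hσm : Measurable fun y => w y ^ (1 - a.conjExponent) := hw.pow_const _
  have hσ0 : ∀ x r, 0 < r → ∫⁻ y in ball x r, w y ^ (1 - a.conjExponent) ≠ 0 := fun x r hr =>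
    setLIntegral_ball_ne_zero hσm.aemeasurable
      (hpos.mono fun _ h => ENNReal.rpow_pos h.1 h.2.ne) x hr
  -- Local integrability of the dual weight is not assumed: it follows from the A_a bound because
  -- the mass of w on a ball is positive.
  have hσt : ∀ x r, ∫⁻ y in ball x r, w y ^ (1 - a.conjExponent) ≠ ∞ := by
    intro x r htop
    rcases le_or_gt r 0 with hr | hr
    · simp [ball_eq_empty.2 hr] at htop
    · have h1 := hb x r hr
      rw [htop, ENNReal.top_rpow_of_pos (by linarith), ENNReal.mul_top (hw0 x r hr), top_le_iff]
        at h1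
      exact ENNReal.mul_ne_top ENNReal.coe_ne_top
        (ENNReal.rpow_ne_top_of_nonneg (by linarith) measure_ball_lt_top.ne) h1
  have hdual : ∀ᵐ y, w y ^ (1 / a) * (w y ^ (1 - a.conjExponent)) ^ (1 / a.conjExponent) = 1 :=
    hpos.mono fun y hy => rpow_mul_rpow_dual ha hy.1 hy.2
  refine ⟨C, C ^ (a.conjExponent - 1), hC0, NNReal.rpow_pos hC0, hb, hσ0, hσt,
    isAInfty_of_dual ha hw hσm (fun x r => (hloc x r).ne) hdual hb,
    isAInfty_of_dual hc.symm.lt hσm hw hσt ?_ fun x r hr => ?_⟩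
  · rw [hc.symm.conjExponent_eq]
    exact hdual.mono fun y hy => by rw [mul_comm]; exact hy
  -- The A_a condition raised to the power a' - 1 is the A_{a'} condition of the dual weight.
  · have ha1 : a - 1 ≠ 0 := by linarith
    have e1 : (a - 1) * (a.conjExponent - 1) = 1 := by
      rw [Real.conjExponent]; field_simp; ring
    have e2 : a * (a.conjExponent - 1) = a.conjExponent := by
      rw [Real.conjExponent]; field_simp; ring
    have h0 : 0 ≤ a.conjExponent - 1 := by linarith [hc.symm.lt]
    have h1 := ENNReal.rpow_le_rpow (hb x r hr) h0
    rwa [ENNReal.mul_rpow_of_nonneg _ _ h0, ENNReal.mul_rpow_of_nonneg _ _ h0, ← ENNReal.rpow_mul,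
      ← ENNReal.rpow_mul, e1, e2, ENNReal.rpow_one, mul_comm, ← ENNReal.coe_rpow_of_nonneg _ h0]
      at h1

theorem IsAInfty.exists_doubling {a : ℝ} {C : ℝ≥0} {ν : Measure (EuclideanSpace ℝ (Fin n))}
    (h : IsAInfty a C ν) (ha : 0 ≤ a) :
    ∃ K : ℝ≥0, ∀ x r, 0 < r → ν (ball x (4 * r)) ≤ K * ν (ball x r) := by
  refine ⟨C * (4 ^ n) ^ a, fun x r hr => ?_⟩
  have h1 := h.measure_ball_le ha hr (by linarith : 0 < 4 * r)
    (ball_subset_ball (x := x) (by linarith : r ≤ 4 * r))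
  rw [mul_div_cancel_right₀ _ hr.ne'] at h1
  refine h1.trans (le_of_eq ?_)
  rw [ENNReal.coe_mul, ENNReal.coe_rpow_of_nonneg _ ha]
  norm_num

/-- The localized commutator estimate and doubling when `w` is an `A_{p / s'}` weight. -/
theorem exists_localCommutatorBound_of_memAp (𝕜 : Type*) [RCLike 𝕜] {p : ℝ} (hp : 1 < p)
    {s : ℝ≥0∞} (hs : 1 < s) {M : ℝ≥0} {k : EuclideanSpace ℝ (Fin n) → ℝ≥0∞} (hk : Measurable k)
    (hks : IsRoughSize s M k) (hw : Measurable w) (h : MemAp (p / s.conjExponent.toReal) w) :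
    ∃ K K₀ : ℝ≥0, LocalCommutatorBound 𝕜 p w k (fun x r => wBall w x r ^ (1 / p)) K ∧
      ∀ x r, 0 < r → wBall w x (4 * r) ^ (1 / p) ≤ K₀ * wBall w x r ^ (1 / p) := by
  have hs1 := one_le_toReal_conjExponent hs
  have hs0 : s.conjExponent.toReal ≠ 0 := by linarith
  have hp0 : 0 < p := by linarith
  obtain ⟨-, hpos, hloc⟩ := h.1
  have hdoub : ∀ {a : ℝ} {C : ℝ≥0}, 0 ≤ a → IsAInfty a C (volume.withDensity w) →
      ∃ K₀ : ℝ≥0, ∀ x r, 0 < r → wBall w x (4 * r) ^ (1 / p) ≤ K₀ * wBall w x r ^ (1 / p) := by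
    intro a C ha hA
    obtain ⟨K, hK⟩ := hA.exists_doubling ha
    refine ⟨K ^ (1 / p), fun x r hr => ?_⟩
    have h1 := hK x r hr
    rw [withDensity_apply _ measurableSet_ball, withDensity_apply _ measurableSet_ball] at h1
    have h2 := ENNReal.rpow_le_rpow h1 (by positivity : 0 ≤ 1 / p)
    rwa [ENNReal.mul_rpow_of_nonneg _ _ (by positivity),
      ← ENNReal.coe_rpow_of_nonneg _ (by positivity)] at h2
  -- The two branches of `MemAp` are the regimes s' < p and s' = p.
  rcases h.2 with ⟨ha, -⟩ | ⟨ha, C, hC⟩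
  · obtain ⟨C, C', hC0, hC'0, hb, hσ0, hσt, hA, hA'⟩ := h.exists_dual ha hw
    have hc := Real.HolderConjugate.conjExponent ha
    obtain ⟨K, hK⟩ := localCommutatorBound_of_lt 𝕜 hs hp hk hks hw (hw.pow_const _) ha
      (by field_simp) (hpos.mono fun y hy => rpow_mul_rpow_dual ha hy.1 hy.2)
      (fun x r hr => setLIntegral_ball_ne_zero hw.aemeasurable (hpos.mono fun _ h => h.1) x hr)
      (fun x r => (hloc x r).ne) hb (by linarith) hc.symm.pos.le hC0 hC'0 hA hA'
    obtain ⟨K₀, hK₀⟩ := hdoub (by linarith) hA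
    exact ⟨K, K₀, hK, hK₀⟩
  · have hC' : ∀ x r, 0 < r → ∀ᵐ y ∂(volume.restrict (ball x r)),
        ∫⁻ y in ball x r, w y ≤ C * volume (ball x r) * w y := by
      intro x r hr
      have hV0 : volume (ball x r) ≠ 0 := volume_ball_ne_zero x hr
      have hVt : volume (ball x r) ≠ ∞ := measure_ball_lt_top.ne
      have h1 := hC x r hr
      rw [setLAverage_eq, ENNReal.div_le_iff hV0 hVt] at h1
      filter_upwards [ae_essInf_le (μ := volume.restrict (ball x r)) (f := w)] with y hy
      calc _ ≤ _ := h1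
        _ ≤ C * w y * volume (ball x r) := by gcongr
        _ = _ := by ring
    have hps : s.conjExponent.toReal = p := ((div_eq_one_iff_eq hs0).1 ha).symm
    obtain ⟨K, hK⟩ := localCommutatorBound_of_eq 𝕜 hs hp hk hks hw hps hpos
      (fun x r => (hloc x r).ne) hC'
    obtain ⟨K₀, hK₀⟩ := hdoub zero_le_one (isAInfty_of_A1 hw (fun x r => (hloc x r).ne) hC')
    exact ⟨K, K₀, hK, hK₀⟩

/-- The localized commutator estimate and doubling when `p < s` and `w ^ (1 - p')` is an `A_{p' / s'}` weight. -/
theorem exists_localCommutatorBound_of_memAp_dual (𝕜 : Type*) [RCLike 𝕜] {p : ℝ} (hp : 1 < p)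
    {s : ℝ≥0∞} (hs : 1 < s) (hps : ENNReal.ofReal p < s) {M : ℝ≥0}
    {k : EuclideanSpace ℝ (Fin n) → ℝ≥0∞} (hk : Measurable k) (hks : IsRoughSize s M k)
    (hw : Measurable w) (hwW : IsWeight w) {q : ℝ}
    (hq : q = (s / ENNReal.ofReal p).conjExponent.toReal)
    (h : MemAp (p.conjExponent / s.conjExponent.toReal) fun x => w x ^ (1 - p.conjExponent)) :
    ∃ K K₀ : ℝ≥0, LocalCommutatorBound 𝕜 p w k (fun x r => lpBall q w x r ^ (1 / p)) K ∧
      (∀ x r, 0 < r → lpBall q w x (4 * r) ^ (1 / p) ≤ K₀ * lpBall q w x r ^ (1 / p)) ∧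
      (∀ x r, 0 < r → lpBall q w x r ≠ 0) ∧ ∀ x r, lpBall q w x r ≠ ∞ := by
  have hp0 : 0 < p := by linarith
  have hs1 := one_le_toReal_conjExponent hs
  have hs0 : 0 < s.conjExponent.toReal := by linarith
  have hps1 : 1 < s / ENNReal.ofReal p := by
    rwa [ENNReal.lt_div_iff_mul_lt (by simp) (by simp), one_mul]
  have hq1 : 1 ≤ q := hq ▸ one_le_toReal_conjExponent hps1
  have hq0 : 0 < q := by linarith
  have hexp := one_div_toReal_conjExponent hp0 hps
  rw [← hq] at hexp
  have hexp1 := one_div_toReal_conjExponent (s := s) one_pos (by simpa using hs)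
  simp only [ENNReal.ofReal_one, div_one, one_mul] at hexp1
  set s₁ := s.conjExponent.toReal with hs₁
  set e := s⁻¹.toReal with he
  have hpe : 0 < 1 - p * e := by rw [← hexp]; positivity
  have hp1 : p - 1 ≠ 0 := by linarith
  set a := p.conjExponent / s₁ with ha
  -- As p < s, this is positive, so no A_1 endpoint arises in the dual case.
  have ha1 : a - 1 = (1 - p * e) / (p - 1) := by
    rw [ha, div_eq_mul_one_div, hexp1, Real.conjExponent]
    field_simp
    ring
  have ha' : 1 < a := by
    have : 0 < a - 1 := by rw [ha1]; exact div_pos hpe (by linarith)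
    linarith
  -- The A_a dual of w^{1-p'} is therefore w^q, the weight behind the gauge.
  have hqe : (1 - p.conjExponent) * (1 - a.conjExponent) = q := by
    have h1 : 1 - a.conjExponent = - (1 / (a - 1)) := by
      rw [Real.conjExponent]; field_simp [show a - 1 ≠ 0 by linarith]; ring
    have h2 : 1 - p.conjExponent = - (1 / (p - 1)) := by
      rw [Real.conjExponent]; field_simp; ring
    have h3 : q = 1 / (1 - p * e) := by rw [← hexp]; simp
    rw [h1, h2, h3, ha1]
    field_simp
  obtain ⟨-, hpos, hloc⟩ := hwW
  have hv := hw.pow_const (1 - p.conjExponent)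
  obtain ⟨C, C', hC0, hC'0, hb, hσ0, hσt, hA, hA'⟩ := h.exists_dual ha' hv
  have hc := Real.HolderConjugate.conjExponent ha'
  simp_rw [← ENNReal.rpow_mul, hqe] at hb hσ0 hσt hA'
  obtain ⟨K, hK⟩ := localCommutatorBound_dual 𝕜 hs hp hps hk hks hw hv hq
    (a := a) (by rw [ha, ← hs₁]; field_simp)
    (hpos.mono fun y hy => rpow_mul_rpow_dual hp hy.1 hy.2) (fun x r => (hloc x r).ne) hσ0 hσt hb
    (by linarith) hc.symm.pos.le hC0 hC'0 hA hA'
  obtain ⟨K₀, hK₀⟩ := hA'.exists_doubling hc.symm.pos.le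
  refine ⟨K, (K₀ ^ (1 / q)) ^ (1 / p), hK, fun x r hr => ?_, fun x r hr => ?_, fun x r => ?_⟩
  · have h1 := hK₀ x r hr
    rw [withDensity_apply _ measurableSet_ball, withDensity_apply _ measurableSet_ball] at h1
    have h2 := ENNReal.rpow_le_rpow (ENNReal.rpow_le_rpow h1 (by positivity : 0 ≤ 1 / q))
      (by positivity : 0 ≤ 1 / p)
    rwa [ENNReal.mul_rpow_of_nonneg _ _ (by positivity),
      ENNReal.mul_rpow_of_nonneg _ _ (by positivity), ← ENNReal.coe_rpow_of_nonneg _ (by positivity),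
      ← ENNReal.coe_rpow_of_nonneg _ (by positivity)] at h2
  · simp [lpBall, ENNReal.rpow_eq_zero_iff, hσ0 x r hr, hσt x r]
  · exact ENNReal.rpow_ne_top_of_nonneg (by positivity) (hσt x r)

end Muckenhoupt

/-! ### The tail of the commutator integral. -/

section Tail

variable {n : ℕ}

/-- Only t between 2ρ and 4ρ are kept; there the integrand is at least its value at 4ρ, and the
interval lies in t > d. -/
theorem inv_ofReal_pow_le_lintegral {ρ d : ℝ} (hρ : 0 < ρ) (hd : d ≤ 2 * ρ)
    (x₀ : EuclideanSpace ℝ (Fin n)) :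
    (ENNReal.ofReal (ρ ^ n))⁻¹ ≤ 4 ^ (n + 1) * volume (ball (0 : EuclideanSpace ℝ (Fin n)) 1) *
      ∫⁻ t in Ioi d, (ENNReal.ofReal t * volume (ball x₀ t))⁻¹ := by
  set V := volume (ball (0 : EuclideanSpace ℝ (Fin n)) 1) with hV
  have hV0 : V ≠ 0 := volume_ball_ne_zero _ one_pos
  have hVt : V ≠ ∞ := measure_ball_lt_top.ne
  set R := ENNReal.ofReal ρ with hR
  have hR0 : R ≠ 0 := by simpa [hR] using hρ
  have hRt : R ≠ ∞ := ENNReal.ofReal_ne_top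
  set X := 4 ^ (n + 1) * V * R with hX
  have h4 : (4 : ℝ≥0∞) ^ (n + 1) ≠ ∞ := ENNReal.pow_ne_top (by simp)
  have hX0 : X ≠ 0 := mul_ne_zero (mul_ne_zero (by simp) hV0) hR0
  have hXt : X ≠ ∞ := ENNReal.mul_ne_top (ENNReal.mul_ne_top h4 hVt) hRt
  have h4R : ENNReal.ofReal (4 * ρ) = 4 * R := by
    rw [ENNReal.ofReal_mul (by norm_num)]; simp [hR]
  have hlow : (X * R ^ n)⁻¹ * R ≤ ∫⁻ t in Ioi d, (ENNReal.ofReal t * volume (ball x₀ t))⁻¹ := by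
    calc (X * R ^ n)⁻¹ * R ≤ (X * R ^ n)⁻¹ * volume (Ioo (2 * ρ) (4 * ρ)) := by
          rw [Real.volume_Ioo]
          exact mul_le_mul_right (ENNReal.ofReal_le_ofReal (by linarith)) _
      _ = ∫⁻ _t in Ioo (2 * ρ) (4 * ρ), (X * R ^ n)⁻¹ := (setLIntegral_const _ _).symm
      _ ≤ ∫⁻ t in Ioo (2 * ρ) (4 * ρ), (ENNReal.ofReal t * volume (ball x₀ t))⁻¹ := by
          refine setLIntegral_mono' measurableSet_Ioo fun t ht => ENNReal.inv_le_inv.2 ?_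
          have ht0 : 0 < t := by linarith [ht.1]
          rw [volume_ball_eq x₀ ht0]
          calc _ ≤ 4 * R * ((4 * R) ^ n * V) := by
                rw [← h4R]
                gcongr <;> exact ht.2.le
            _ = _ := by rw [hX, mul_pow, pow_succ]; ring
      _ ≤ _ := lintegral_mono_set fun t ht => hd.trans_lt ht.1
  calc (ENNReal.ofReal (ρ ^ n))⁻¹ = (X * X⁻¹) * (R ^ n)⁻¹ := by
        rw [ENNReal.mul_inv_cancel hX0 hXt, one_mul, ENNReal.ofReal_pow hρ.le]
    _ = 4 ^ (n + 1) * V * ((X * R ^ n)⁻¹ * R) := by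
        rw [ENNReal.mul_inv (Or.inl hX0) (Or.inl hXt)]
        rw [hX]; ring
    _ ≤ _ := by gcongr

variable {𝕜 : Type*} [RCLike 𝕜]

/-- The varying domain of integration becomes an indicator of {|y - x₀| < t}, jointly measurable in
y and t. -/
theorem measurable_uncurry_commAvg {b : EuclideanSpace ℝ (Fin n) → 𝕜}
    {k F : EuclideanSpace ℝ (Fin n) → ℝ≥0∞} (hb : Measurable b) (hk : Measurable k)
    (hF : Measurable F) (x₀ : EuclideanSpace ℝ (Fin n)) :
    Measurable (Function.uncurry fun (x : EuclideanSpace ℝ (Fin n)) (t : ℝ) =>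
      commAvg b k F x₀ t x) := by
  set S : Set (ℝ × EuclideanSpace ℝ (Fin n)) := {z | dist z.2 x₀ < z.1} with hS
  have hSm : MeasurableSet S := measurableSet_lt (by fun_prop) (by fun_prop)
  have h1 : (Function.uncurry fun (x : EuclideanSpace ℝ (Fin n)) (t : ℝ) =>
      commAvg b k F x₀ t x) = fun z => ∫⁻ y, S.indicator 1 (z.2, y) *
        (‖b z.1 - b y‖ₑ * k (z.1 - y) * F y) := by
    funext z
    simp only [Function.uncurry, commAvg]
    rw [← lintegral_indicator measurableSet_ball]
    refine lintegral_congr fun y => ?_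
    by_cases hy : dist y x₀ < z.2 <;> simp [indicator, hS, hy]
  rw [h1]
  refine Measurable.lintegral_prod_right' (f := fun z : (EuclideanSpace ℝ (Fin n) × ℝ) ×
    EuclideanSpace ℝ (Fin n) => S.indicator (1 : ℝ × EuclideanSpace ℝ (Fin n) → ℝ≥0∞)
      (z.1.2, z.2) * (‖b z.1.1 - b z.2‖ₑ * k (z.1.1 - z.2) * F z.2)) ?_
  refine Measurable.mul ?_ (by fun_prop)
  exact (measurable_one.indicator hSm).comp (by fun_prop)

/-- The part of the commutator integral outside `B(x₀, 2r)` is an average over `t > r` of the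
integrals over the balls `B(x₀, t)`. -/
theorem lintegral_compl_ball_le {b : EuclideanSpace ℝ (Fin n) → 𝕜}
    {k F : EuclideanSpace ℝ (Fin n) → ℝ≥0∞} (hb : Measurable b) (hk : Measurable k)
    (hF : Measurable F) {x₀ x : EuclideanSpace ℝ (Fin n)} {r : ℝ} (hr : 0 < r)
    (hx : x ∈ ball x₀ r) :
    ∫⁻ y in (ball x₀ (2 * r))ᶜ, ‖b x - b y‖ₑ * (k (x - y) / ENNReal.ofReal (‖x - y‖ ^ n)) * F y ≤
      4 ^ (n + 1) * volume (ball (0 : EuclideanSpace ℝ (Fin n)) 1) *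
        ∫⁻ t in Ioi r, (ENNReal.ofReal t * volume (ball x₀ t))⁻¹ * commAvg b k F x₀ t x := by
  set c := 4 ^ (n + 1) * volume (ball (0 : EuclideanSpace ℝ (Fin n)) 1) with hc
  have hct : c ≠ ∞ :=
    ENNReal.mul_ne_top (ENNReal.pow_ne_top (by simp)) measure_ball_lt_top.ne
  set κ : ℝ → ℝ≥0∞ := fun t => (ENNReal.ofReal t * volume (ball x₀ t))⁻¹ with hκ
  have hκm : Measurable κ := by
    refine (Measurable.mul (by fun_prop) ?_).inv
    refine Monotone.measurable fun s t hst => measure_mono (ball_subset_ball hst)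
  set h : EuclideanSpace ℝ (Fin n) → ℝ≥0∞ := fun y => ‖b x - b y‖ₑ * k (x - y) * F y with hh
  have hhm : Measurable h := by fun_prop
  set S : Set (EuclideanSpace ℝ (Fin n) × ℝ) := {z | dist z.1 x₀ < z.2} with hS
  have hSm : MeasurableSet S := measurableSet_lt (by fun_prop) (by fun_prop)
  calc ∫⁻ y in (ball x₀ (2 * r))ᶜ,
        ‖b x - b y‖ₑ * (k (x - y) / ENNReal.ofReal (‖x - y‖ ^ n)) * F y
      ≤ ∫⁻ y in (ball x₀ (2 * r))ᶜ, c * ∫⁻ t in Ioi r, κ t * (S.indicator 1 (y, t) * h y) := by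
        refine setLIntegral_mono' measurableSet_ball.compl fun y hy => ?_
        rw [mem_compl_iff, mem_ball, not_lt] at hy
        rw [mem_ball] at hx
        have h1 : dist y x₀ ≤ dist y x + dist x x₀ := dist_triangle _ _ _
        have h2 : dist y x = ‖x - y‖ := by rw [dist_comm, dist_eq_norm]
        -- Since |x - x₀| < r ≤ |y - x₀| / 2, one has |y - x₀| ≤ 2|x - y|.
        have h3 := inv_ofReal_pow_le_lintegral (n := n) (ρ := ‖x - y‖) (d := dist y x₀)
          (by linarith) (by linarith) x₀
        have h4 : (∫⁻ t in Ioi (dist y x₀), κ t) * h y ≤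
            ∫⁻ t in Ioi r, κ t * (S.indicator 1 (y, t) * h y) := by
          rw [← lintegral_mul_const _ hκm]
          calc _ = ∫⁻ t in Ioi (dist y x₀), κ t * (S.indicator 1 (y, t) * h y) := by
                refine setLIntegral_congr_fun measurableSet_Ioi fun t ht => ?_
                have : (y, t) ∈ S := ht
                simp [this]
            _ ≤ _ := lintegral_mono_set (Ioi_subset_Ioi (by linarith))
        calc ‖b x - b y‖ₑ * (k (x - y) / ENNReal.ofReal (‖x - y‖ ^ n)) * F y
            = (ENNReal.ofReal (‖x - y‖ ^ n))⁻¹ * h y := by rw [div_eq_mul_inv, hh]; ring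
          _ ≤ (c * ∫⁻ t in Ioi (dist y x₀), κ t) * h y := by gcongr
          _ ≤ _ := by rw [mul_assoc]; gcongr
    _ ≤ ∫⁻ y, c * ∫⁻ t in Ioi r, κ t * (S.indicator 1 (y, t) * h y) :=
        setLIntegral_le_lintegral _ _
    _ = c * ∫⁻ y, ∫⁻ t in Ioi r, κ t * (S.indicator 1 (y, t) * h y) :=
        lintegral_const_mul' _ _ hct
    _ = c * ∫⁻ t in Ioi r, ∫⁻ y, κ t * (S.indicator 1 (y, t) * h y) := by
        rw [lintegral_lintegral_swap]
        refine Measurable.aemeasurable ?_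
        unfold Function.uncurry
        refine Measurable.mul (by fun_prop) (Measurable.mul ?_ (by fun_prop))
        exact (measurable_one.indicator hSm).comp (by fun_prop)
    _ = _ := by
        congr 2
        funext t
        rw [lintegral_const_mul]
        · congr 1
          rw [commAvg, ← lintegral_indicator measurableSet_ball]
          refine lintegral_congr fun y => ?_
          by_cases hy : dist y x₀ < t <;> simp [indicator, hS, hy, hh]
        · refine Measurable.mul ?_ hhm
          exact (measurable_one.indicator hSm).comp (by fun_prop)

/-- The `L_p(w)` norm over `B(x₀, r)` of the part of the commutator integral outside `B(x₀, 2r)`. -/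
theorem LocalCommutatorBound.tail_le {p : ℝ} (hp : 1 < p)
    {w k : EuclideanSpace ℝ (Fin n) → ℝ≥0∞} {U : EuclideanSpace ℝ (Fin n) → ℝ → ℝ≥0∞} {K : ℝ≥0}
    (hK : LocalCommutatorBound 𝕜 p w k U K) (hw : Measurable w) (hk : Measurable k)
    (hwt : ∀ x r, ∫⁻ y in ball x r, w y ≠ ∞) {b : EuclideanSpace ℝ (Fin n) → 𝕜}
    {c : EuclideanSpace ℝ (Fin n) → ℝ → 𝕜} (hb : Measurable b) (hbc : HasMeanOscillationLE 1 b c)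
    {F : EuclideanSpace ℝ (Fin n) → ℝ≥0∞} (hF : Measurable F) {x₀ : EuclideanSpace ℝ (Fin n)}
    {r : ℝ} (hr : 0 < r) (hUt : U x₀ r ≠ ∞) :
    (∫⁻ x in ball x₀ r, (∫⁻ y in (ball x₀ (2 * r))ᶜ,
      ‖b x - b y‖ₑ * (k (x - y) / ENNReal.ofReal (‖x - y‖ ^ n)) * F y) ^ p * w x) ^ (1 / p) ≤
      4 ^ (n + 1) * volume (ball (0 : EuclideanSpace ℝ (Fin n)) 1) * K *
        (U x₀ r * ∫⁻ t in Ioi r, ENNReal.ofReal (1 + Real.log (t / r)) *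
          ((∫⁻ y in ball x₀ t, F y ^ p * w y) ^ (1 / p) / U x₀ t) / ENNReal.ofReal t) := by
  have hp0 : 0 < p := by linarith
  set κ : ℝ → ℝ≥0∞ := fun t => (ENNReal.ofReal t * volume (ball x₀ t))⁻¹ with hκ
  have hκm : Measurable κ := by
    refine (Measurable.mul (by fun_prop) ?_).inv
    refine Monotone.measurable fun s t hst => measure_mono (ball_subset_ball hst)
  have hm : Measurable (Function.uncurry fun (x : EuclideanSpace ℝ (Fin n)) (t : ℝ) =>
      κ t * commAvg b k F x₀ t x) :=
    (hκm.comp measurable_snd).mul (measurable_uncurry_commAvg hb hk hF x₀)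
  have : IsFiniteMeasure ((volume.withDensity w).restrict (ball x₀ r)) := by
    refine ⟨?_⟩
    rw [Measure.restrict_apply_univ, withDensity_apply _ measurableSet_ball]
    exact (hwt x₀ r).lt_top
  refine (rpow_setLIntegral_le_mul hp0 (hm.lintegral_prod_right (ν := volume.restrict (Ioi r))) hw
    measurableSet_ball fun x hx => lintegral_compl_ball_le hb hk hF hr hx).trans ?_
  rw [mul_assoc _ (K : ℝ≥0∞)]
  refine mul_le_mul_right ?_ _
  rw [← setLIntegral_mul_withDensity hw ((hm.lintegral_prod_right).pow_const p) measurableSet_ball]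
  refine (lintegral_rpow_lintegral_le _ _ hp hm).trans ?_
  rw [← lintegral_const_mul' _ _ hUt, ← lintegral_const_mul' _ _ ENNReal.coe_ne_top]
  refine setLIntegral_mono' measurableSet_Ioi fun t ht => ?_
  have ht0 : 0 < t := hr.trans ht
  rw [setLIntegral_mul_withDensity hw (by
    exact ((hm.comp (measurable_id.prodMk measurable_const))).pow_const p) measurableSet_ball]
  have h1 : (∫⁻ x in ball x₀ r, (κ t * commAvg b k F x₀ t x) ^ p * w x) ^ (1 / p) ≤
      κ t * (∫⁻ x in ball x₀ r, commAvg b k F x₀ t x ^ p * w x) ^ (1 / p) :=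
    rpow_setLIntegral_le_mul hp0 (measurable_commAvg hb hk hF x₀ t) hw measurableSet_ball
      fun x _ => le_rfl
  refine h1.trans ((mul_le_mul_right (hK b c hb hbc F hF x₀ r t hr (le_of_lt ht)) _).trans ?_)
  -- The volume factor of the local estimate cancels that of the averaging kernel, leaving dt / t.
  have hV : volume (ball x₀ t) * (volume (ball x₀ t))⁻¹ = 1 :=
    ENNReal.mul_inv_cancel (volume_ball_ne_zero x₀ ht0) measure_ball_lt_top.ne
  simp only [hκ]
  rw [ENNReal.mul_inv (Or.inl (by simpa using ht0)) (Or.inl ENNReal.ofReal_ne_top)]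
  refine le_of_eq (Eq.trans ?_ (mul_one _))
  rw [← hV]
  simp only [div_eq_mul_inv]
  ring

/-- The local part of the operator is controlled by the same tail integral. -/
theorem le_mul_lintegral_tail {U Φ : ℝ → ℝ≥0∞} (hU : Monotone U) (hΦ : Monotone Φ) {K : ℝ≥0}
    {r : ℝ} (hr : 0 < r) (hU0 : U r ≠ 0) (hUt : U (4 * r) ≠ ∞) (hK : U (4 * r) ≤ K * U r) :
    Φ (2 * r) ≤ 2 * K * (U r * ∫⁻ t in Ioi r, ENNReal.ofReal (1 + Real.log (t / r)) *
      (Φ t / U t) / ENNReal.ofReal t) := by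
  have h4 : U r ≤ U (4 * r) := hU (by linarith)
  have hU40 : U (4 * r) ≠ 0 := fun h => hU0 (by simpa [h] using h4)
  set R := ENNReal.ofReal r with hR
  have hR0 : R ≠ 0 := by simpa [hR] using hr
  have hRt : R ≠ ∞ := ENNReal.ofReal_ne_top
  -- Bound the integrand from below on 2r < t < 4r: there Φ t ≥ Φ (2r), U t ≤ U (4r) and the
  -- logarithmic factor is at least 1.
  have hI : Φ (2 * r) / U (4 * r) / (4 * R) * (2 * R) ≤
      ∫⁻ t in Ioi r, ENNReal.ofReal (1 + Real.log (t / r)) * (Φ t / U t) / ENNReal.ofReal t := by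
    calc Φ (2 * r) / U (4 * r) / (4 * R) * (2 * R)
        = ∫⁻ _t in Ioo (2 * r) (4 * r), Φ (2 * r) / U (4 * r) / (4 * R) := by
          rw [setLIntegral_const, Real.volume_Ioo, show 4 * r - 2 * r = 2 * r by ring,
            ENNReal.ofReal_mul (by norm_num)]
          simp [hR]
      _ ≤ ∫⁻ t in Ioo (2 * r) (4 * r), ENNReal.ofReal (1 + Real.log (t / r)) *
            (Φ t / U t) / ENNReal.ofReal t := by
          refine setLIntegral_mono' measurableSet_Ioo fun t ht => ?_
          have h1 : (1 : ℝ≥0∞) ≤ ENNReal.ofReal (1 + Real.log (t / r)) :=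
            one_le_ofReal_one_add_log hr (by linarith [ht.1])
          have h2 : ENNReal.ofReal t ≤ 4 * R := by
            rw [show 4 * R = ENNReal.ofReal (4 * r) by
              rw [ENNReal.ofReal_mul (by norm_num)]; simp [hR]]
            exact ENNReal.ofReal_le_ofReal ht.2.le
          calc Φ (2 * r) / U (4 * r) / (4 * R) = 1 * (Φ (2 * r) / U (4 * r)) / (4 * R) := by
                rw [one_mul]
            _ ≤ _ := ENNReal.div_le_div (mul_le_mul' h1
                (ENNReal.div_le_div (hΦ ht.1.le) (hU ht.2.le))) h2
      _ ≤ _ := lintegral_mono_set fun t ht => by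
          rw [mem_Ioi]; linarith [ht.1]
  calc Φ (2 * r) = 2 * (U (4 * r) * (Φ (2 * r) / U (4 * r) / (4 * R) * (2 * R))) := by
        have e1 : (4 * R)⁻¹ * (4 * R) = 1 :=
          ENNReal.inv_mul_cancel (mul_ne_zero (by simp) hR0) (ENNReal.mul_ne_top (by simp) hRt)
        have e2 : (U (4 * r))⁻¹ * U (4 * r) = 1 := ENNReal.inv_mul_cancel hU40 hUt
        calc Φ (2 * r) = Φ (2 * r) * ((U (4 * r))⁻¹ * U (4 * r)) * ((4 * R)⁻¹ * (4 * R)) := by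
              rw [e1, e2, mul_one, mul_one]
          _ = _ := by simp only [div_eq_mul_inv]; ring
    _ ≤ 2 * ((K * U r) * ∫⁻ t in Ioi r, ENNReal.ofReal (1 + Real.log (t / r)) *
          (Φ t / U t) / ENNReal.ofReal t) := by gcongr
    _ = _ := by ring

end Tail

/-! ### Local estimates of the operator. -/

section Operator

variable {n : ℕ} {𝕜 : Type*} [RCLike 𝕜] {p : ℝ} {w : EuclideanSpace ℝ (Fin n) → ℝ≥0∞}

theorem lpwBall_eq_lintegral (hp : 0 < p) (hw : Measurable w) {f : EuclideanSpace ℝ (Fin n) → 𝕜}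
    (hf : AEStronglyMeasurable f volume) (x : EuclideanSpace ℝ (Fin n)) (r : ℝ) :
    lpwBall p w f x r = (∫⁻ y in ball x r, ‖f y‖ₑ ^ p * w y) ^ (1 / p) := by
  rw [lpwBall, eLpNorm_eq_lintegral_rpow_enorm_toReal (by simpa using hp) (by simp),
    ENNReal.toReal_ofReal hp.le, restrict_withDensity measurableSet_ball,
    lintegral_withDensity_eq_lintegral_mul₀ hw.aemeasurable
      ((hf.enorm.pow_const p).mono_measure Measure.restrict_le_self)]
  simp_rw [Pi.mul_apply, mul_comm]

theorem lpwBall_mono (f : EuclideanSpace ℝ (Fin n) → 𝕜) (x : EuclideanSpace ℝ (Fin n)) :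
    Monotone (lpwBall p w f x) := fun _ _ h =>
  eLpNorm_mono_measure _ (Measure.restrict_mono (ball_subset_ball h) le_rfl)

/-- Dividing by a positive upper bound N of the seminorm, instead of the seminorm itself, includes
functions of seminorm zero. The function b' is meant to be a Borel version of b. -/
theorem hasMeanOscillationLE_of_bmoNorm_le {b b' : EuclideanSpace ℝ (Fin n) → 𝕜}
    (hbb : b =ᵐ[volume] b') {N : ℝ≥0} (hN : 0 < N) (h : bmoNorm b ≤ N) :
    HasMeanOscillationLE 1 (fun y => ((N : ℝ)⁻¹ : 𝕜) * b' y)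
      (fun x r => ((N : ℝ)⁻¹ : 𝕜) * ⨍ z in ball x r, b z) := by
  intro x r hr
  have hV0 : volume (ball x r) ≠ 0 := volume_ball_ne_zero x hr
  have hVt : volume (ball x r) ≠ ∞ := measure_ball_lt_top.ne
  simp only [bmoNorm, iSup_le_iff] at h
  have h1 := h x r hr
  rw [setLAverage_eq, ENNReal.div_le_iff hV0 hVt] at h1
  have hNe : ‖((N : ℝ)⁻¹ : 𝕜)‖ₑ = (N : ℝ≥0∞)⁻¹ := by
    rw [← RCLike.ofReal_inv, ← ofReal_norm, RCLike.norm_ofReal, abs_of_nonneg (by positivity),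
      ENNReal.ofReal_inv_of_pos (by exact_mod_cast hN), ENNReal.ofReal_coe_nnreal]
  calc _ = ∫⁻ y in ball x r, (N : ℝ≥0∞)⁻¹ * ‖b y - ⨍ z in ball x r, b z‖ₑ := by
        refine lintegral_congr_ae (ae_restrict_of_ae ?_)
        filter_upwards [hbb] with y hy
        rw [← mul_sub, enorm_mul, hNe, hy]
    _ = (N : ℝ≥0∞)⁻¹ * ∫⁻ y in ball x r, ‖b y - ⨍ z in ball x r, b z‖ₑ :=
        lintegral_const_mul' _ _ (by simpa using hN.ne')
    _ ≤ (N : ℝ≥0∞)⁻¹ * (N * volume (ball x r)) := by gcongr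
    _ = _ := by
        rw [← mul_assoc, ENNReal.inv_mul_cancel (by simpa using hN.ne') (by simp)]
        simp

/-- The basic local estimate of the operator by a tail integral of local norms. -/
theorem lpwBall_apply_le (hp : 1 < p) (hw : Measurable w) (hwt : ∀ x r, ∫⁻ y in ball x r, w y < ∞)
    {Ω : EuclideanSpace ℝ (Fin n) → 𝕜} {k : EuclideanSpace ℝ (Fin n) → ℝ≥0∞} (hk : Measurable k)
    (hkΩ : k =ᵐ[volume] fun z => ‖Ω z‖ₑ) {U : EuclideanSpace ℝ (Fin n) → ℝ → ℝ≥0∞} {K K₀ : ℝ≥0}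
    (hK : LocalCommutatorBound 𝕜 p w k U K) (hUm : ∀ x, Monotone (U x))
    (hU0 : ∀ x r, 0 < r → U x r ≠ 0) (hUt : ∀ x r, U x r ≠ ∞)
    (hK₀ : ∀ x r, 0 < r → U x (4 * r) ≤ K₀ * U x r)
    {b : EuclideanSpace ℝ (Fin n) → 𝕜} (hb : AEStronglyMeasurable b volume) {N' : ℝ≥0}
    (hN' : 0 < N') (hbN : bmoNorm b ≤ N') {D : Submodule 𝕜 (EuclideanSpace ℝ (Fin n) → 𝕜)}
    {T : (EuclideanSpace ℝ (Fin n) → 𝕜) → EuclideanSpace ℝ (Fin n) → 𝕜}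
    (hD : ∀ f, MemLp f (ENNReal.ofReal p) (volume.withDensity w) → f ∈ D)
    (hT : IsSublinearOn D T) {c₀ : ℝ≥0} (hsize : CommutatorSizeCondition Ω b c₀ D T) {N : ℝ≥0∞}
    (hTN : BoundedOnLpw p w T N) {f : EuclideanSpace ℝ (Fin n) → 𝕜} (hfD : f ∈ D)
    (hf : AEStronglyMeasurable f volume) (hfloc : ∀ x r, 0 < r → lpwBall p w f x r < ∞)
    (x₀ : EuclideanSpace ℝ (Fin n)) {r : ℝ} (hr : 0 < r) :
    lpwBall p w (T f) x₀ r ≤ (2 * K₀ * N + c₀ *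
        (4 ^ (n + 1) * volume (ball (0 : EuclideanSpace ℝ (Fin n)) 1) * K) * N') *
      (U x₀ r * ∫⁻ t in Ioi r, ENNReal.ofReal (1 + Real.log (t / r)) *
        (lpwBall p w f x₀ t / U x₀ t) / ENNReal.ofReal t) := by
  have hp0 : 0 < p := by linarith
  have hp1 : 1 ≤ ENNReal.ofReal p := by simpa using hp.le
  have hac : volume.withDensity w ≪ volume := withDensity_absolutelyContinuous _ _
  set I := U x₀ r * ∫⁻ t in Ioi r, ENNReal.ofReal (1 + Real.log (t / r)) *
        (lpwBall p w f x₀ t / U x₀ t) / ENNReal.ofReal t with hI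
  set B := ball x₀ (2 * r) with hB
  have hBm : MeasurableSet B := measurableSet_ball
  set f₁ := B.indicator f with hf₁
  set f₂ := Bᶜ.indicator f with hf₂
  have hff : f₁ + f₂ = f := indicator_self_add_compl B f
  have he₁ : eLpNorm f₁ (ENNReal.ofReal p) (volume.withDensity w) = lpwBall p w f x₀ (2 * r) :=
    eLpNorm_indicator_eq_eLpNorm_restrict hBm
  have hm₁ : MemLp f₁ (ENNReal.ofReal p) (volume.withDensity w) :=
    ⟨(hf.mono_ac hac).indicator hBm, by rw [he₁]; exact hfloc x₀ _ (by linarith)⟩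
  have hD₁ : f₁ ∈ D := hD f₁ hm₁
  -- The outer part need not be in L_p(w); it is in D as the difference of f and the inner part.
  have hD₂ : f₂ ∈ D := by
    have : f₂ = f - f₁ := by rw [← hff]; simp
    rw [this]; exact D.sub_mem hfD hD₁
  have hT₁ := hT.aestronglyMeasurable f₁ hD₁
  have hT₂ := hT.aestronglyMeasurable f₂ hD₂
  have hrac : (volume.withDensity w).restrict (ball x₀ r) ≪ volume :=
    Measure.restrict_le_self.absolutelyContinuous.trans hac
  have hsplit : lpwBall p w (T f) x₀ r ≤ lpwBall p w (T f₁) x₀ r + lpwBall p w (T f₂) x₀ r := by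
    have h1 : ∀ᵐ x ∂((volume.withDensity w).restrict (ball x₀ r)),
        ‖T f x‖ ≤ ‖T f₁ x‖ + ‖T f₂ x‖ := by
      have := hT.add_le f₁ hD₁ f₂ hD₂
      rw [hff] at this
      exact hrac.ae_le this
    refine (eLpNorm_mono_ae_real h1).trans ((eLpNorm_add_le (hT₁.mono_ac hrac).norm
      (hT₂.mono_ac hrac).norm hp1).trans (le_of_eq ?_))
    rw [eLpNorm_norm, eLpNorm_norm]
    rfl
  have hloc : lpwBall p w (T f₁) x₀ r ≤ N * (2 * K₀ * I) := by
    calc lpwBall p w (T f₁) x₀ r ≤ eLpNorm (T f₁) (ENNReal.ofReal p) (volume.withDensity w) :=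
          eLpNorm_mono_measure _ Measure.restrict_le_self
      _ ≤ N * lpwBall p w f x₀ (2 * r) := he₁ ▸ (hTN f₁ hm₁).2
      _ ≤ _ := mul_le_mul_right (le_mul_lintegral_tail (hUm x₀) (lpwBall_mono f x₀) hr
          (hU0 x₀ r hr) (hUt _ _) (hK₀ x₀ r hr)) _
  have htail : lpwBall p w (T f₂) x₀ r ≤
      c₀ * N' * (4 ^ (n + 1) * volume (ball (0 : EuclideanSpace ℝ (Fin n)) 1) * K * I) := by
    -- The local estimate is stated for oscillation at most 1; the factor N' returns through the
    -- size condition, which is linear in b.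
    set β : EuclideanSpace ℝ (Fin n) → 𝕜 := fun y => ((N' : ℝ)⁻¹ : 𝕜) * hb.mk b y with hβ
    have hβm : Measurable β := (hb.stronglyMeasurable_mk.measurable).const_mul _
    have hβo := hasMeanOscillationLE_of_bmoNorm_le hb.ae_eq_mk hN' hbN
    set F : EuclideanSpace ℝ (Fin n) → ℝ≥0∞ := fun y => ‖hf.mk f y‖ₑ with hF
    have hFm : Measurable F := hf.stronglyMeasurable_mk.measurable.enorm
    have hFf : ∀ t, (∫⁻ y in ball x₀ t, F y ^ p * w y) ^ (1 / p) = lpwBall p w f x₀ t := by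
      intro t
      rw [lpwBall_eq_lintegral hp0 hw hf]
      congr 1
      refine lintegral_congr_ae (ae_restrict_of_ae ?_)
      filter_upwards [hf.ae_eq_mk] with y hy
      rw [hy]
    have h1 := hK.tail_le hp hw hk (fun x r => (hwt x r).ne) hβm hβo hFm hr (hUt x₀ r)
    simp only [hFf] at h1
    set H : EuclideanSpace ℝ (Fin n) → ℝ≥0∞ := fun x => ∫⁻ y in Bᶜ,
      ‖β x - β y‖ₑ * (k (x - y) / ENNReal.ofReal (‖x - y‖ ^ n)) * F y with hH
    have hHm : Measurable H := by
      refine Measurable.lintegral_prod_right ?_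
      refine Measurable.mul (Measurable.mul ?_ (Measurable.div ?_ ?_)) ?_ <;> fun_prop
    have h2 : ∀ᵐ x, x ∈ ball x₀ r → ‖T f₂ x‖ₑ ≤ c₀ * N' * H x := by
      filter_upwards [hsize f₂ hD₂, hb.ae_eq_mk] with x hx hbx hxr
      have hxs : x ∉ tsupport f₂ := by
        have h3 : tsupport f₂ ⊆ Bᶜ :=
          closure_minimal support_indicator_subset isOpen_ball.isClosed_compl
        exact fun h => h3 h (ball_subset_ball (by linarith) hxr)
      refine (hx hxs).trans ?_
      rw [mul_assoc]
      refine mul_le_mul_right ?_ _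
      rw [← lintegral_const_mul' _ _ ENNReal.coe_ne_top, ← lintegral_indicator hBm.compl]
      refine lintegral_mono_ae ?_
      have h4 := (measurePreserving_sub_left x).quasiMeasurePreserving.ae hkΩ
      filter_upwards [h4, hb.ae_eq_mk, hf.ae_eq_mk] with y hky hby hfy
      by_cases hy : y ∈ Bᶜ
      · simp only [hf₂, indicator_of_mem hy]
        rw [← hky, hbx, hby, hfy]
        have h5 : ‖hb.mk b x - hb.mk b y‖ₑ = N' * ‖β x - β y‖ₑ := by
          have : hb.mk b x - hb.mk b y = ((N' : ℝ) : 𝕜) * (β x - β y) := by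
            have h0 : ((N' : ℝ) : 𝕜) ≠ 0 := by exact_mod_cast hN'.ne'
            simp only [hβ]
            field_simp
          rw [this, enorm_mul, ← ofReal_norm (((N' : ℝ) : 𝕜)), RCLike.norm_ofReal,
            abs_of_nonneg (by positivity), ENNReal.ofReal_coe_nnreal]
        rw [h5]
        refine le_of_eq ?_
        simp only [hF]
        ring
      · simp [hf₂, indicator_of_notMem hy]
    rw [lpwBall_eq_lintegral hp0 hw hT₂]
    calc (∫⁻ x in ball x₀ r, ‖T f₂ x‖ₑ ^ p * w x) ^ (1 / p)
        ≤ (∫⁻ x in ball x₀ r, (c₀ * N' * H x) ^ p * w x) ^ (1 / p) := by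
          refine ENNReal.rpow_le_rpow (setLIntegral_mono_ae' measurableSet_ball ?_) (by positivity)
          filter_upwards [h2] with x hx hxr
          exact mul_le_mul_left (ENNReal.rpow_le_rpow (hx hxr) hp0.le) _
      _ ≤ c₀ * N' * (∫⁻ x in ball x₀ r, H x ^ p * w x) ^ (1 / p) :=
          rpow_setLIntegral_le_mul hp0 hHm hw measurableSet_ball fun x _ => le_rfl
      _ ≤ _ := mul_le_mul_right h1 _
  refine (hsplit.trans (add_le_add hloc htail)).trans (le_of_eq ?_)
  ring

end Operator

/-! ### Local norms of Morrey functions. -/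

section Morrey

variable {n : ℕ} {𝕜 : Type*} [RCLike 𝕜] {p : ℝ} {w : EuclideanSpace ℝ (Fin n) → ℝ≥0∞}
  {φ : EuclideanSpace ℝ (Fin n) → ℝ → ℝ}

theorem morreyNorm_le_iff (hφ : ∀ x r, 0 < r → 0 < φ x r)
    (hw0 : ∀ x r, 0 < r → wBall w x r ≠ 0) (hwt : ∀ x r, wBall w x r ≠ ∞)
    {f : EuclideanSpace ℝ (Fin n) → 𝕜} {N : ℝ≥0∞} :
    morreyNorm p φ w f ≤ N ↔ ∀ x r, 0 < r →
      lpwBall p w f x r ≤ ENNReal.ofReal (φ x r) * wBall w x r ^ (1 / p) * N := by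
  simp only [morreyNorm, iSup_le_iff]
  refine forall_congr' fun x => forall_congr' fun r => forall_congr' fun hr => ?_
  have h1 : ENNReal.ofReal (φ x r) ≠ 0 := by simpa using hφ x r hr
  have h2 : wBall w x r ^ (1 / p) ≠ 0 := by
    simp [ENNReal.rpow_eq_zero_iff, hw0 x r hr, hwt x r]
  have h3 : wBall w x r ^ (1 / p) ≠ ∞ := by
    simp [ENNReal.rpow_eq_top_iff, hw0 x r hr, hwt x r]
  rw [ENNReal.rpow_neg, ← ENNReal.mul_inv (Or.inl h1) (Or.inl ENNReal.ofReal_ne_top),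
    mul_comm, ← div_eq_mul_inv, ENNReal.div_le_iff (mul_ne_zero h1 h2)
      (ENNReal.mul_ne_top ENNReal.ofReal_ne_top h3), mul_comm N]

/-- The local norm at t is at most the one at any τ > t, hence at most the Morrey norm times φ(x, τ)
w(B(x, τ))^{1/p} for all such τ. -/
theorem lpwBall_le_essInfTail (hφ : ∀ x r, 0 < r → 0 < φ x r)
    (hw0 : ∀ x r, 0 < r → wBall w x r ≠ 0) (hwt : ∀ x r, wBall w x r ≠ ∞)
    {f : EuclideanSpace ℝ (Fin n) → 𝕜} (hf : morreyNorm p φ w f ≠ ∞)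
    (x : EuclideanSpace ℝ (Fin n)) {t : ℝ} (ht : 0 < t) :
    lpwBall p w f x t ≤ morreyNorm p φ w f * essInfTail p φ w x t := by
  have h1 := (morreyNorm_le_iff (p := p) (f := f) hφ hw0 hwt).1 le_rfl
  rcases eq_or_ne (morreyNorm p φ w f) 0 with h0 | h0
  · have h2 := h1 x t ht
    rw [h0, mul_zero] at h2
    exact h2.trans zero_le
  · rw [mul_comm, ← ENNReal.div_le_iff h0 hf]
    refine le_essInf_of_ae_le _ ((ae_restrict_iff' measurableSet_Ioi).2 (.of_forall fun τ hτ => ?_))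
    rw [ENNReal.div_le_iff h0 hf]
    exact (lpwBall_mono f x (le_of_lt hτ)).trans (h1 x τ (ht.trans hτ))

end Morrey

/-! ### Boundedness between Morrey spaces and dependence on b. -/

section Boundedness

variable {n : ℕ} {𝕜 : Type*} [RCLike 𝕜] {p : ℝ} {w : EuclideanSpace ℝ (Fin n) → ℝ≥0∞}

theorem IsWeight.wBall_ne_zero (hw : IsWeight w) (x : EuclideanSpace ℝ (Fin n)) {r : ℝ}
    (hr : 0 < r) : wBall w x r ≠ 0 :=
  setLIntegral_ball_ne_zero hw.aemeasurable (hw.pos_lt_top.mono fun _ h => h.1) x hr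

/-- The operator is bounded between generalized Morrey spaces as soon as the localized commutator
estimate holds with a doubling gauge `U` for which the Zygmund-type condition is satisfied. -/
theorem morreyNorm_apply_le (hp : 1 < p) (hw : Measurable w) (hwW : IsWeight w)
    {Ω : EuclideanSpace ℝ (Fin n) → 𝕜} {k : EuclideanSpace ℝ (Fin n) → ℝ≥0∞} (hk : Measurable k)
    (hkΩ : k =ᵐ[volume] fun z => ‖Ω z‖ₑ) {U : EuclideanSpace ℝ (Fin n) → ℝ → ℝ≥0∞} {K K₀ : ℝ≥0}
    (hK : LocalCommutatorBound 𝕜 p w k U K) (hUm : ∀ x, Monotone (U x))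
    (hU0 : ∀ x r, 0 < r → U x r ≠ 0) (hUt : ∀ x r, U x r ≠ ∞)
    (hK₀ : ∀ x r, 0 < r → U x (4 * r) ≤ K₀ * U x r)
    {φ₁ φ₂ : EuclideanSpace ℝ (Fin n) → ℝ → ℝ} (hφ₁ : ∀ x r, 0 < r → 0 < φ₁ x r)
    (hφ₂ : ∀ x r, 0 < r → 0 < φ₂ x r) {C : ℝ≥0}
    (hZ : ∀ x r, 0 < r → U x r * ∫⁻ t in Ioi r, ENNReal.ofReal (1 + Real.log (t / r)) *
      (essInfTail p φ₁ w x t / U x t) / ENNReal.ofReal t ≤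
        C * (ENNReal.ofReal (φ₂ x r) * wBall w x r ^ (1 / p)))
    {b : EuclideanSpace ℝ (Fin n) → 𝕜} (hb : AEStronglyMeasurable b volume) {N' : ℝ≥0}
    (hN' : 0 < N') (hbN : bmoNorm b ≤ N') {D : Submodule 𝕜 (EuclideanSpace ℝ (Fin n) → 𝕜)}
    {T : (EuclideanSpace ℝ (Fin n) → 𝕜) → EuclideanSpace ℝ (Fin n) → 𝕜}
    (hD : ∀ f, MemLp f (ENNReal.ofReal p) (volume.withDensity w) → f ∈ D)
    (hT : IsSublinearOn D T) {c₀ : ℝ≥0} (hsize : CommutatorSizeCondition Ω b c₀ D T) {N : ℝ≥0∞}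
    (hTN : BoundedOnLpw p w T N) {f : EuclideanSpace ℝ (Fin n) → 𝕜} (hfD : f ∈ D)
    (hf : MemMorrey p φ₁ w f) :
    morreyNorm p φ₂ w (T f) ≤ (2 * K₀ * N + c₀ *
      (4 ^ (n + 1) * volume (ball (0 : EuclideanSpace ℝ (Fin n)) 1) * K) * N') * C *
        morreyNorm p φ₁ w f := by
  have hw0 : ∀ x r, 0 < r → wBall w x r ≠ 0 := fun x r hr => hwW.wBall_ne_zero x hr
  have hwt : ∀ x r, wBall w x r ≠ ∞ := fun x r => (hwW.locallyIntegrable x r).ne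
  rw [morreyNorm_le_iff hφ₂ hw0 hwt]
  intro x r hr
  set G := 2 * K₀ * N + c₀ *
    (4 ^ (n + 1) * volume (ball (0 : EuclideanSpace ℝ (Fin n)) 1) * K) * N'
  set m := morreyNorm p φ₁ w f with hm
  have hmt : m ≠ ∞ := hf.norm_lt_top.ne
  refine (lpwBall_apply_le hp hw hwW.locallyIntegrable hk hkΩ hK hUm hU0 hUt hK₀ hb hN' hbN hD hT
    hsize hTN hfD hf.aestronglyMeasurable hf.locallyLp x hr).trans ?_
  have h1 : ∫⁻ t in Ioi r, ENNReal.ofReal (1 + Real.log (t / r)) *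
      (lpwBall p w f x t / U x t) / ENNReal.ofReal t ≤
      m * ∫⁻ t in Ioi r, ENNReal.ofReal (1 + Real.log (t / r)) *
        (essInfTail p φ₁ w x t / U x t) / ENNReal.ofReal t := by
    rw [← lintegral_const_mul' _ _ hmt]
    refine setLIntegral_mono' measurableSet_Ioi fun t ht => ?_
    calc _ ≤ ENNReal.ofReal (1 + Real.log (t / r)) *
          (m * essInfTail p φ₁ w x t / U x t) / ENNReal.ofReal t := by
          gcongr
          exact lpwBall_le_essInfTail hφ₁ hw0 hwt hmt x (hr.trans ht)
      _ = _ := by simp only [div_eq_mul_inv]; ring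
  calc _ ≤ G * (U x r * (m * ∫⁻ t in Ioi r, ENNReal.ofReal (1 + Real.log (t / r)) *
        (essInfTail p φ₁ w x t / U x t) / ENNReal.ofReal t)) := by gcongr
    _ = G * m * (U x r * ∫⁻ t in Ioi r, ENNReal.ofReal (1 + Real.log (t / r)) *
        (essInfTail p φ₁ w x t / U x t) / ENNReal.ofReal t) := by ring
    _ ≤ G * m * (C * (ENNReal.ofReal (φ₂ x r) * wBall w x r ^ (1 / p))) := by
        exact mul_le_mul_right (hZ x r hr) _
    _ = _ := by ring

theorem memMorrey_apply (hwW : IsWeight w) {φ : EuclideanSpace ℝ (Fin n) → ℝ → ℝ}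
    (hφ : ∀ x r, 0 < r → 0 < φ x r) (hp : 0 < p) {g : EuclideanSpace ℝ (Fin n) → 𝕜}
    (hg : AEStronglyMeasurable g volume) (h : morreyNorm p φ w g < ∞) : MemMorrey p φ w g where
  aestronglyMeasurable := hg
  locallyLp x r hr := by
    have hwt : ∀ x r, wBall w x r ≠ ∞ := fun x r => (hwW.locallyIntegrable x r).ne
    refine ((morreyNorm_le_iff hφ (fun x r hr => hwW.wBall_ne_zero x hr) hwt).1 le_rfl x r
      hr).trans_lt (ENNReal.mul_lt_top (ENNReal.mul_lt_top ENNReal.ofReal_lt_top ?_) h)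
    exact ENNReal.rpow_lt_top_of_nonneg (by positivity) (hwt x r)
  norm_lt_top := h

/-- Boundedness, and the bound linear in the `BMO` seminorm, from the estimates by upper bounds
of the seminorm. -/
theorem bounded_of_forall_morreyNorm_apply_le (hp : 1 < p) (hwW : IsWeight w)
    {φ₁ φ₂ : EuclideanSpace ℝ (Fin n) → ℝ → ℝ} (hφ₂ : ∀ x r, 0 < r → 0 < φ₂ x r)
    {b : EuclideanSpace ℝ (Fin n) → 𝕜} (hb : bmoNorm b < ∞)
    {D : Submodule 𝕜 (EuclideanSpace ℝ (Fin n) → 𝕜)}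
    {T : (EuclideanSpace ℝ (Fin n) → 𝕜) → EuclideanSpace ℝ (Fin n) → 𝕜}
    (hT : IsSublinearOn D T) (hD : ∀ f, MemMorrey p φ₁ w f → f ∈ D) {A G₁ G₂ C : ℝ≥0}
    (hN : ∃ N : ℝ≥0, BoundedOnLpw p w T N)
    (h : ∀ N : ℝ≥0∞, BoundedOnLpw p w T N → ∀ N' : ℝ≥0, 0 < N' → bmoNorm b ≤ N' →
      ∀ f, MemMorrey p φ₁ w f →
        morreyNorm p φ₂ w (T f) ≤ (G₁ * N + G₂ * N') * C * morreyNorm p φ₁ w f) :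
    (∃ K' : ℝ≥0, ∀ f, MemMorrey p φ₁ w f → MemMorrey p φ₂ w (T f) ∧
      morreyNorm p φ₂ w (T f) ≤ K' * morreyNorm p φ₁ w f) ∧
    (BoundedOnLpw p w T (A * bmoNorm b) → ∀ f, MemMorrey p φ₁ w f →
      morreyNorm p φ₂ w (T f) ≤
        ((G₁ * A + G₂) * C : ℝ≥0) * bmoNorm b * morreyNorm p φ₁ w f) := by
  lift bmoNorm b to ℝ≥0 using hb.ne with β hβ
  constructor
  · obtain ⟨N, hN⟩ := hN
    refine ⟨(G₁ * N + G₂ * (β + 1)) * C, fun f hf => ?_⟩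
    have h1 := h N hN (β + 1) (by positivity) (by simp) f hf
    have h2 : morreyNorm p φ₂ w (T f) ≤
        ((G₁ * N + G₂ * (β + 1)) * C : ℝ≥0) * morreyNorm p φ₁ w f := by
      push_cast at h1 ⊢
      exact h1
    refine ⟨memMorrey_apply hwW hφ₂ (by linarith) (hT.aestronglyMeasurable f (hD f hf))
      (h2.trans_lt (ENNReal.mul_lt_top ENNReal.coe_lt_top hf.norm_lt_top)), h2⟩
  · intro hA f hf
    lift morreyNorm p φ₁ w f to ℝ≥0 using hf.norm_lt_top.ne with m hm
    refine ENNReal.le_of_forall_pos_le_add fun ε hε _ => ?_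
    -- The seminorm may vanish while N' must be positive, so N' exceeds it by an amount whose total
    -- contribution is at most ε.
    have h1 := h _ hA (β + ε / (G₂ * C * m + 1)) (by positivity)
      (by rw [ENNReal.coe_le_coe]; exact le_self_add) f hf
    rw [← hm] at h1
    refine h1.trans ?_
    norm_cast
    have h2 : G₂ * C * m * (ε / (G₂ * C * m + 1)) ≤ ε := by
      rw [← mul_div_assoc]
      refine div_le_of_le_mul₀ (by positivity) (by positivity) ?_
      rw [mul_comm]
      gcongr
      exact le_self_add
    calc _ = (G₁ * A + G₂) * C * β * m + G₂ * C * m * (ε / (G₂ * C * m + 1)) := by ring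
      _ ≤ _ := by gcongr

end Boundedness

/-! ### Invariance under change of the weight on a null set, and uniform constants. -/

section Main

variable {n : ℕ} {𝕜 : Type*} [RCLike 𝕜] {p : ℝ} {w w' : EuclideanSpace ℝ (Fin n) → ℝ≥0∞}

theorem wBall_mono (w : EuclideanSpace ℝ (Fin n) → ℝ≥0∞) (x : EuclideanSpace ℝ (Fin n)) :
    Monotone (wBall w x) := fun _ _ h => lintegral_mono_set (ball_subset_ball h)

theorem lpBall_mono {q : ℝ} (hq : 0 ≤ q) (w : EuclideanSpace ℝ (Fin n) → ℝ≥0∞)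
    (x : EuclideanSpace ℝ (Fin n)) : Monotone (lpBall q w x) := fun _ _ h =>
  ENNReal.rpow_le_rpow (lintegral_mono_set (ball_subset_ball h)) (by positivity)

theorem wBall_congr (h : w =ᵐ[volume] w') : wBall w = wBall w' := by
  funext x r
  exact lintegral_congr_ae (ae_restrict_of_ae h)

theorem lpBall_congr (h : w =ᵐ[volume] w') (q : ℝ) : lpBall q w = lpBall q w' := by
  funext x r
  rw [lpBall, lpBall, lintegral_congr_ae (ae_restrict_of_ae (h.mono fun y hy => by
    rw [hy]))]

theorem essInfTail_congr (h : w =ᵐ[volume] w') (p : ℝ) (φ : EuclideanSpace ℝ (Fin n) → ℝ → ℝ) :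
    essInfTail p φ w = essInfTail p φ w' := by
  funext x t
  rw [essInfTail, essInfTail, wBall_congr h]

theorem morreyNorm_congr (h : w =ᵐ[volume] w') (p : ℝ) (φ : EuclideanSpace ℝ (Fin n) → ℝ → ℝ)
    (f : EuclideanSpace ℝ (Fin n) → 𝕜) : morreyNorm p φ w f = morreyNorm p φ w' f := by
  simp only [morreyNorm, lpwBall, wBall_congr h, withDensity_congr_ae h]

theorem memMorrey_congr (h : w =ᵐ[volume] w') (p : ℝ) (φ : EuclideanSpace ℝ (Fin n) → ℝ → ℝ)
    (f : EuclideanSpace ℝ (Fin n) → 𝕜) : MemMorrey p φ w f ↔ MemMorrey p φ w' f := by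
  have h1 : lpwBall p w f = lpwBall p w' f := by
    funext x r; rw [lpwBall, lpwBall, withDensity_congr_ae h]
  have h2 := morreyNorm_congr h p φ f
  constructor <;> rintro ⟨h3, h4, h5⟩
  · exact ⟨h3, h1 ▸ h4, h2 ▸ h5⟩
  · exact ⟨h3, h1 ▸ h4, h2 ▸ h5⟩

theorem IsWeight.congr (h : w =ᵐ[volume] w') (hw : IsWeight w) : IsWeight w' where
  aemeasurable := hw.aemeasurable.congr h
  pos_lt_top := by filter_upwards [h, hw.pos_lt_top] with y hy h1; rwa [← hy]
  locallyIntegrable x r := (lintegral_congr_ae (ae_restrict_of_ae h)) ▸ hw.locallyIntegrable x r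

theorem MemAp.congr {q : ℝ} (h : w =ᵐ[volume] w') (hw : MemAp q w) : MemAp q w' := by
  have h1 : ∀ x r, ⨍⁻ y in ball x r, w y ∂volume = ⨍⁻ y in ball x r, w' y ∂volume := fun x r => by
    rw [setLAverage_eq, setLAverage_eq, lintegral_congr_ae (ae_restrict_of_ae h)]
  have h2 : ∀ x r, ⨍⁻ y in ball x r, w y ^ (1 - q / (q - 1)) ∂volume =
      ⨍⁻ y in ball x r, w' y ^ (1 - q / (q - 1)) ∂volume := fun x r => by
    rw [setLAverage_eq, setLAverage_eq, lintegral_congr_ae (ae_restrict_of_ae (h.mono fun y hy => by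
      rw [hy]))]
  refine ⟨hw.1.congr h, hw.2.imp (fun h3 => ⟨h3.1, ?_⟩) fun ⟨h3, C, hC⟩ => ⟨h3, C, ?_⟩⟩
  · have := h3.2
    simp only [apConst, h1, h2] at this ⊢
    exact this
  · intro x r hr
    rw [← h1, ← essInf_congr_ae (ae_restrict_of_ae h)]
    exact hC x r hr

/-- The constants are fixed before b, φ₁, φ₂ and T, so they depend only on the kernel, the weight,
c₀ and the exponents. The Muckenhoupt condition comes after them as a premise, hence the case
distinction on it, trivial when it fails. -/
theorem exists_morreyNorm_le_of_memAp [Nontrivial (EuclideanSpace ℝ (Fin n))] (hp : 1 < p)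
    {s : ℝ≥0∞} (hs : 1 < s) {Ω : EuclideanSpace ℝ (Fin n) → 𝕜} (hΩ : IsRoughKernel s Ω)
    (hwm : Measurable w) (hw : IsWeight w) (c₀ C : ℝ≥0) :
    ∃ G₁ G₂ : ℝ≥0, ∀ (b : EuclideanSpace ℝ (Fin n) → 𝕜)
      (φ₁ φ₂ : EuclideanSpace ℝ (Fin n) → ℝ → ℝ)
      (D : Submodule 𝕜 (EuclideanSpace ℝ (Fin n) → 𝕜))
      (T : (EuclideanSpace ℝ (Fin n) → 𝕜) → EuclideanSpace ℝ (Fin n) → 𝕜),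
      MemBMO b → IsMorreyFunction φ₁ → IsMorreyFunction φ₂ →
      (∀ f, MemLp f (ENNReal.ofReal p) (volume.withDensity w) → f ∈ D) →
      (∀ f, MemMorrey p φ₁ w f → f ∈ D) →
      IsSublinearOn D T → CommutatorSizeCondition Ω b c₀ D T →
      MemAp (p / s.conjExponent.toReal) w → ZygmundCondition p w φ₁ φ₂ C →
      ∀ N : ℝ≥0∞, BoundedOnLpw p w T N → ∀ N' : ℝ≥0, 0 < N' → bmoNorm b ≤ N' →
      ∀ f, MemMorrey p φ₁ w f →
        morreyNorm p φ₂ w (T f) ≤ (G₁ * N + G₂ * N') * C * morreyNorm p φ₁ w f := by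
  by_cases hA : MemAp (p / s.conjExponent.toReal) w
  swap
  · exact ⟨0, 0, fun b φ₁ φ₂ D T _ _ _ _ _ _ _ h => absurd h hA⟩
  have hp0 : 0 ≤ 1 / p := by positivity
  have hΩm := hΩ.aestronglyMeasurable.enorm
  obtain ⟨M, hM⟩ := hΩ.exists_isRoughSize (by positivity)
  obtain ⟨K, K₀, hK, hK₀⟩ := exists_localCommutatorBound_of_memAp 𝕜 hp hs hΩm.measurable_mk
    (hM.congr hΩm.ae_eq_mk) hwm hA
  refine ⟨2 * K₀, c₀ * (4 ^ (n + 1) *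
    (volume (ball (0 : EuclideanSpace ℝ (Fin n)) 1)).toNNReal * K),
    fun b φ₁ φ₂ D T hb hφ₁ hφ₂ hD hDM hT hsize _ hZ N hN N' hN' hbN f hf => ?_⟩
  have hw0 : ∀ x r, 0 < r → wBall w x r ^ (1 / p) ≠ 0 := fun x r hr => by
    have hwt : wBall w x r ≠ ∞ := (hw.locallyIntegrable x r).ne
    simp [ENNReal.rpow_eq_zero_iff, hw.wBall_ne_zero x hr, hwt]
  have hwt : ∀ x r, wBall w x r ^ (1 / p) ≠ ∞ := fun x r =>
    ENNReal.rpow_ne_top_of_nonneg hp0 (hw.locallyIntegrable x r).ne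
  have h := morreyNorm_apply_le hp hwm hw hΩm.measurable_mk hΩm.ae_eq_mk.symm hK
    (fun x _ _ h => ENNReal.rpow_le_rpow (wBall_mono w x h) hp0) hw0 hwt hK₀ hφ₁.pos hφ₂.pos
    (C := C) (fun x r hr => by
      refine (mul_le_mul_right (hZ x r hr) _).trans (le_of_eq ?_)
      ring) hb.1.aestronglyMeasurable hN' hbN hD hT hsize hN (hDM f hf) hf
  push_cast
  rwa [ENNReal.coe_toNNReal measure_ball_lt_top.ne]

theorem exists_morreyNorm_le_of_memAp_dual [Nontrivial (EuclideanSpace ℝ (Fin n))] (hp : 1 < p)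
    {s : ℝ≥0∞} (hs : 1 < s) {Ω : EuclideanSpace ℝ (Fin n) → 𝕜} (hΩ : IsRoughKernel s Ω)
    (hwm : Measurable w) (hw : IsWeight w) (c₀ C : ℝ≥0) :
    ∃ G₁ G₂ : ℝ≥0, ∀ (b : EuclideanSpace ℝ (Fin n) → 𝕜)
      (φ₁ φ₂ : EuclideanSpace ℝ (Fin n) → ℝ → ℝ)
      (D : Submodule 𝕜 (EuclideanSpace ℝ (Fin n) → 𝕜))
      (T : (EuclideanSpace ℝ (Fin n) → 𝕜) → EuclideanSpace ℝ (Fin n) → 𝕜),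
      MemBMO b → IsMorreyFunction φ₁ → IsMorreyFunction φ₂ →
      (∀ f, MemLp f (ENNReal.ofReal p) (volume.withDensity w) → f ∈ D) →
      (∀ f, MemMorrey p φ₁ w f → f ∈ D) →
      IsSublinearOn D T → CommutatorSizeCondition Ω b c₀ D T →
      ENNReal.ofReal p < s → MemAp (p.conjExponent / s.conjExponent.toReal)
        (fun x => w x ^ (1 - p.conjExponent)) →
      ZygmundConditionLp p (s / ENNReal.ofReal p).conjExponent.toReal w φ₁ φ₂ C →
      ∀ N : ℝ≥0∞, BoundedOnLpw p w T N → ∀ N' : ℝ≥0, 0 < N' → bmoNorm b ≤ N' →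
      ∀ f, MemMorrey p φ₁ w f →
        morreyNorm p φ₂ w (T f) ≤ (G₁ * N + G₂ * N') * C * morreyNorm p φ₁ w f := by
  by_cases hA : ENNReal.ofReal p < s ∧ MemAp (p.conjExponent / s.conjExponent.toReal)
        (fun x => w x ^ (1 - p.conjExponent))
  swap
  · exact ⟨0, 0, fun b φ₁ φ₂ D T _ _ _ _ _ _ _ h h' => absurd ⟨h, h'⟩ hA⟩
  have hp0 : 0 ≤ 1 / p := by positivity
  have hΩm := hΩ.aestronglyMeasurable.enorm
  obtain ⟨M, hM⟩ := hΩ.exists_isRoughSize (by positivity)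
  set q := (s / ENNReal.ofReal p).conjExponent.toReal with hq
  obtain ⟨K, K₀, hK, hK₀, hq0, hqt⟩ := exists_localCommutatorBound_of_memAp_dual 𝕜 hp hs hA.1
    hΩm.measurable_mk (hM.congr hΩm.ae_eq_mk) hwm hw hq hA.2
  refine ⟨2 * K₀, c₀ * (4 ^ (n + 1) *
    (volume (ball (0 : EuclideanSpace ℝ (Fin n)) 1)).toNNReal * K),
    fun b φ₁ φ₂ D T hb hφ₁ hφ₂ hD hDM hT hsize _ _ hZ N hN N' hN' hbN f hf => ?_⟩
  have hU0 : ∀ x r, 0 < r → lpBall q w x r ^ (1 / p) ≠ 0 := fun x r hr => by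
    simp [ENNReal.rpow_eq_zero_iff, hq0 x r hr, hqt x r]
  have hUt : ∀ x r, lpBall q w x r ^ (1 / p) ≠ ∞ := fun x r =>
    ENNReal.rpow_ne_top_of_nonneg hp0 (hqt x r)
  have h := morreyNorm_apply_le hp hwm hw hΩm.measurable_mk hΩm.ae_eq_mk.symm hK
    (fun x _ _ h => ENNReal.rpow_le_rpow (lpBall_mono ENNReal.toReal_nonneg w x h) hp0) hU0 hUt hK₀
    hφ₁.pos hφ₂.pos (C := C) (fun x r hr => by
      refine (mul_le_mul_right (hZ x r hr) _).trans (le_of_eq ?_)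
      rw [mul_left_comm, mul_assoc, ENNReal.mul_div_cancel (hU0 x r hr) (hUt x r)])
    hb.1.aestronglyMeasurable hN' hbN hD hT hsize hN (hDM f hf) hf
  push_cast
  rwa [ENNReal.coe_toNNReal measure_ball_lt_top.ne]

end Main

end RoughMorrey

end

/-! ### The boundedness theorem. -/

theorem theorem4 {𝕜 : Type*} [RCLike 𝕜] (n : ℕ) (hn : 2 ≤ n) (p : ℝ) (hp : 1 < p)
    (s : ℝ≥0∞) (hs : 1 < s) (Ω : EuclideanSpace ℝ (Fin n) → 𝕜)
    (hΩ : RoughMorrey.IsRoughKernel s Ω)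
    (w : EuclideanSpace ℝ (Fin n) → ℝ≥0∞) (hw : RoughMorrey.IsWeight w) (c₀ A C : ℝ≥0) :
    ∃ K : ℝ≥0, ∀ (b : EuclideanSpace ℝ (Fin n) → 𝕜) (φ₁ φ₂ : EuclideanSpace ℝ (Fin n) → ℝ → ℝ)
      (D : Submodule 𝕜 (EuclideanSpace ℝ (Fin n) → 𝕜))
      (T : (EuclideanSpace ℝ (Fin n) → 𝕜) → EuclideanSpace ℝ (Fin n) → 𝕜),
      RoughMorrey.MemBMO b →
      RoughMorrey.IsMorreyFunction φ₁ →
      RoughMorrey.IsMorreyFunction φ₂ →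
      (∀ f, MemLp f (ENNReal.ofReal p) (volume.withDensity w) → f ∈ D) →
      (∀ f, RoughMorrey.MemMorrey p φ₁ w f → f ∈ D) →
      RoughMorrey.IsSublinearOn D T →
      RoughMorrey.CommutatorSizeCondition Ω b c₀ D T →
      (∃ N : ℝ≥0, RoughMorrey.BoundedOnLpw p w T N) →
      ((s.conjExponent.toReal ≤ p ∧ RoughMorrey.MemAp (p / s.conjExponent.toReal) w ∧
          RoughMorrey.ZygmundCondition p w φ₁ φ₂ C) ∨
        (ENNReal.ofReal p < s ∧
          RoughMorrey.MemAp (p.conjExponent / s.conjExponent.toReal)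
            (fun x => w x ^ (1 - p.conjExponent)) ∧
          RoughMorrey.ZygmundConditionLp p (s / ENNReal.ofReal p).conjExponent.toReal
            w φ₁ φ₂ C)) →
      (∃ K' : ℝ≥0, ∀ f, RoughMorrey.MemMorrey p φ₁ w f →
          RoughMorrey.MemMorrey p φ₂ w (T f) ∧
            RoughMorrey.morreyNorm p φ₂ w (T f) ≤ K' * RoughMorrey.morreyNorm p φ₁ w f) ∧
        (RoughMorrey.BoundedOnLpw p w T (A * RoughMorrey.bmoNorm b) →
          ∀ f, RoughMorrey.MemMorrey p φ₁ w f →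
            RoughMorrey.morreyNorm p φ₂ w (T f) ≤
              K * RoughMorrey.bmoNorm b * RoughMorrey.morreyNorm p φ₁ w f) := by
  have : Nontrivial (EuclideanSpace ℝ (Fin n)) := by
    have : Nontrivial (Fin n) := Fin.nontrivial_iff_two_le.2 hn
    infer_instance
  have hae : w =ᵐ[volume] hw.aemeasurable.mk w := hw.aemeasurable.ae_eq_mk
  have hwm : Measurable (hw.aemeasurable.mk w) := hw.aemeasurable.measurable_mk
  -- The weight is only almost everywhere measurable; every notion involved depends on its class
  -- alone, so a Borel version v replaces it.
  generalize hw.aemeasurable.mk w = v at hae hwm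
  have hv : RoughMorrey.IsWeight v := hw.congr hae
  obtain ⟨G₁, G₂, h₁⟩ := RoughMorrey.exists_morreyNorm_le_of_memAp hp hs hΩ hwm hv c₀ C
  obtain ⟨G₃, G₄, h₂⟩ := RoughMorrey.exists_morreyNorm_le_of_memAp_dual hp hs hΩ hwm hv c₀ C
  -- Sums of the constants of both cases, since K is chosen before it is known which case holds.
  refine ⟨((G₁ + G₃) * A + (G₂ + G₄)) * C,
    fun b φ₁ φ₂ D T hb hφ₁ hφ₂ hD hDM hT hsize hN hcase => ?_⟩
  simp only [RoughMorrey.memMorrey_congr hae, RoughMorrey.morreyNorm_congr hae,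
    RoughMorrey.BoundedOnLpw, withDensity_congr_ae hae] at hD hDM hN ⊢
  refine RoughMorrey.bounded_of_forall_morreyNorm_apply_le hp hv hφ₂.pos hb.2 hT hDM hN
    fun N hTN N' hN' hbN f hf => ?_
  rcases hcase with ⟨-, hA, hZ⟩ | ⟨hps, hA, hZ⟩
  · refine (h₁ b φ₁ φ₂ D T hb hφ₁ hφ₂ hD hDM hT hsize (hA.congr hae) ?_ N hTN N' hN' hbN f hf).trans
      ?_
    · simpa only [RoughMorrey.ZygmundCondition, RoughMorrey.essInfTail_congr hae,
        RoughMorrey.wBall_congr hae] using hZ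
    · gcongr <;> exact le_self_add
  · refine (h₂ b φ₁ φ₂ D T hb hφ₁ hφ₂ hD hDM hT hsize hps (hA.congr ?_) ?_ N hTN N' hN' hbN f
      hf).trans ?_
    · filter_upwards [hae] with y hy
      rw [hy]
    · simpa only [RoughMorrey.ZygmundConditionLp, RoughMorrey.essInfTail_congr hae,
        RoughMorrey.wBall_congr hae, RoughMorrey.lpBall_congr hae] using hZ
    · gcongr <;> exact le_add_self
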